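/- Notation. For $\beta\ge 0$, $a,a'>0$ let $\mathfrak A_\beta(a,a')$ be the class of functions $f(z)=\sum_{n\ge0}\hat f(n)z^n$ analytic in the unit disc $\mathbb D$, smooth up to the boundary, with $$|\hat f(n)|\le a'\exp\bigl(-a\,n^{(1+\beta)/(2+\beta)}\bigr),\qquad n\ge 0 .$$ For $d,d'>0$ let $\mathfrak C_\beta(d,d')$ be the class of planar Cauchy transforms $$f(z)=\frac1\pi\int_{\mathbb C}\frac{\varphi(\zeta)}{z-\zeta}\,dm_2(\zeta),\qquad z\in\overline{\mathbb D},$$ of measurable functions $\varphi$ that vanish off $\{1\le|z|<2\}$ and satisfy $|\varphi(z)|\le d'\exp\bigl(-(d(|z|-1))^{-(1+\beta)}\bigr)$ for $1<|z|<2$; here $m_2$ is planar Lebesgue measure. For $K\ge1$ let $\mathfrak A_\beta^K$ (resp. $\mathfrak C_\beta^K$) be the union of $\mathfrak A_\beta(a,a')$ (resp. $\mathfrak C_\beta(a,a')$) over $a,a'\in[K^{-1},K]$. Let $N_f$ be the number of zeros of $f$ in the closed disc $\overline{\mathbb D}$, counted with multiplicity (at every point $z$ of $\overline{\mathbb D}$,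 the multiplicity is the least $k\ge 0$ with $f^{(k)}(z)\ne0$, and $\infty$ if there is no such $k$). Theorem. Let $K\ge 1$. (0) For every $\beta_0>0$ there is $K'\ge1$, depending only on $\beta_0$ and $K$, such that $\mathfrak A_\beta^K\subset\mathfrak C_\beta^{K'}$ and $\mathfrak C_\beta^K\subset\mathfrak A_\beta^{K'}$ for all $0\le\beta\le\beta_0$. (a) There is $c>0$, depending only on $K$, such that if $f\in\mathfrak A_0^K\cup\mathfrak C_0^K$ and $|f(0)|\ge e^{-A}$ with $A\ge1$, then $N_f\le\exp(c\sqrt A)$. (b) For every $\beta_0>0$ there is $c>0$, depending only on $\beta_0$ and $K$, such that if $0<\beta\le\beta_0$, $f\in\mathfrak A_\beta^K\cup\mathfrak C_\beta^K$ and $|f(0)|\ge e^{-A}$ with $A\ge1$, then $$N_f\le\begin{cases}\exp(c\sqrt A), & A\le\beta^{-2},\\ A^{2/\beta+1}\,\beta^{4/\beta+2}\,e^{c/\beta}, & \beta^{-2}\le A\le\beta^{-4},\\ A^{1/\beta+1}\,e^{c/\beta}, & A\ge\beta^{-4}.\end{cases}$$ -/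

import Mathlib

open scoped ContDiff

noncomputable section

namespace Gevrey

/-- The closed unit disc. -/
def closedDisc : Set ℂ := Metric.closedBall (0 : ℂ) 1

/-- The `n`-th Taylor coefficient of `f` at the origin. -/
def taylorCoeff (f : ℂ → ℂ) (n : ℕ) : ℂ := iteratedDeriv n f 0 / (n.factorial : ℂ)

/-- `f` is analytic in the open unit disc, (complex) smooth up to the boundary, and its Taylor
coefficients are bounded by `a' * exp (-a * n ^ ((1 + β) / (2 + β)))`. -/
structure ClassA (β a a' : ℝ) (f : ℂ → ℂ) : Prop where
  analytic : AnalyticOnNhd ℂ f (Metric.ball (0 : ℂ) 1)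
  smooth : ContDiffOn ℂ ∞ f closedDisc
  coeff_le : ∀ n : ℕ,
    ‖taylorCoeff f n‖ ≤ a' * Real.exp (-(a * (n : ℝ) ^ ((1 + β) / (2 + β))))

/-- The weight `ρ_β(x) = exp (-1 / x ^ (1 + β))`, used for `x > 0`. -/
def rho (β x : ℝ) : ℝ := Real.exp (-(1 / x ^ (1 + β)))

/-- On the closed unit disc, `f` is the planar Cauchy transform of a function `φ` that vanishes
off the annulus `1 ≤ |z| < 2` and satisfies `|φ z| ≤ d' * ρ_β (d * (|z| - 1))`
for `1 < |z| < 2`. -/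
def ClassC (β d d' : ℝ) (f : ℂ → ℂ) : Prop :=
  ∃ φ : ℂ → ℂ, Measurable φ ∧
    (∀ z : ℂ, ¬ (1 ≤ ‖z‖ ∧ ‖z‖ < 2) → φ z = 0) ∧
    (∀ z : ℂ, 1 < ‖z‖ → ‖z‖ < 2 → ‖φ z‖ ≤ d' * rho β (d * (‖z‖ - 1))) ∧
    ∀ z ∈ closedDisc, f z = (1 / (Real.pi : ℂ)) * ∫ ζ : ℂ, φ ζ / (z - ζ)

/-- Membership in `ClassA` with both parameters comparable to `1`, with comparison constant `K`. -/
def ClassAComparable (K β : ℝ) (f : ℂ → ℂ) : Prop :=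
  ∃ a ∈ Set.Icc K⁻¹ K, ∃ a' ∈ Set.Icc K⁻¹ K, ClassA β a a' f

/-- Membership in `ClassC` with both parameters comparable to `1`, with comparison constant `K`. -/
def ClassCComparable (K β : ℝ) (f : ℂ → ℂ) : Prop :=
  ∃ d ∈ Set.Icc K⁻¹ K, ∃ d' ∈ Set.Icc K⁻¹ K, ClassC β d d' f

/-- The order of vanishing at `z` of a function smooth on the closed unit disc: the least `k` such
that the `k`-th derivative (relative to the closed disc) does not vanish at `z`, and `⊤` if all
of them vanish. It is `0` where `f z ≠ 0`. -/
def zeroMult (f : ℂ → ℂ) (z : ℂ) : ℕ∞ :=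
  ⨅ (k : ℕ) (_ : iteratedDerivWithin k f closedDisc z ≠ 0), (k : ℕ∞)

/-- The number of zeros of `f` in the closed unit disc, counted with multiplicity (`∞` if there are
infinitely many of them). -/
def zeroCount (f : ℂ → ℂ) : ENNReal :=
  ∑' z : closedDisc, ((zeroMult f z : ℕ∞) : ENNReal)

end Gevrey

end

/-!
The Taylor coefficients of a Cauchy transform are the moments `-π⁻¹ ∫ φ ζ / ζ ^ (n + 1)`. At
distance `y` from the circle the integrand is at most a constant times
`exp (-(d y) ^ (-(1 + β)) - n y / 2)`, and the two terms balance at `y = n ^ (-1 / (2 + β))`.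
Conversely, `z ^ n` is on the closed disc the Cauchy transform of a multiple of `ζ ^ (n + 1)`
supported in an annulus at this distance from the circle, where the bound on the densities and
the bound on the `n`-th coefficient have the same order.

For the zeros, let `m ρ` be the integral of `log (1 / |f|)` over an arc of half-length `ρ`; it is
`O(A)`. If `m ρ` exceeds a multiple of `ρ ^ (-β)`, the Poisson-Jensen inequality makes `f` small
inside the disc near the arc of twice the length, and the maximum principle for a truncated
series, which is bounded in a slightly larger disc, carries this smallness back to that longer
arc: `m (2 ρ) - m ρ ≥ ε ρ (m ρ / ρ ^ 2) ^ ((1 + β) / (2 + β))`. Hence each doubling of `ρ`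
increases `(m ρ) ^ (1 / (2 + β))` by a multiple of `ρ ^ (-β / (2 + β))`, and a start at `ρ = r`
is impossible as soon as the sum of these increments exceeds a multiple of `A ^ (1 / (2 + β))`.
For such an `r`, no boundary point has more than about `r ^ (-(1 + β))` zeros within distance
`r`: so many would make `m r` too large. The number of zeros within distance `r` of a boundary
point is then at most `log (1 / |f|) + O(1)` there, and integrating over the circle gives
`O(A / r)` zeros within distance `r` of the circle. Jensen's inequality bounds the number of the
other zeros by `O(A / r)` too.
-/

namespace Gevrey

open Filter MeasureTheory Metric Set
open scoped Polynomial Topology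

/-! ### Power series that are smooth up to the boundary -/

/-- The sum of the power series with coefficients `c`, studied here on the closed unit disc. -/
noncomputable def seriesSum (c : ℕ → ℂ) (z : ℂ) : ℂ := ∑' n, c n * z ^ n

/-- The binomial moment `∑ₖ (k choose m) |cₖ|`. It dominates the `m`-th derivative of the power
series divided by `m !` on the closed unit disc, and takes the value `∞` if the series diverges. -/
noncomputable def binomMoment (m : ℕ) (c : ℕ → ℂ) : ENNReal :=
  ∑' k, (k.choose m : ENNReal) * ‖c k‖ₑ

/-- Sequences that decay faster than every power of the index, expressed by their moments. Their
power series are smooth up to the unit circle. -/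
def RapidDecay (c : ℕ → ℂ) : Prop := ∀ m, binomMoment m c ≠ ⊤

/-- The coefficients of the derivative of a power series. -/
noncomputable def derivCoeff (c : ℕ → ℂ) (n : ℕ) : ℂ := (n + 1) * c (n + 1)

lemma mem_closedDisc {z : ℂ} : z ∈ closedDisc ↔ ‖z‖ ≤ 1 := by simp [closedDisc]

lemma uniqueDiffOn_closedDisc : UniqueDiffOn ℂ closedDisc := by
  refine uniqueDiffOn_convex_of_isRCLikeNormedField (𝕜 := ℂ) (convex_closedBall 0 1) ?_
  rw [closedDisc, interior_closedBall _ one_ne_zero]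
  exact ⟨0, by simp⟩

section

variable {c : ℕ → ℂ}

lemma RapidDecay.summable_choose_mul_norm (hc : RapidDecay c) (m : ℕ) :
    Summable fun k => (k.choose m : ℝ) * ‖c k‖ :=
  (ENNReal.summable_toReal (hc m)).congr fun k => by simp [ENNReal.toReal_mul]

lemma rapidDecay_of_summable (hc : ∀ m, Summable fun k => (k.choose m : ℝ) * ‖c k‖) :
    RapidDecay c := fun m => by
  have h := (hc m).tsum_ofReal_ne_top
  simpa only [binomMoment, ENNReal.ofReal_mul (Nat.cast_nonneg _), ofReal_norm,
    ENNReal.ofReal_natCast] using h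

lemma RapidDecay.summable_norm (hc : RapidDecay c) : Summable fun k => ‖c k‖ := by
  simpa using hc.summable_choose_mul_norm 0

lemma norm_mul_pow_le (c : ℕ → ℂ) {z : ℂ} (hz : ‖z‖ ≤ 1) (n : ℕ) : ‖c n * z ^ n‖ ≤ ‖c n‖ := by
  rw [norm_mul, norm_pow]
  exact mul_le_of_le_one_right (norm_nonneg _) (pow_le_one₀ (norm_nonneg _) hz)

lemma RapidDecay.summable (hc : RapidDecay c) {z : ℂ} (hz : ‖z‖ ≤ 1) :
    Summable fun n => c n * z ^ n :=
  .of_norm_bounded hc.summable_norm fun n => norm_mul_pow_le c hz n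

lemma RapidDecay.norm_seriesSum_le (hc : RapidDecay c) {z : ℂ} (hz : ‖z‖ ≤ 1) :
    ‖seriesSum c z‖ ≤ (binomMoment 0 c).toReal := by
  have h_moment : (binomMoment 0 c).toReal = ∑' k, ‖c k‖ := by
    rw [binomMoment, ENNReal.tsum_toReal_eq fun k => by simp]
    simp
  rw [h_moment]
  exact tsum_of_norm_bounded hc.summable_norm.hasSum fun n => norm_mul_pow_le c hz n

lemma RapidDecay.continuousOn_seriesSum (hc : RapidDecay c) :
    ContinuousOn (seriesSum c) closedDisc :=
  continuousOn_tsum (fun n => by fun_prop) hc.summable_norm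
    fun n _ hz => norm_mul_pow_le c (mem_closedDisc.1 hz) n

lemma binomMoment_derivCoeff (m : ℕ) (c : ℕ → ℂ) :
    binomMoment m (derivCoeff c) = (m + 1 : ENNReal) * binomMoment (m + 1) c := by
  rw [binomMoment, binomMoment, tsum_eq_zero_add' (f := fun k => (k.choose (m + 1) : ENNReal) * _)
    ENNReal.summable, Nat.choose_zero_succ, Nat.cast_zero, zero_mul, zero_add,
    ← ENNReal.tsum_mul_left]
  refine tsum_congr fun k => ?_
  have h_norm : ‖((k : ℂ) + 1)‖ₑ = (k + 1 : ENNReal) := by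
    rw [← Nat.cast_succ, ← ofReal_norm, Complex.norm_natCast, ENNReal.ofReal_natCast]
    push_cast
    rfl
  have h_choose : ((k + 1 : ENNReal)) * k.choose m = (k + 1).choose (m + 1) * (m + 1) := by
    exact_mod_cast Nat.add_one_mul_choose_eq k m
  rw [derivCoeff, enorm_mul, h_norm, ← mul_assoc, mul_comm (k.choose m : ENNReal), h_choose,
    mul_comm _ ((m : ENNReal) + 1), mul_assoc]

lemma RapidDecay.derivCoeff (hc : RapidDecay c) : RapidDecay (derivCoeff c) := fun m => by
  rw [binomMoment_derivCoeff]
  exact ENNReal.mul_ne_top (by simp) (hc (m + 1))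

lemma norm_pow_succ_sub_linear_le {R : Type*} [NormedCommRing R] [NormOneClass R] {w z : R}
    (hw : ‖w‖ ≤ 1) (hz : ‖z‖ ≤ 1) (n : ℕ) :
    ‖w ^ (n + 1) - z ^ (n + 1) - (n + 1) * z ^ n * (w - z)‖
      ≤ ((n + 1).choose 2 : ℝ) * ‖w - z‖ ^ 2 := by
  induction n with
  | zero => simp
  | succ n ih =>
    have h_split : w ^ (n + 1 + 1) - z ^ (n + 1 + 1) - ((n + 1 : ℕ) + 1) * z ^ (n + 1) * (w - z)
        = w * (w ^ (n + 1) - z ^ (n + 1) - (n + 1) * z ^ n * (w - z))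
          + ((n + 1 : ℕ) * z ^ n) * (w - z) ^ 2 := by
      push_cast; ring
    have h_coeff : ‖((n + 1 : ℕ) : R) * z ^ n‖ ≤ n + 1 :=
      calc ‖((n + 1 : ℕ) : R) * z ^ n‖ ≤ ‖((n + 1 : ℕ) : R)‖ * ‖z‖ ^ n :=
            norm_mul_le_of_le le_rfl (norm_pow_le _ _)
        _ ≤ (n + 1) * 1 := by
            gcongr
            · simpa using Nat.norm_cast_le (α := R) (n + 1)
            · exact pow_le_one₀ (norm_nonneg _) hz
        _ = n + 1 := mul_one _
    have h_choose : ((n + 1 + 1).choose 2 : ℝ) = (n + 1) + (n + 1).choose 2 := by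
      rw [Nat.choose_succ_succ' (n + 1) 1, Nat.choose_one_right]
      push_cast
      rfl
    rw [h_split, h_choose]
    calc _ ≤ ‖w‖ * _ + ‖((n + 1 : ℕ) : R) * z ^ n‖ * ‖w - z‖ ^ 2 :=
          norm_add_le_of_le (norm_mul_le _ _) (norm_mul_le_of_le le_rfl (norm_pow_le _ _))
      _ ≤ 1 * (((n + 1).choose 2 : ℝ) * ‖w - z‖ ^ 2) + (n + 1) * ‖w - z‖ ^ 2 := by gcongr
      _ = _ := by ring

lemma RapidDecay.norm_seriesSum_sub_linear_le (hc : RapidDecay c) {w z : ℂ} (hw : ‖w‖ ≤ 1)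
    (hz : ‖z‖ ≤ 1) :
    ‖seriesSum c w - seriesSum c z - (w - z) * seriesSum (Gevrey.derivCoeff c) z‖
      ≤ (∑' k, (k.choose 2 : ℝ) * ‖c k‖) * ‖w - z‖ ^ 2 := by
  have h_termwise : seriesSum c w - seriesSum c z - (w - z) * seriesSum (Gevrey.derivCoeff c) z
      = ∑' n, c (n + 1) * (w ^ (n + 1) - z ^ (n + 1) - (n + 1) * z ^ n * (w - z)) := by
    have hw_sum := (summable_nat_add_iff 1).2 (hc.summable hw)
    have hz_sum := (summable_nat_add_iff 1).2 (hc.summable hz)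
    rw [seriesSum, seriesSum, seriesSum, (hc.summable hw).tsum_eq_zero_add,
      (hc.summable hz).tsum_eq_zero_add, ← tsum_mul_left]
    simp only [pow_zero, mul_one, add_sub_add_left_eq_sub]
    rw [← hw_sum.tsum_sub hz_sum,
      ← (hw_sum.sub hz_sum).tsum_sub ((hc.derivCoeff.summable hz).mul_left (w - z))]
    refine tsum_congr fun n => ?_
    simp only [Gevrey.derivCoeff]
    ring
  have h_sum := (hc.summable_choose_mul_norm 2).mul_right (‖w - z‖ ^ 2)
  rw [h_termwise, ← tsum_mul_right, h_sum.tsum_eq_zero_add]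
  simp only [Nat.choose_zero_succ, Nat.cast_zero, zero_mul, zero_add]
  refine tsum_of_norm_bounded ((summable_nat_add_iff 1).2 h_sum).hasSum fun n => ?_
  calc _ ≤ ‖c (n + 1)‖ * (((n + 1).choose 2 : ℝ) * ‖w - z‖ ^ 2) :=
        norm_mul_le_of_le le_rfl (norm_pow_succ_sub_linear_le hw hz n)
    _ = _ := by ring

lemma RapidDecay.hasDerivWithinAt_seriesSum (hc : RapidDecay c) {z : ℂ} (hz : ‖z‖ ≤ 1) :
    HasDerivWithinAt (seriesSum c) (seriesSum (Gevrey.derivCoeff c) z) closedDisc z := by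
  rw [hasDerivWithinAt_iff_isLittleO]
  have h_quadratic :
      (fun w => seriesSum c w - seriesSum c z - (w - z) • seriesSum (Gevrey.derivCoeff c) z)
        =O[𝓝[closedDisc] z] fun w => ‖w - z‖ ^ 2 := by
    refine .of_bound (∑' k, (k.choose 2 : ℝ) * ‖c k‖) ?_
    filter_upwards [self_mem_nhdsWithin] with w hw
    simpa using hc.norm_seriesSum_sub_linear_le (mem_closedDisc.1 hw) hz
  exact h_quadratic.trans_isLittleO
    ((Asymptotics.isLittleO_pow_sub_sub z one_lt_two).mono nhdsWithin_le_nhds)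

lemma RapidDecay.derivWithin_seriesSum (hc : RapidDecay c) {z : ℂ} (hz : z ∈ closedDisc) :
    derivWithin (seriesSum c) closedDisc z = seriesSum (Gevrey.derivCoeff c) z :=
  (hc.hasDerivWithinAt_seriesSum (mem_closedDisc.1 hz)).derivWithin (uniqueDiffOn_closedDisc z hz)

lemma RapidDecay.iterate_derivCoeff (hc : RapidDecay c) (n : ℕ) :
    RapidDecay (Gevrey.derivCoeff^[n] c) := by
  induction n generalizing c with
  | zero => exact hc
  | succ _ ih => exact ih hc.derivCoeff

lemma RapidDecay.iteratedDerivWithin_seriesSum (hc : RapidDecay c) (n : ℕ) {z : ℂ}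
    (hz : z ∈ closedDisc) :
    iteratedDerivWithin n (seriesSum c) closedDisc z = seriesSum (Gevrey.derivCoeff^[n] c) z := by
  induction n generalizing z with
  | zero => simp
  | succ n ih =>
    rw [iteratedDerivWithin_succ, derivWithin_congr (fun w hw => ih hw) (ih hz),
      (hc.iterate_derivCoeff n).derivWithin_seriesSum hz, Function.iterate_succ_apply']

lemma RapidDecay.contDiffOn_seriesSum (hc : RapidDecay c) :
    ContDiffOn ℂ ∞ (seriesSum c) closedDisc := by
  rw [contDiffOn_infty]
  intro n
  induction n generalizing c with
  | zero => simpa using hc.continuousOn_seriesSum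
  | succ n ih =>
    rw [Nat.cast_succ, contDiffOn_succ_iff_derivWithin uniqueDiffOn_closedDisc]
    exact ⟨fun z hz => (hc.hasDerivWithinAt_seriesSum (mem_closedDisc.1 hz)).differentiableWithinAt,
      by simp, (ih hc.derivCoeff).congr fun z hz => hc.derivWithin_seriesSum hz⟩

lemma RapidDecay.analyticOnNhd_seriesSum (hc : RapidDecay c) :
    AnalyticOnNhd ℂ (seriesSum c) (ball 0 1) := by
  refine DifferentiableOn.analyticOnNhd (fun z hz => ?_) isOpen_ball
  exact (hc.hasDerivWithinAt_seriesSum (mem_ball_zero_iff.1 hz).le).differentiableWithinAt.mono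
    ball_subset_closedBall

lemma derivCoeff_iterate (c : ℕ → ℂ) (n j : ℕ) :
    derivCoeff^[n] c j = ((j + n).factorial / j.factorial : ℂ) * c (j + n) := by
  induction n generalizing c j with
  | zero => simp [Nat.factorial_ne_zero]
  | succ n ih =>
    rw [Function.iterate_succ_apply, ih, derivCoeff, ← add_assoc, Nat.factorial_succ (j + n)]
    push_cast
    ring

lemma seriesSum_zero (c : ℕ → ℂ) : seriesSum c 0 = c 0 := by
  rw [seriesSum, tsum_eq_single 0 fun n hn => by simp [hn]]
  simp

lemma RapidDecay.taylorCoeff_eq (hc : RapidDecay c) {f : ℂ → ℂ}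
    (hf : EqOn f (seriesSum c) closedDisc) (n : ℕ) : taylorCoeff f n = c n := by
  have h_nhds : closedDisc ∈ 𝓝 (0 : ℂ) := closedBall_mem_nhds _ one_pos
  have h_zero : (0 : ℂ) ∈ closedDisc := mem_closedDisc.2 (by simp)
  have h_within : iteratedDerivWithin n (seriesSum c) closedDisc 0
      = iteratedDeriv n (seriesSum c) 0 :=
    iteratedDerivWithin_eq_iteratedDeriv uniqueDiffOn_closedDisc
      ((hc.contDiffOn_seriesSum.contDiffAt h_nhds).of_le (mod_cast le_top)) h_zero
  rw [taylorCoeff, (hf.eventuallyEq_of_mem h_nhds).iteratedDeriv_eq, ← h_within,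
    hc.iteratedDerivWithin_seriesSum n h_zero, seriesSum_zero, derivCoeff_iterate, zero_add,
    Nat.factorial_zero, Nat.cast_one, div_one, mul_div_cancel_left₀]
  exact_mod_cast n.factorial_ne_zero

end

/-! ### Stretched exponential decay of the coefficients -/

lemma summable_pow_mul_exp_neg_mul_rpow {a s : ℝ} (ha : 0 < a) (hs : 0 < s) (m : ℕ) :
    Summable fun k : ℕ => (k : ℝ) ^ m * Real.exp (-(a * (k : ℝ) ^ s)) := by
  have h_exp : (fun k : ℕ => Real.exp (-(a * (k : ℝ) ^ s)))
      =O[atTop] fun k : ℕ => ((k : ℝ) ^ s) ^ (-((m + 2 : ℕ) / s)) := by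
    simpa only [Function.comp_def, neg_mul] using
      ((isLittleO_exp_neg_mul_rpow_atTop ha _).comp_tendsto
        ((tendsto_rpow_atTop hs).comp tendsto_natCast_atTop_atTop)).isBigO
  refine summable_of_isBigO_nat (Real.summable_nat_pow_inv.2 one_lt_two)
    (((Asymptotics.isBigO_refl _ _).mul h_exp).trans_eventuallyEq ?_)
  filter_upwards [eventually_ge_atTop 1] with k hk
  have hk0 : (0 : ℝ) < k := by exact_mod_cast hk
  rw [← Real.rpow_mul hk0.le, mul_neg, mul_div_cancel₀ _ hs.ne', Real.rpow_neg hk0.le,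
    Real.rpow_natCast, pow_add]
  field_simp

lemma rapidDecay_of_norm_le_exp {c : ℕ → ℂ} {a a' s : ℝ} (ha : 0 < a) (hs : 0 < s)
    (hc : ∀ n : ℕ, ‖c n‖ ≤ a' * Real.exp (-(a * (n : ℝ) ^ s))) : RapidDecay c := by
  refine rapidDecay_of_summable fun m => .of_nonneg_of_le (fun k => by positivity) (fun k => ?_)
    ((summable_pow_mul_exp_neg_mul_rpow ha hs m).mul_left a')
  calc (k.choose m : ℝ) * ‖c k‖ ≤ (k : ℝ) ^ m * (a' * Real.exp (-(a * (k : ℝ) ^ s))) := by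
        gcongr
        · exact_mod_cast Nat.choose_le_pow k m
        · exact hc k
    _ = a' * ((k : ℝ) ^ m * Real.exp (-(a * (k : ℝ) ^ s))) := by ring

lemma exponent_pos {β : ℝ} (hβ : 0 ≤ β) : 0 < (1 + β) / (2 + β) := by positivity

section

variable {β a a' : ℝ} {f : ℂ → ℂ}

lemma ClassA.rapidDecay (hβ : 0 ≤ β) (ha : 0 < a) (hf : ClassA β a a' f) :
    RapidDecay (taylorCoeff f) :=
  rapidDecay_of_norm_le_exp ha (exponent_pos hβ) hf.coeff_le

lemma ClassA.eqOn_seriesSum (hβ : 0 ≤ β) (ha : 0 < a) (hf : ClassA β a a' f) :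
    EqOn f (seriesSum (taylorCoeff f)) closedDisc := by
  have h_ball : EqOn f (seriesSum (taylorCoeff f)) (ball 0 1) := fun z hz => by
    rw [← (Complex.hasSum_taylorSeries_on_ball hf.analytic.differentiableOn hz).tsum_eq, seriesSum]
    refine tsum_congr fun n => ?_
    simp only [sub_zero, smul_eq_mul, taylorCoeff]
    ring
  exact h_ball.of_subset_closure hf.smooth.continuousOn
    (hf.rapidDecay hβ ha).continuousOn_seriesSum ball_subset_closedBall
    (closure_ball (0 : ℂ) one_ne_zero).ge

lemma classA_of_eqOn_seriesSum {c : ℕ → ℂ} (hβ : 0 ≤ β) (ha : 0 < a)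
    (hc : ∀ n : ℕ, ‖c n‖ ≤ a' * Real.exp (-(a * (n : ℝ) ^ ((1 + β) / (2 + β)))))
    (hf : EqOn f (seriesSum c) closedDisc) : ClassA β a a' f := by
  have h_rapid := rapidDecay_of_norm_le_exp ha (exponent_pos hβ) hc
  refine ⟨?_, h_rapid.contDiffOn_seriesSum.congr hf, fun n => ?_⟩
  · exact h_rapid.analyticOnNhd_seriesSum.congr isOpen_ball
      fun z hz => (hf (ball_subset_closedBall hz)).symm
  · rw [h_rapid.taylorCoeff_eq hf]
    exact hc n

end

/-! ### Taylor coefficients of Cauchy transforms -/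

/-- The densities whose Cauchy transforms form `ClassC β d d'`. -/
structure IsDensity (β d d' : ℝ) (φ : ℂ → ℂ) : Prop where
  measurable : Measurable φ
  eq_zero : ∀ z : ℂ, ¬ (1 ≤ ‖z‖ ∧ ‖z‖ < 2) → φ z = 0
  norm_le : ∀ z : ℂ, 1 < ‖z‖ → ‖z‖ < 2 → ‖φ z‖ ≤ d' * rho β (d * (‖z‖ - 1))

/-- The coefficients of the expansion at the origin of the Cauchy transform of `φ`. -/
noncomputable def cauchyCoeff (φ : ℂ → ℂ) (k : ℕ) : ℂ :=
  -(1 / (Real.pi : ℂ)) * ∫ ζ : ℂ, φ ζ / ζ ^ (k + 1)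

lemma rpow_exponent_eq_mul {β t : ℝ} (hβ : 0 ≤ β) (ht : 0 ≤ t) :
    t ^ ((1 + β) / (2 + β)) = t * t ^ (-(1 / (2 + β))) := by
  have h_exponent : 1 + -(1 / (2 + β)) = (1 + β) / (2 + β) := by field_simp; ring
  rw [← Real.rpow_one_add' ht (h_exponent ▸ (exponent_pos hβ).ne'), h_exponent]

lemma rpow_exponent_eq_rpow {β t : ℝ} (ht : 0 ≤ t) :
    t ^ ((1 + β) / (2 + β)) = (t ^ (-(1 / (2 + β)))) ^ (-(1 + β)) := by
  rw [← Real.rpow_mul ht]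
  congr 1
  ring

-- The two terms balance at `y = t ^ (-1 / (2 + β))`, which is where the exponent comes from.
lemma rpow_exponent_le_max {β t y : ℝ} (hβ : 0 ≤ β) (ht : 0 ≤ t) (hy : 0 < y) :
    t ^ ((1 + β) / (2 + β)) ≤ max (t * y) (y ^ (-(1 + β))) := by
  rcases le_total y (t ^ (-(1 / (2 + β)))) with h | h
  · rw [rpow_exponent_eq_rpow ht]
    exact le_max_of_le_right (Real.rpow_le_rpow_of_nonpos hy h (by linarith))
  · rw [rpow_exponent_eq_mul hβ ht]
    exact le_max_of_le_left (mul_le_mul_of_nonneg_left h ht)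

lemma half_mul_le_log_one_add_pow {x : ℝ} (hx0 : 0 ≤ x) (hx2 : x ≤ 2) (k : ℕ) :
    k * (x / 2) ≤ Real.log ((1 + x) ^ k) := by
  rw [Real.log_pow]
  gcongr
  refine le_trans ?_ (Real.le_log_one_add_of_nonneg hx0)
  rw [div_le_div_iff₀ (by norm_num) (by linarith)]
  nlinarith

lemma rho_mul_inv_pow_le {β K d x : ℝ} (hβ : 0 ≤ β) (hK : 1 ≤ K) (hd : 0 < d) (hdK : d ≤ K)
    (hx0 : 0 < x) (hx2 : x ≤ 2) (k : ℕ) :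
    rho β (d * x) * ((1 + x) ^ k)⁻¹
      ≤ Real.exp (-(K⁻¹ / 2 * (k : ℝ) ^ ((1 + β) / (2 + β)))) := by
  have : 0 < K := by linarith
  have h_weight : (K * x) ^ (-(1 + β)) ≤ 1 / (d * x) ^ (1 + β) := by
    rw [one_div, ← Real.rpow_neg (by positivity)]
    exact Real.rpow_le_rpow_of_nonpos (by positivity) (by gcongr) (by linarith)
  have : 0 ≤ 1 / (d * x) ^ (1 + β) := by positivity
  have h_balance : K⁻¹ / 2 * (k : ℝ) ^ ((1 + β) / (2 + β))
      ≤ 1 / (d * x) ^ (1 + β) + k * (x / 2) :=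
    calc K⁻¹ / 2 * (k : ℝ) ^ ((1 + β) / (2 + β))
        ≤ K⁻¹ / 2 * (k * (K * x) + (K * x) ^ (-(1 + β))) := by
          gcongr
          exact (rpow_exponent_le_max hβ k.cast_nonneg (by positivity)).trans
            (max_le_add_of_nonneg (by positivity) (by positivity))
      _ = k * (x / 2) + K⁻¹ / 2 * (K * x) ^ (-(1 + β)) := by field_simp
      _ ≤ k * (x / 2) + 1 * (1 / (d * x) ^ (1 + β)) := by
          gcongr
          linarith [inv_le_one_of_one_le₀ hK]
      _ = _ := by ring
  rw [rho, ← Real.exp_log (show 0 < (1 + x) ^ k by positivity), ← Real.exp_neg, ← Real.exp_add]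
  exact Real.exp_le_exp.2 (by linarith [half_mul_le_log_one_add_pow hx0.le hx2 k])

lemma integrable_indicator_ball (r C : ℝ) :
    Integrable ((ball (0 : ℂ) r).indicator fun _ => C) :=
  (integrable_indicator_iff measurableSet_ball).2
    (integrableOn_const (by simp [Complex.volume_ball, ENNReal.mul_eq_top]) (by simp))

lemma integral_indicator_ball {r : ℝ} (hr : 0 ≤ r) (C : ℝ) :
    ∫ ζ, (ball (0 : ℂ) r).indicator (fun _ => C) ζ = r ^ 2 * Real.pi * C := by
  rw [integral_indicator measurableSet_ball, setIntegral_const, smul_eq_mul, measureReal_def,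
    Complex.volume_ball, ENNReal.toReal_mul, ENNReal.toReal_pow, ENNReal.toReal_ofReal hr,
    ENNReal.coe_toReal, NNReal.coe_real_pi]

lemma ae_norm_ne {r : ℝ} (hr : r ≠ 0) : ∀ᵐ ζ : ℂ, ‖ζ‖ ≠ r := by
  rw [ae_iff]
  convert Measure.addHaar_sphere_of_ne_zero (volume : Measure ℂ) 0 hr using 2
  ext z
  simp

lemma tsum_div_pow_succ {z ζ : ℂ} (hz : ‖z‖ < ‖ζ‖) (w : ℂ) :
    ∑' k : ℕ, -(z ^ k * (w / ζ ^ (k + 1))) = w / (z - ζ) := by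
  have hζ : ζ ≠ 0 := norm_pos_iff.1 ((norm_nonneg z).trans_lt hz)
  have h_ratio : ‖z / ζ‖ < 1 := by rwa [norm_div, div_lt_one ((norm_nonneg z).trans_lt hz)]
  have h_ne : z - ζ ≠ 0 := sub_ne_zero.2 fun h => hz.ne (h ▸ rfl)
  have h_ne' : 1 - z / ζ ≠ 0 := by
    rw [one_sub_div hζ]
    exact div_ne_zero (sub_ne_zero.2 (sub_ne_zero.1 h_ne).symm) hζ
  calc ∑' k : ℕ, -(z ^ k * (w / ζ ^ (k + 1))) = ∑' k : ℕ, -(w / ζ) * (z / ζ) ^ k :=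
        tsum_congr fun k => by rw [div_pow, pow_succ]; field_simp
    _ = -(w / ζ) * (1 - z / ζ)⁻¹ := by rw [tsum_mul_left, tsum_geometric_of_norm_lt_one h_ratio]
    _ = w / (z - ζ) := by
        rw [one_sub_div hζ] at h_ne' ⊢
        rw [← neg_sub ζ z] at h_ne ⊢
        field_simp

section

variable {φ : ℂ → ℂ} {β K d d' : ℝ}

lemma IsDensity.nonneg (hφ : IsDensity β d d' φ) : 0 ≤ d' := by
  have h := (norm_nonneg _).trans (hφ.norm_le (3 / 2) (by norm_num) (by norm_num))
  exact nonneg_of_mul_nonneg_left h (Real.exp_pos _)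

lemma IsDensity.ae_norm_div_pow_le (hφ : IsDensity β d d' φ) (hβ : 0 ≤ β) (hK : 1 ≤ K)
    (hd : 0 < d) (hdK : d ≤ K) (k : ℕ) :
    ∀ᵐ ζ : ℂ, ‖φ ζ / ζ ^ k‖ ≤ (ball (0 : ℂ) 2).indicator
      (fun _ => d' * Real.exp (-(K⁻¹ / 2 * (k : ℝ) ^ ((1 + β) / (2 + β))))) ζ := by
  have hd' := hφ.nonneg
  filter_upwards [ae_norm_ne one_ne_zero] with ζ hζ
  by_cases h : 1 ≤ ‖ζ‖ ∧ ‖ζ‖ < 2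
  · have h_one_lt : 1 < ‖ζ‖ := h.1.lt_of_ne hζ.symm
    have h_rho := rho_mul_inv_pow_le hβ hK hd hdK (sub_pos.2 h_one_lt) (by linarith [h.2]) k
    rw [add_sub_cancel] at h_rho
    rw [indicator_of_mem (by simpa using h.2), norm_div, norm_pow, div_eq_mul_inv]
    calc _ ≤ d' * rho β (d * (‖ζ‖ - 1)) * (‖ζ‖ ^ k)⁻¹ := by
          gcongr
          exact hφ.norm_le ζ h_one_lt h.2
      _ ≤ _ := by
          rw [mul_assoc]
          gcongr
  · rw [hφ.eq_zero ζ h, zero_div, norm_zero]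
    exact indicator_nonneg (fun _ _ => by positivity) _

lemma IsDensity.integrable_div_pow (hφ : IsDensity β d d' φ) (hβ : 0 ≤ β) (hd : 0 < d) (k : ℕ) :
    Integrable fun ζ => φ ζ / ζ ^ k :=
  (integrable_indicator_ball _ _).mono'
    (hφ.measurable.div (measurable_id.pow_const _)).aestronglyMeasurable
    (hφ.ae_norm_div_pow_le hβ (le_max_right d 1) hd (le_max_left d 1) k)

lemma IsDensity.integral_norm_div_pow_le (hφ : IsDensity β d d' φ) (hβ : 0 ≤ β) (hK : 1 ≤ K)
    (hd : 0 < d) (hdK : d ≤ K) (k : ℕ) :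
    ∫ ζ, ‖φ ζ / ζ ^ (k + 1)‖ ≤ 4 * Real.pi *
      (d' * Real.exp (-(K⁻¹ / 2 * (k : ℝ) ^ ((1 + β) / (2 + β))))) := by
  have hd' := hφ.nonneg
  calc ∫ ζ, ‖φ ζ / ζ ^ (k + 1)‖ ≤ 2 ^ 2 * Real.pi *
        (d' * Real.exp (-(K⁻¹ / 2 * ((k + 1 : ℕ) : ℝ) ^ ((1 + β) / (2 + β))))) := by
        rw [← integral_indicator_ball zero_le_two]
        exact integral_mono_ae (hφ.integrable_div_pow hβ hd _).norm (integrable_indicator_ball _ _)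
          (hφ.ae_norm_div_pow_le hβ hK hd hdK _)
    _ ≤ _ := by
        have := Real.pi_pos
        have := exponent_pos hβ
        gcongr
        · norm_num
        · exact k.le_succ

lemma IsDensity.norm_cauchyCoeff_le (hφ : IsDensity β d d' φ) (hβ : 0 ≤ β) (hK : 1 ≤ K)
    (hd : 0 < d) (hdK : d ≤ K) (k : ℕ) :
    ‖cauchyCoeff φ k‖ ≤ 4 * d' * Real.exp (-(K⁻¹ / 2 * (k : ℝ) ^ ((1 + β) / (2 + β)))) := by
  have h := (norm_integral_le_integral_norm _).trans
    (hφ.integral_norm_div_pow_le hβ hK hd hdK k)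
  rw [cauchyCoeff, norm_mul, norm_neg, norm_div, norm_one, Complex.norm_real,
    Real.norm_of_nonneg Real.pi_pos.le, one_div_mul_eq_div, div_le_iff₀ Real.pi_pos]
  linarith

lemma IsDensity.cauchyTransform_eq_seriesSum (hφ : IsDensity β d d' φ) (hβ : 0 ≤ β) (hd : 0 < d)
    {z : ℂ} (hz : ‖z‖ ≤ 1) :
    (1 / (Real.pi : ℂ)) * ∫ ζ : ℂ, φ ζ / (z - ζ) = seriesSum (cauchyCoeff φ) z := by
  have h_int := fun k : ℕ => hφ.integrable_div_pow hβ hd (k + 1)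
  have h_summable : Summable fun k : ℕ => ∫ ζ, ‖-(z ^ k * (φ ζ / ζ ^ (k + 1)))‖ := by
    refine .of_nonneg_of_le (fun k => integral_nonneg fun _ => norm_nonneg _) (fun k => ?_)
      (((summable_pow_mul_exp_neg_mul_rpow (a := (max d 1)⁻¹ / 2) (by positivity)
        (exponent_pos hβ) 0).mul_left d').mul_left (4 * Real.pi))
    rw [pow_zero, one_mul]
    refine le_trans (integral_mono ((h_int k).const_mul _).neg.norm (h_int k).norm fun ζ => ?_)
      (hφ.integral_norm_div_pow_le hβ (le_max_right d 1) hd (le_max_left d 1) k)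
    rw [norm_neg, norm_mul, norm_pow]
    exact mul_le_of_le_one_left (norm_nonneg _) (pow_le_one₀ (norm_nonneg _) hz)
  have h_exchange := (hasSum_integral_of_summable_integral_norm
    (fun k => ((h_int k).const_mul (z ^ k)).neg) h_summable).tsum_eq
  have h_geometric : ∫ ζ, ∑' k : ℕ, -(z ^ k * (φ ζ / ζ ^ (k + 1))) = ∫ ζ : ℂ, φ ζ / (z - ζ) := by
    refine integral_congr_ae ?_
    filter_upwards [ae_norm_ne one_ne_zero] with ζ hζ
    by_cases h : 1 ≤ ‖ζ‖ ∧ ‖ζ‖ < 2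
    · exact tsum_div_pow_succ (hz.trans_lt (h.1.lt_of_ne hζ.symm)) _
    · simp [hφ.eq_zero ζ h]
  rw [← h_geometric, seriesSum]
  refine (congrArg _ h_exchange.symm).trans ?_
  rw [← tsum_mul_left]
  refine tsum_congr fun k => ?_
  simp only [cauchyCoeff, Pi.neg_apply, integral_neg, integral_const_mul]
  ring

end

lemma ClassCComparable.classAComparable {β K : ℝ} (hβ : 0 ≤ β) (hK : 1 ≤ K) {f : ℂ → ℂ}
    (hf : ClassCComparable K β f) : ClassAComparable (4 * K) β f := by
  obtain ⟨d, ⟨hd1, hd2⟩, d', ⟨hd1', hd2'⟩, φ, h_meas, h_zero, h_le, hfφ⟩ := hf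
  have hφ : IsDensity β d d' φ := ⟨h_meas, h_zero, h_le⟩
  have hK0 : 0 < K := by linarith
  have hd : 0 < d := (inv_pos.2 hK0).trans_le hd1
  have h_inv : (4 * K)⁻¹ = K⁻¹ / 4 := by rw [mul_inv]; ring
  have h_inv_pos : 0 < K⁻¹ := inv_pos.2 hK0
  have : K⁻¹ ≤ 1 := inv_le_one_of_one_le₀ hK
  refine ⟨K⁻¹ / 2, ⟨by linarith, by linarith⟩, 4 * d', ⟨by linarith, by linarith⟩,
    classA_of_eqOn_seriesSum hβ (by positivity) (hφ.norm_cauchyCoeff_le hβ hK hd hd2)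
      fun z hz => ?_⟩
  rw [hfφ z hz, hφ.cauchyTransform_eq_seriesSum hβ hd (mem_closedDisc.1 hz)]

/-! ### Functions with decaying Taylor coefficients as Cauchy transforms -/

/-- The open annulus centred at the origin with radii `p` and `r`. -/
def annulus (p r : ℝ) : Set ℂ := {ζ | p < ‖ζ‖ ∧ ‖ζ‖ < r}

lemma measurableSet_annulus (p r : ℝ) : MeasurableSet (annulus p r) :=
  (measurableSet_lt measurable_const measurable_norm).inter
    (measurableSet_lt measurable_norm measurable_const)

lemma volume_annulus {p r : ℝ} (hp : 0 ≤ p) (hpr : p < r) :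
    volume.real (annulus p r) = Real.pi * (r ^ 2 - p ^ 2) := by
  have h_eq : annulus p r = ball 0 r \ closedBall 0 p := by
    ext z
    simp [annulus, and_comm]
  rw [h_eq, measureReal_sdiff (closedBall_subset_ball hpr) measurableSet_closedBall
    (by simp [ENNReal.mul_eq_top]), measureReal_def, measureReal_def,
    Complex.volume_ball, Complex.volume_closedBall, ENNReal.toReal_mul, ENNReal.toReal_mul,
    ENNReal.toReal_pow, ENNReal.toReal_pow, ENNReal.toReal_ofReal hp,
    ENNReal.toReal_ofReal (hp.trans hpr.le)]
  simp only [ENNReal.coe_toReal, NNReal.coe_real_pi]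
  ring

-- The rotation by `π / (n - k)` changes the sign of the integrand.
lemma integral_annulus_pow_div_pow_of_ne {n k : ℕ} (hnk : n ≠ k) (p r : ℝ) :
    ∫ ζ in annulus p r, ζ ^ n / ζ ^ k = 0 := by
  have h_sub_ne : (n : ℂ) - k ≠ 0 := by simpa [sub_ne_zero] using hnk
  set u : Circle := Circle.exp (Real.pi / ((n : ℝ) - k)) with hu
  have h_char : (u : ℂ) ^ n / (u : ℂ) ^ k = -1 := by
    rw [hu, Circle.coe_exp, ← Complex.exp_nat_mul, ← Complex.exp_nat_mul, ← Complex.exp_sub,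
      ← Complex.exp_pi_mul_I]
    congr 1
    push_cast
    field_simp
  rw [← integral_indicator (measurableSet_annulus p r)]
  set g : ℂ → ℂ := (annulus p r).indicator fun ζ => ζ ^ n / ζ ^ k with hg
  have h_odd : ∀ ζ, g (rotation u ζ) = - g ζ := by
    intro ζ
    have h_mem : rotation u ζ ∈ annulus p r ↔ ζ ∈ annulus p r := by
      simp only [annulus, mem_ofPred_eq, LinearIsometryEquiv.norm_map]
    by_cases h : ζ ∈ annulus p r
    · rw [hg, indicator_of_mem (h_mem.2 h), indicator_of_mem h, rotation_apply, mul_pow,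
        mul_pow, mul_div_mul_comm, h_char, neg_one_mul]
    · rw [hg, indicator_of_notMem (mt h_mem.1 h), indicator_of_notMem h, neg_zero]
  have h_invariant := (rotation u).measurePreserving.integral_comp
    (rotation u).toHomeomorph.measurableEmbedding g
  simp_rw [h_odd, integral_neg] at h_invariant
  exact self_eq_neg.1 h_invariant.symm

lemma integral_annulus_pow_div_pow_self (n : ℕ) {p : ℝ} (hp : 0 ≤ p) (r : ℝ) :
    ∫ ζ in annulus p r, ζ ^ n / ζ ^ n = (volume.real (annulus p r) : ℂ) := by
  have h_one : ∫ ζ in annulus p r, ζ ^ n / ζ ^ n = ∫ _ in annulus p r, (1 : ℂ) :=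
    setIntegral_congr_fun (measurableSet_annulus p r) fun _ hζ =>
      div_self (pow_ne_zero n (norm_pos_iff.1 (hp.trans_lt hζ.1)))
  simp [h_one]

/-- A density supported in `annulus p r` whose Cauchy transform is `w * z ^ n` for `‖z‖ ≤ p`. -/
noncomputable def annulusDensity (p r : ℝ) (n : ℕ) (w : ℂ) : ℂ → ℂ :=
  (annulus p r).indicator fun ζ => -(Real.pi * w / volume.real (annulus p r) : ℂ) * ζ ^ (n + 1)

lemma measurable_annulusDensity (p r : ℝ) (n : ℕ) (w : ℂ) :
    Measurable (annulusDensity p r n w) :=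
  Measurable.indicator (by fun_prop) (measurableSet_annulus _ _)

lemma cauchyCoeff_annulusDensity {p r : ℝ} (hp : 0 ≤ p) (hpr : p < r) (n k : ℕ) (w : ℂ) :
    cauchyCoeff (annulusDensity p r n w) k = if k = n then w else 0 := by
  have h_vol : (volume.real (annulus p r) : ℂ) ≠ 0 := by
    rw [volume_annulus hp hpr]
    exact_mod_cast (mul_pos Real.pi_pos (sub_pos.2 (by gcongr))).ne'
  have h_integrand : ∀ ζ, annulusDensity p r n w ζ / ζ ^ (k + 1) =
      (annulus p r).indicator (fun ζ =>
        -(Real.pi * w / volume.real (annulus p r) : ℂ) * (ζ ^ (n + 1) / ζ ^ (k + 1))) ζ := by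
    intro ζ
    by_cases hζ : ζ ∈ annulus p r
    · simp only [annulusDensity, indicator_of_mem hζ, mul_div_assoc]
    · simp only [annulusDensity, indicator_of_notMem hζ, zero_div]
  have h_pi : (Real.pi : ℂ) ≠ 0 := by exact_mod_cast Real.pi_ne_zero
  simp_rw [cauchyCoeff, h_integrand]
  rw [integral_indicator (measurableSet_annulus p r), integral_const_mul]
  split_ifs with h
  · subst h
    rw [integral_annulus_pow_div_pow_self _ hp]
    field_simp
  · rw [integral_annulus_pow_div_pow_of_ne (by simpa using Ne.symm h), mul_zero, mul_zero]

lemma norm_annulusDensity_le {δ : ℝ} (hδ : 0 < δ) (n : ℕ) (w : ℂ) (ζ : ℂ) :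
    ‖annulusDensity (1 + δ) (1 + 2 * δ) n w ζ‖
      ≤ ‖w‖ / (2 * δ) * Real.exp (2 * δ * (n + 1)) := by
  by_cases hζ : ζ ∈ annulus (1 + δ) (1 + 2 * δ)
  · have h_vol : Real.pi * (2 * δ) ≤ volume.real (annulus (1 + δ) (1 + 2 * δ)) := by
      rw [volume_annulus (by positivity) (by linarith)]
      have := Real.pi_pos
      gcongr
      nlinarith
    have h_pow : ‖ζ‖ ^ (n + 1) ≤ Real.exp (2 * δ * (n + 1)) :=
      calc ‖ζ‖ ^ (n + 1) ≤ Real.exp (2 * δ) ^ (n + 1) := by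
            gcongr
            linarith [hζ.2, Real.add_one_le_exp (2 * δ)]
        _ = _ := by
            rw [← Real.exp_nat_mul]
            push_cast
            ring_nf
    rw [annulusDensity, indicator_of_mem hζ, norm_mul, norm_neg, norm_div, norm_mul, norm_pow,
      Complex.norm_real, Complex.norm_real, Real.norm_of_nonneg Real.pi_pos.le,
      Real.norm_of_nonneg measureReal_nonneg]
    calc Real.pi * ‖w‖ / volume.real (annulus (1 + δ) (1 + 2 * δ)) * ‖ζ‖ ^ (n + 1)
        ≤ Real.pi * ‖w‖ / (Real.pi * (2 * δ)) * Real.exp (2 * δ * (n + 1)) := by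
          have := Real.pi_pos
          gcongr
      _ = _ := by rw [mul_div_mul_left _ _ Real.pi_ne_zero]
  · rw [annulusDensity, indicator_of_notMem hζ, norm_zero]
    positivity

lemma cauchyCoeff_tsum {D : ℕ → ℂ → ℂ} {B : ℕ → ℝ} {R : ℝ} (hR : 0 ≤ R)
    (hD : ∀ n, Measurable (D n)) (hB : Summable B)
    (h_zero : ∀ n z, ¬ (1 < ‖z‖ ∧ ‖z‖ < R) → D n z = 0)
    (h_le : ∀ n z, 1 < ‖z‖ → ‖D n z‖ ≤ B n) (k : ℕ) :
    cauchyCoeff (fun z => ∑' n, D n z) k = ∑' n, cauchyCoeff (D n) k := by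
  have h_bound : ∀ n z, ‖D n z / z ^ (k + 1)‖ ≤ (ball (0 : ℂ) R).indicator (fun _ => |B n|) z := by
    intro n z
    by_cases hz : 1 < ‖z‖ ∧ ‖z‖ < R
    · rw [indicator_of_mem (by simpa using hz.2), norm_div, norm_pow]
      exact (div_le_self (norm_nonneg _) (one_le_pow₀ hz.1.le)).trans
        ((h_le n z hz.1).trans (le_abs_self _))
    · rw [h_zero n z hz, zero_div, norm_zero]
      exact indicator_nonneg (fun _ _ => abs_nonneg _) _
  have h_int : ∀ n, Integrable fun z => D n z / z ^ (k + 1) := fun n =>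
    (integrable_indicator_ball R |B n|).mono'
      ((hD n).div (measurable_id.pow_const _)).aestronglyMeasurable
      (Eventually.of_forall fun z => h_bound n z)
  have h_summable : Summable fun n => ∫ z, ‖D n z / z ^ (k + 1)‖ := by
    refine .of_nonneg_of_le (fun n => integral_nonneg fun _ => norm_nonneg _) (fun n => ?_)
      (hB.abs.mul_left (R ^ 2 * Real.pi))
    rw [← integral_indicator_ball hR]
    exact integral_mono (h_int n).norm (integrable_indicator_ball _ _) (h_bound n)
  have h_exchange := (hasSum_integral_of_summable_integral_norm h_int h_summable).tsum_eq
  simp only [cauchyCoeff, tsum_mul_left, h_exchange, tsum_div_const]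

/-- The distance `κ * (n + 1) ^ (-1 / (2 + β))` from the unit circle at which the `n`-th Taylor
coefficient is represented by a density. -/
noncomputable def width (κ β : ℝ) (n : ℕ) : ℝ := κ * ((n : ℝ) + 1) ^ (-(1 / (2 + β)))

lemma width_pos {κ : ℝ} (hκ : 0 < κ) (β : ℝ) (n : ℕ) : 0 < width κ β n := by
  unfold width
  positivity

lemma width_le {κ β : ℝ} (hκ : 0 ≤ κ) (hβ : 0 ≤ β) (n : ℕ) : width κ β n ≤ κ :=
  mul_le_of_le_one_right hκ (Real.rpow_le_one_of_one_le_of_nonpos (by simp)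
    (neg_nonpos.2 (by positivity)))

lemma width_mul_add_one {κ β : ℝ} (hβ : 0 ≤ β) (n : ℕ) :
    width κ β n * (n + 1) = κ * ((n : ℝ) + 1) ^ ((1 + β) / (2 + β)) := by
  rw [rpow_exponent_eq_mul hβ (by positivity), width]
  ring

lemma half_le_exponent {β : ℝ} (hβ : 0 ≤ β) : 1 / 2 ≤ (1 + β) / (2 + β) := by
  rw [div_le_div_iff₀ (by norm_num) (by linarith)]
  linarith

lemma half_rpow_le {s : ℝ} (hs : 1 / 2 ≤ s) (k : ℕ) : (k : ℝ) ^ (1 / 2 : ℝ) ≤ (k : ℝ) ^ s := by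
  rcases k.eq_zero_or_pos with rfl | hk
  · rw [Nat.cast_zero, Real.zero_rpow (by norm_num)]
    exact Real.zero_rpow_nonneg s
  · exact Real.rpow_le_rpow_of_exponent_le (by exact_mod_cast hk) hs

lemma add_one_rpow_exponent_le {β : ℝ} (hβ : 0 ≤ β) (n : ℕ) :
    ((n : ℝ) + 1) ^ ((1 + β) / (2 + β)) ≤ (n : ℝ) ^ ((1 + β) / (2 + β)) + 1 := by
  simpa using Real.rpow_add_le_add_rpow (n.cast_nonneg (α := ℝ)) zero_le_one
    (exponent_pos hβ).le ((div_le_one (by linarith)).2 (by linarith))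

lemma exp_neg_mul_mul_exp_le {a x y Y : ℝ} (ha : 0 ≤ a) (ha1 : a ≤ 1) (hxy : x ≤ y)
    (hY : Y ≤ y + 1) :
    Real.exp (-(a * y)) * Real.exp (a / 4 * Y)
      ≤ 3 * Real.exp (-(a / 2 * x)) * Real.exp (-(a / 4 * Y)) :=
  calc Real.exp (-(a * y)) * Real.exp (a / 4 * Y)
      ≤ Real.exp 1 * Real.exp (-(a / 2 * x)) * Real.exp (-(a / 4 * Y)) := by
        simp only [← Real.exp_add]
        refine Real.exp_le_exp.2 ?_
        linarith [mul_le_mul_of_nonneg_left hxy ha, mul_le_mul_of_nonneg_left hY ha]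
    _ ≤ _ := by
        gcongr
        linarith [Real.exp_one_lt_d9]

lemma rho_nonneg (β x : ℝ) : 0 ≤ rho β x := (Real.exp_pos _).le

lemma rho_le_one {β x : ℝ} (hx : 0 ≤ x) : rho β x ≤ 1 := by
  rw [rho, Real.exp_le_one_iff, neg_nonpos]
  positivity

lemma rho_mono {β x y : ℝ} (hβ : 0 ≤ β) (hx : 0 < x) (hxy : x ≤ y) : rho β x ≤ rho β y := by
  unfold rho
  gcongr

lemma exp_neg_le_rho_width {κ β M : ℝ} (hβ : 0 ≤ β) (hM : 1 ≤ M * κ) (n : ℕ) :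
    Real.exp (-((M * κ)⁻¹ * ((n : ℝ) + 1) ^ ((1 + β) / (2 + β)))) ≤ rho β (M * width κ β n) := by
  have hn : (0 : ℝ) ≤ n + 1 := by positivity
  have h_width : 0 ≤ ((n : ℝ) + 1) ^ (-(1 / (2 + β))) := by positivity
  rw [rho, width, ← mul_assoc, Real.mul_rpow (by linarith) h_width, one_div,
    mul_inv ((M * κ) ^ (1 + β)), ← Real.rpow_neg h_width, ← rpow_exponent_eq_rpow hn]
  gcongr
  exact Real.self_le_rpow_of_one_le hM (by linarith)

/-- A summable majorant, uniform in `β`, for the densities representing the single Taylor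
coefficients of a function in one of the classes `ClassAComparable K β`. -/
noncomputable def densityBound (K : ℝ) (n : ℕ) : ℝ :=
  12 * K ^ 2 * ((n + 1) * Real.exp (-(K⁻¹ / 2 * (n : ℝ) ^ (1 / 2 : ℝ))))

lemma summable_densityBound {K : ℝ} (hK : 0 < K) : Summable (densityBound K) := by
  have h_summable := fun m => summable_pow_mul_exp_neg_mul_rpow (a := K⁻¹ / 2) (s := 1 / 2)
    (by positivity) (by positivity) m
  refine (((h_summable 1).add (h_summable 0)).mul_left (12 * K ^ 2)).congr fun n => ?_
  rw [densityBound]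
  ring

lemma densityBound_nonneg (K : ℝ) (n : ℕ) : 0 ≤ densityBound K n := by
  unfold densityBound
  positivity

lemma norm_annulusDensity_width_le {K β : ℝ} (hK : 1 ≤ K) (hβ : 0 ≤ β) {n : ℕ} {w : ℂ}
    (hw : ‖w‖ ≤ K * Real.exp (-(K⁻¹ * (n : ℝ) ^ ((1 + β) / (2 + β))))) (ζ : ℂ) :
    ‖annulusDensity (1 + width (K⁻¹ / 8) β n) (1 + 2 * width (K⁻¹ / 8) β n) n w ζ‖
      ≤ densityBound K n * rho β (32 * K ^ 2 * (‖ζ‖ - 1)) := by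
  have : 0 < K := by linarith
  have hK1 : K⁻¹ ≤ 1 := inv_le_one_of_one_le₀ hK
  set δ := width (K⁻¹ / 8) β n
  have hδ : 0 < δ := width_pos (by positivity) β n
  by_cases h_mem : ζ ∈ annulus (1 + δ) (1 + 2 * δ)
  swap
  · rw [annulusDensity, indicator_of_notMem h_mem, norm_zero]
    exact mul_nonneg (densityBound_nonneg K n) (rho_nonneg _ _)
  set y := (n : ℝ) ^ ((1 + β) / (2 + β))
  set Y := ((n : ℝ) + 1) ^ ((1 + β) / (2 + β))
  have hδY : δ * (n + 1) = K⁻¹ / 8 * Y := width_mul_add_one hβ n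
  have h_inv : 1 / (2 * δ) ≤ 4 * K * (n + 1) := by
    have hY1 : 1 ≤ Y := Real.one_le_rpow (by simp) (exponent_pos hβ).le
    rw [div_le_iff₀ (by positivity)]
    calc (1 : ℝ) ≤ Y := hY1
      _ = 8 * K * (δ * (n + 1)) := by rw [hδY]; field_simp
      _ = _ := by ring
  have h_rho : Real.exp (-(K⁻¹ / 4 * Y)) ≤ rho β (32 * K ^ 2 * (‖ζ‖ - 1)) := by
    have h_const : 32 * K ^ 2 * (K⁻¹ / 8) = 4 * K := by field_simp; norm_num
    refine le_trans ?_ ((exp_neg_le_rho_width (M := 32 * K ^ 2) (κ := K⁻¹ / 8) hβ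
      (by linarith) n).trans (rho_mono hβ (by positivity) ?_))
    · rw [h_const, mul_inv, mul_comm (4⁻¹ : ℝ), ← div_eq_mul_inv]
    · gcongr
      linarith [h_mem.1]
  have h_exp : Real.exp (-(K⁻¹ * y)) * Real.exp (K⁻¹ / 4 * Y)
      ≤ 3 * Real.exp (-(K⁻¹ / 2 * (n : ℝ) ^ (1 / 2 : ℝ))) * Real.exp (-(K⁻¹ / 4 * Y)) :=
    exp_neg_mul_mul_exp_le (by positivity) hK1 (half_rpow_le (half_le_exponent hβ) n)
      (add_one_rpow_exponent_le hβ n)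
  calc _ ≤ ‖w‖ / (2 * δ) * Real.exp (2 * δ * (n + 1)) := norm_annulusDensity_le hδ n w ζ
    _ = ‖w‖ * Real.exp (K⁻¹ / 4 * Y) * (1 / (2 * δ)) := by
        rw [mul_assoc 2, hδY]
        ring_nf
    _ ≤ K * Real.exp (-(K⁻¹ * y)) * Real.exp (K⁻¹ / 4 * Y) * (4 * K * (n + 1)) := by gcongr
    _ = 4 * K ^ 2 * (n + 1) * (Real.exp (-(K⁻¹ * y)) * Real.exp (K⁻¹ / 4 * Y)) := by ring
    _ ≤ 4 * K ^ 2 * (n + 1) * (3 * Real.exp (-(K⁻¹ / 2 * (n : ℝ) ^ (1 / 2 : ℝ))) *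
          rho β (32 * K ^ 2 * (‖ζ‖ - 1))) := by
        refine mul_le_mul_of_nonneg_left (h_exp.trans ?_) (by positivity)
        exact mul_le_mul_of_nonneg_left h_rho (by positivity)
    _ = _ := by rw [densityBound]; ring

lemma exists_isDensity_cauchyCoeff_eq {β K : ℝ} (hβ : 0 ≤ β) (hK : 1 ≤ K) {c : ℕ → ℂ}
    (hc : ∀ n : ℕ, ‖c n‖ ≤ K * Real.exp (-(K⁻¹ * (n : ℝ) ^ ((1 + β) / (2 + β))))) :
    ∃ φ, IsDensity β (32 * K ^ 2) (∑' n, densityBound K n) φ ∧ ∀ k, cauchyCoeff φ k = c k := by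
  have hκ : 0 < K⁻¹ / 8 := by positivity
  have hκ1 : K⁻¹ / 8 ≤ 1 / 8 := by linarith [inv_le_one_of_one_le₀ hK]
  set δ := width (K⁻¹ / 8) β
  have hδ : ∀ n, 0 < δ n := width_pos hκ β
  have hδ1 : ∀ n, δ n ≤ K⁻¹ / 8 := width_le hκ.le hβ
  set D : ℕ → ℂ → ℂ := fun n => annulusDensity (1 + δ n) (1 + 2 * δ n) n (c n)
  have h_zero : ∀ n z, ¬ (1 < ‖z‖ ∧ ‖z‖ < 2) → D n z = 0 := fun n z hz =>
    indicator_of_notMem (fun h => hz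
      ⟨by linarith [h.1, hδ n], by linarith [h.2, hδ1 n]⟩) _
  have h_le : ∀ n z, ‖D n z‖ ≤ densityBound K n * rho β (32 * K ^ 2 * (‖z‖ - 1)) :=
    fun n => norm_annulusDensity_width_le hK hβ (hc n)
  have h_bound := summable_densityBound (show 0 < K by linarith)
  have h_meas : ∀ n, Measurable (D n) := fun n => measurable_annulusDensity _ _ _ _
  refine ⟨fun z => ∑' n, D n z, ⟨.tsum h_meas, fun z hz => ?_, fun z _ _ => ?_⟩, fun k => ?_⟩
  · simp [fun n => h_zero n z fun h => hz ⟨h.1.le, h.2⟩]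
  · rw [← tsum_mul_right]
    exact tsum_of_norm_bounded (h_bound.mul_right _).hasSum fun n => h_le n z
  · rw [cauchyCoeff_tsum zero_le_two h_meas h_bound h_zero fun n z hz => (h_le n z).trans
      (mul_le_of_le_one_right (densityBound_nonneg K n)
        (rho_le_one (mul_nonneg (by positivity) (by linarith))))]
    have h_coeff : ∀ n, cauchyCoeff (D n) k = if k = n then c n else 0 := fun n =>
      cauchyCoeff_annulusDensity (by linarith [hδ n]) (by linarith [hδ n]) n k (c n)
    simp_rw [h_coeff, tsum_ite_eq']

lemma exists_classCComparable_of_classAComparable {K : ℝ} (hK : 1 ≤ K) :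
    ∃ K' : ℝ, 1 ≤ K' ∧ ∀ β : ℝ, 0 ≤ β →
      ∀ f : ℂ → ℂ, ClassAComparable K β f → ClassCComparable K' β f := by
  set B := ∑' n, densityBound K n
  have hK0 : 0 < K := by linarith
  have hB : 1 ≤ B := by
    refine le_trans ?_ ((summable_densityBound hK0).le_tsum 0 fun n _ => densityBound_nonneg K n)
    rw [densityBound, Nat.cast_zero, Real.zero_rpow (by norm_num)]
    simp only [zero_add, mul_zero, neg_zero, Real.exp_zero]
    nlinarith
  have hM : 1 ≤ 32 * K ^ 2 := by nlinarith
  refine ⟨32 * K ^ 2 + B, by linarith, fun β hβ f hf => ?_⟩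
  obtain ⟨a, ⟨ha, -⟩, a', ⟨-, ha'⟩, hA⟩ := hf
  obtain ⟨φ, hφ, h_coeff⟩ := exists_isDensity_cauchyCoeff_eq hβ hK fun n =>
    (hA.coeff_le n).trans (by gcongr)
  have : (32 * K ^ 2 + B)⁻¹ ≤ 1 := inv_le_one_of_one_le₀ (by linarith)
  refine ⟨32 * K ^ 2, ⟨by linarith, by linarith⟩, B, ⟨by linarith, by linarith⟩, φ,
    hφ.measurable, hφ.eq_zero, hφ.norm_le, fun z hz => ?_⟩
  rw [hA.eqOn_seriesSum hβ ((inv_pos.2 hK0).trans_le ha) hz,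
    hφ.cauchyTransform_eq_seriesSum hβ (by positivity) (mem_closedDisc.1 hz)]
  exact congrArg (seriesSum · z) (funext fun k => (h_coeff k).symm)

/-! ### Division by zeros -/

/-- The coefficients of `w ↦ (f w - f a) / (w - a)`, where `f` has the coefficients `c`. -/
noncomputable def quotCoeff (a : ℂ) (c : ℕ → ℂ) (i : ℕ) : ℂ := ∑' j, c (i + 1 + j) * a ^ j

/-- The power series with coefficients `c` vanishes at `z` to order at least `k`. -/
def VanishesToOrder (c : ℕ → ℂ) (z : ℂ) (k : ℕ) : Prop :=
  ∀ i < k, seriesSum (derivCoeff^[i] c) z = 0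

open scoped Classical in
/-- `Z` is a multiset of points of the closed unit disc in which no point occurs more often than
its multiplicity as a zero of the power series with coefficients `c`. -/
structure IsZeroMultiset (c : ℕ → ℂ) (Z : Multiset ℂ) : Prop where
  norm_le_one : ∀ z ∈ Z, ‖z‖ ≤ 1
  vanishes : ∀ z, VanishesToOrder c z (Z.count z)

section

variable {c c' c'' : ℕ → ℂ} {a : ℂ} {Z : Multiset ℂ}

lemma sum_range_choose_left (k m : ℕ) : ∑ i ∈ Finset.range k, i.choose m = k.choose (m + 1) := by
  induction k with
  | zero => simp
  | succ k ih => rw [Finset.sum_range_succ, ih, Nat.choose_succ_succ' k m, add_comm]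

lemma enorm_quotCoeff_le (ha : ‖a‖ ≤ 1) (c : ℕ → ℂ) (i : ℕ) :
    ‖quotCoeff a c i‖ₑ ≤ ∑' k, if i < k then ‖c k‖ₑ else 0 :=
  calc ‖quotCoeff a c i‖ₑ ≤ ∑' j, ‖c (i + 1 + j) * a ^ j‖ₑ := enorm_tsum_le_tsum_enorm
    _ ≤ ∑' j, if i < i + 1 + j then ‖c (i + 1 + j)‖ₑ else 0 :=
        ENNReal.tsum_le_tsum fun j => by
          rw [if_pos (by omega), enorm_le_iff_norm_le]
          exact norm_mul_pow_le (fun j => c (i + 1 + j)) ha j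
    _ ≤ _ := ENNReal.tsum_comp_le_tsum_of_injective (add_right_injective (i + 1)) fun k =>
        if i < k then ‖c k‖ₑ else 0

lemma binomMoment_quotCoeff_le (m : ℕ) (ha : ‖a‖ ≤ 1) (c : ℕ → ℂ) :
    binomMoment m (quotCoeff a c) ≤ binomMoment (m + 1) c :=
  calc binomMoment m (quotCoeff a c)
      ≤ ∑' i, ∑' k, (i.choose m : ENNReal) * (if i < k then ‖c k‖ₑ else 0) :=
        ENNReal.tsum_le_tsum fun i => by
          rw [ENNReal.tsum_mul_left]
          gcongr
          exact enorm_quotCoeff_le ha c i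
    _ = ∑' k, ∑' i, (i.choose m : ENNReal) * (if i < k then ‖c k‖ₑ else 0) := ENNReal.tsum_comm
    _ = binomMoment (m + 1) c := tsum_congr fun k => by
        rw [tsum_eq_sum (s := Finset.range k) fun i hi => by simp_all, ← sum_range_choose_left,
          Nat.cast_sum, Finset.sum_mul]
        exact Finset.sum_congr rfl fun i hi => by rw [if_pos (Finset.mem_range.1 hi)]

lemma RapidDecay.quotCoeff (hc : RapidDecay c) (ha : ‖a‖ ≤ 1) : RapidDecay (quotCoeff a c) :=
  fun m => ne_top_of_le_ne_top (hc (m + 1)) (binomMoment_quotCoeff_le m ha c)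

lemma RapidDecay.summable_shift (hc : RapidDecay c) (ha : ‖a‖ ≤ 1) (i : ℕ) :
    Summable fun j => c (i + j) * a ^ j :=
  .of_norm_bounded (hc.summable_norm.comp_injective (add_right_injective i)) fun j =>
    norm_mul_pow_le (fun j => c (i + j)) ha j

lemma RapidDecay.quotCoeff_succ (hc : RapidDecay c) (ha : ‖a‖ ≤ 1) (i : ℕ) :
    a * Gevrey.quotCoeff a c (i + 1) = Gevrey.quotCoeff a c i - c (i + 1) := by
  rw [Gevrey.quotCoeff, Gevrey.quotCoeff, (hc.summable_shift ha (i + 1)).tsum_eq_zero_add,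
    ← tsum_mul_left]
  simp only [add_zero, pow_zero, mul_one, add_sub_cancel_left]
  refine tsum_congr fun j => ?_
  rw [show i + 1 + 1 + j = i + 1 + (j + 1) by ring]
  ring

lemma RapidDecay.quotCoeff_zero (hc : RapidDecay c) (ha : ‖a‖ ≤ 1) :
    a * Gevrey.quotCoeff a c 0 = seriesSum c a - c 0 := by
  rw [Gevrey.quotCoeff, seriesSum, (hc.summable ha).tsum_eq_zero_add, ← tsum_mul_left]
  simp only [pow_zero, mul_one, add_sub_cancel_left]
  refine tsum_congr fun j => ?_
  rw [show 0 + 1 + j = j + 1 by ring]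
  ring

lemma RapidDecay.seriesSum_sub_seriesSum (hc : RapidDecay c) {w : ℂ} (ha : ‖a‖ ≤ 1)
    (hw : ‖w‖ ≤ 1) :
    seriesSum c w - seriesSum c a = (w - a) * seriesSum (Gevrey.quotCoeff a c) w := by
  set q := Gevrey.quotCoeff a c
  have h_summable : Summable fun i => q i * w ^ i := (hc.quotCoeff ha).summable hw
  have h_tail : Summable fun i => c (i + 1) * w ^ (i + 1) :=
    (summable_nat_add_iff 1).2 (hc.summable hw)
  have h_mul : a * seriesSum q w
      = a * q 0 + (w * seriesSum q w - ∑' i, c (i + 1) * w ^ (i + 1)) :=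
    calc a * seriesSum q w = a * q 0 + ∑' i, a * (q (i + 1) * w ^ (i + 1)) := by
          rw [seriesSum, h_summable.tsum_eq_zero_add, mul_add, ← tsum_mul_left, pow_zero, mul_one]
      _ = a * q 0 + ∑' i, (w * (q i * w ^ i) - c (i + 1) * w ^ (i + 1)) := by
          congr 1
          refine tsum_congr fun i => ?_
          rw [← mul_assoc, hc.quotCoeff_succ ha]
          ring
      _ = _ := by rw [(h_summable.mul_left w).tsum_sub h_tail, tsum_mul_left, seriesSum]
  have h_split : seriesSum c w = c 0 + ∑' i, c (i + 1) * w ^ (i + 1) := by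
    rw [seriesSum, (hc.summable hw).tsum_eq_zero_add]
    simp
  linear_combination h_split + h_mul + hc.quotCoeff_zero ha

lemma seriesSum_derivCoeff_of_mul_add (hc : RapidDecay c) (hc' : RapidDecay c')
    (hc'' : RapidDecay c'') {m : ℂ}
    (h : ∀ w ∈ closedDisc, seriesSum c w = (w - a) * seriesSum c' w + m * seriesSum c'' w) :
    ∀ w ∈ closedDisc, seriesSum (derivCoeff c) w = (w - a) * seriesSum (derivCoeff c') w +
      (seriesSum c' w + m * seriesSum (derivCoeff c'') w) := by
  intro w hw
  have hw' := mem_closedDisc.1 hw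
  have h_left := (hc.hasDerivWithinAt_seriesSum hw').congr_of_mem (fun w hw => (h w hw).symm) hw
  have h_right := (((hasDerivWithinAt_id w closedDisc).sub_const a).mul
    (hc'.hasDerivWithinAt_seriesSum hw')).add ((hc''.hasDerivWithinAt_seriesSum hw').const_mul m)
  rw [(uniqueDiffOn_closedDisc w hw).eq_deriv _ h_left h_right]
  simp only [id]
  ring

lemma seriesSum_iterate_derivCoeff_of_mul (hc : RapidDecay c) (hc' : RapidDecay c')
    (h : ∀ w ∈ closedDisc, seriesSum c w = (w - a) * seriesSum c' w) (n : ℕ) :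
    ∀ w ∈ closedDisc, seriesSum (derivCoeff^[n + 1] c) w =
      (w - a) * seriesSum (derivCoeff^[n + 1] c') w +
        (n + 1) * seriesSum (derivCoeff^[n] c') w := by
  induction n with
  | zero =>
    simpa using seriesSum_derivCoeff_of_mul_add hc hc' hc' (m := 0) (by simpa using h)
  | succ n ih =>
    intro w hw
    have h_deriv := seriesSum_derivCoeff_of_mul_add (hc.iterate_derivCoeff _)
      (hc'.iterate_derivCoeff _) (hc'.iterate_derivCoeff n) ih w hw
    simp only [← Function.iterate_succ_apply' derivCoeff] at h_deriv
    rw [h_deriv]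
    push_cast
    ring

lemma VanishesToOrder.quot_of_ne {z : ℂ} {k : ℕ} (hv : VanishesToOrder c z k)
    (hc : RapidDecay c) (hc' : RapidDecay c')
    (h : ∀ w ∈ closedDisc, seriesSum c w = (w - a) * seriesSum c' w) (hz : z ∈ closedDisc)
    (hza : z ≠ a) : VanishesToOrder c' z k := by
  have h_cancel {x : ℂ} (hx : (z - a) * x = 0) : x = 0 :=
    (mul_eq_zero.1 hx).resolve_left (sub_ne_zero.2 hza)
  intro i
  induction i with
  | zero =>
    intro hi
    exact h_cancel ((h z hz).symm.trans (hv 0 hi))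
  | succ i ih =>
    intro hi
    have h_zero := hv (i + 1) hi
    rw [seriesSum_iterate_derivCoeff_of_mul hc hc' h i z hz, ih (by omega), mul_zero,
      add_zero] at h_zero
    exact h_cancel h_zero

lemma VanishesToOrder.quot_self {k : ℕ} (hv : VanishesToOrder c a (k + 1)) (hc : RapidDecay c)
    (hc' : RapidDecay c') (h : ∀ w ∈ closedDisc, seriesSum c w = (w - a) * seriesSum c' w)
    (ha : a ∈ closedDisc) : VanishesToOrder c' a k := by
  intro i hi
  have h_zero := hv (i + 1) (by omega)
  rw [seriesSum_iterate_derivCoeff_of_mul hc hc' h i a ha, sub_self, zero_mul,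
    zero_add] at h_zero
  exact (mul_eq_zero.1 h_zero).resolve_left (mod_cast i.succ_ne_zero)

lemma IsZeroMultiset.mono {Z' : Multiset ℂ} (hZ : IsZeroMultiset c Z) (h : Z' ≤ Z) :
    IsZeroMultiset c Z' := by
  classical
  exact ⟨fun z hz => hZ.norm_le_one z (Multiset.mem_of_le h hz), fun z i hi =>
    hZ.vanishes z i (hi.trans_le (Multiset.count_le_of_le z h))⟩

lemma IsZeroMultiset.seriesSum_eq_mul (hc : RapidDecay c) (hZ : IsZeroMultiset c (a ::ₘ Z)) :
    ∀ w ∈ closedDisc, seriesSum c w = (w - a) * seriesSum (quotCoeff a c) w := by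
  classical
  intro w hw
  have h_zero : seriesSum c a = 0 := hZ.vanishes a 0 (by simp)
  rw [← hc.seriesSum_sub_seriesSum (hZ.norm_le_one a (Z.mem_cons_self a)) (mem_closedDisc.1 hw),
    h_zero, sub_zero]

lemma IsZeroMultiset.quot (hc : RapidDecay c) (hZ : IsZeroMultiset c (a ::ₘ Z)) :
    IsZeroMultiset (quotCoeff a c) Z := by
  classical
  have ha : ‖a‖ ≤ 1 := hZ.norm_le_one a (Z.mem_cons_self a)
  refine ⟨fun z hz => hZ.norm_le_one z (Multiset.mem_cons_of_mem hz), fun z => ?_⟩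
  by_cases hz : z ∈ Z
  swap
  · simp [VanishesToOrder, Multiset.count_eq_zero.2 hz]
  have hv := hZ.vanishes z
  by_cases hza : z = a
  · subst hza
    rw [Multiset.count_cons_self] at hv
    exact hv.quot_self hc (hc.quotCoeff ha) (hZ.seriesSum_eq_mul hc) (mem_closedDisc.2 ha)
  · rw [Multiset.count_cons_of_ne hza] at hv
    exact hv.quot_of_ne hc (hc.quotCoeff ha) (hZ.seriesSum_eq_mul hc)
      (mem_closedDisc.2 (hZ.norm_le_one z (Multiset.mem_cons_of_mem hz))) hza

lemma IsZeroMultiset.exists_quot (hc : RapidDecay c) (hZ : IsZeroMultiset c Z) :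
    ∃ c', RapidDecay c' ∧ (∀ m, binomMoment m c' ≤ binomMoment (m + Multiset.card Z) c) ∧
      ∀ w ∈ closedDisc, seriesSum c w = (Z.map fun z => w - z).prod * seriesSum c' w := by
  induction Z using Multiset.induction generalizing c with
  | empty => exact ⟨c, hc, by simp, by simp⟩
  | cons a Z ih =>
    have ha : ‖a‖ ≤ 1 := hZ.norm_le_one a (Z.mem_cons_self a)
    obtain ⟨c', hc', h_moment, h_mul⟩ := ih (hc.quotCoeff ha) (hZ.quot hc)
    refine ⟨c', hc', fun m => ?_, fun w hw => ?_⟩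
    · rw [Multiset.card_cons]
      exact (h_moment m).trans (binomMoment_quotCoeff_le _ ha c)
    · rw [hZ.seriesSum_eq_mul hc w hw, h_mul w hw, Multiset.map_cons, Multiset.prod_cons,
        mul_assoc]

lemma norm_multiset_prod_map (Z : Multiset ℂ) (g : ℂ → ℂ) :
    ‖(Z.map g).prod‖ = (Z.map fun z => ‖g z‖).prod := by
  simpa [Multiset.map_map, Function.comp_def] using map_multiset_prod normHom (Z.map g)

lemma IsZeroMultiset.norm_seriesSum_le (hc : RapidDecay c) (hZ : IsZeroMultiset c Z) {w : ℂ}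
    (hw : ‖w‖ ≤ 1) {B : ℝ} (hB : ∀ z ∈ Z, ‖w - z‖ ≤ B) :
    ‖seriesSum c w‖ ≤ B ^ Multiset.card Z * (binomMoment (Multiset.card Z) c).toReal := by
  obtain ⟨c', hc', h_moment, h_mul⟩ := hZ.exists_quot hc
  have h_prod : (Z.map fun z => ‖w - z‖).prod ≤ B ^ Multiset.card Z := by
    simpa using Multiset.prod_map_le_prod_map₀ _ (fun _ => B) (fun _ _ => norm_nonneg _) hB
  have h_quot : ‖seriesSum c' w‖ ≤ (binomMoment (Multiset.card Z) c).toReal :=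
    (hc'.norm_seriesSum_le hw).trans (ENNReal.toReal_mono (hc _) (by simpa using h_moment 0))
  rw [h_mul w (mem_closedDisc.2 hw), norm_mul, norm_multiset_prod_map]
  exact mul_le_mul h_prod h_quot (norm_nonneg _)
    ((Multiset.prod_map_nonneg fun _ _ => norm_nonneg _).trans h_prod)

lemma norm_sub_eq_norm_one_sub_conj_mul {w : ℂ} (hw : ‖w‖ = 1) (z : ℂ) :
    ‖w - z‖ = ‖1 - (starRingEnd ℂ) z * w‖ := by
  have h_conj : w * (starRingEnd ℂ) w = 1 := by
    rw [Complex.mul_conj, Complex.normSq_eq_norm_sq, hw]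
    norm_num
  calc ‖w - z‖ = ‖(starRingEnd ℂ) (w - z)‖ * ‖w‖ := by rw [hw, mul_one, Complex.norm_conj]
    _ = ‖1 - (starRingEnd ℂ) z * w‖ := by
        rw [← norm_mul, map_sub, sub_mul, mul_comm _ w, h_conj]

lemma differentiable_multiset_prod_map (Z : Multiset ℂ) {g : ℂ → ℂ → ℂ}
    (hg : ∀ z, Differentiable ℂ (g z)) :
    Differentiable ℂ fun w => (Z.map fun z => g z w).prod := by
  induction Z using Multiset.induction with
  | empty => simp
  | cons a Z ih =>
    simp only [Multiset.map_cons, Multiset.prod_cons]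
    exact (hg a).mul ih

-- On the unit circle the product of the `1 - z̄ w` has the modulus of the product of the `w - z`,
-- and it equals `1` at the origin.
lemma IsZeroMultiset.norm_seriesSum_zero_le (hc : RapidDecay c) (hZ : IsZeroMultiset c Z) {S : ℝ}
    (hS : ∀ w : ℂ, ‖w‖ = 1 → ‖seriesSum c w‖ ≤ S) :
    ‖seriesSum c 0‖ ≤ S * (Z.map norm).prod := by
  obtain ⟨c', hc', -, h_mul⟩ := hZ.exists_quot hc
  set P : ℂ → ℂ := fun w => (Z.map fun z => 1 - (starRingEnd ℂ) z * w).prod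
  have hP : Differentiable ℂ P := differentiable_multiset_prod_map Z fun z => by fun_prop
  have h_diffCont : DiffContOnCl ℂ (fun w => P w * seriesSum c' w) (ball 0 1) := by
    refine ⟨hP.differentiableOn.mul hc'.analyticOnNhd_seriesSum.differentiableOn, ?_⟩
    rw [closure_ball _ one_ne_zero]
    exact hP.continuous.continuousOn.mul hc'.continuousOn_seriesSum
  have h_zero : ‖P 0 * seriesSum c' 0‖ ≤ S := by
    refine Complex.norm_le_of_forall_mem_frontier_norm_le isBounded_ball h_diffCont
      (fun w hw => ?_) (subset_closure (by simp))
    rw [frontier_ball _ one_ne_zero, mem_sphere_zero_iff_norm] at hw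
    refine le_trans (le_of_eq ?_) (hS w hw)
    rw [h_mul w (mem_closedDisc.2 hw.le), norm_mul, norm_mul, norm_multiset_prod_map,
      norm_multiset_prod_map]
    simp_rw [norm_sub_eq_norm_one_sub_conj_mul hw]
  have hP0 : P 0 = 1 := by simp [P]
  rw [hP0, one_mul] at h_zero
  rw [h_mul 0 (mem_closedDisc.2 (by simp)), norm_mul, norm_multiset_prod_map, mul_comm]
  simp only [zero_sub, norm_neg]
  exact mul_le_mul_of_nonneg_right h_zero (Multiset.prod_map_nonneg fun _ _ => norm_nonneg _)

lemma isZeroMultiset_sum_replicate {f : ℂ → ℂ} (hc : RapidDecay c)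
    (hf : EqOn f (seriesSum c) closedDisc) (F : Finset closedDisc) {k : closedDisc → ℕ}
    (hk : ∀ z ∈ F, (k z : ℕ∞) ≤ zeroMult f z) :
    IsZeroMultiset c (∑ z ∈ F, Multiset.replicate (k z) (z : ℂ)) := by
  classical
  set Z : Multiset ℂ := ∑ z ∈ F, Multiset.replicate (k z) (z : ℂ) with hZ
  have h_mem : ∀ z ∈ Z, ∃ w ∈ F, (w : ℂ) = z := fun z hz => by
    obtain ⟨w, hw, hzw⟩ := Multiset.mem_sum.1 hz
    exact ⟨w, hw, (Multiset.eq_of_mem_replicate hzw).symm⟩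
  have h_count : ∀ w ∈ F, Z.count (w : ℂ) = k w := fun w hw => by
    rw [hZ, Multiset.count_sum', Finset.sum_eq_single_of_mem w hw, Multiset.count_replicate_self]
    intro v _ hvw
    rw [Multiset.count_replicate, if_neg (mt Subtype.ext hvw)]
  refine ⟨fun z hz => ?_, fun z i hi => ?_⟩
  · obtain ⟨w, -, rfl⟩ := h_mem z hz
    exact mem_closedDisc.1 w.2
  · obtain ⟨w, hw, rfl⟩ := h_mem z (Multiset.count_pos.1 (Nat.zero_le i |>.trans_lt hi))
    rw [h_count w hw] at hi
    rw [← hc.iteratedDerivWithin_seriesSum i w.2, ← iteratedDerivWithin_congr hf w.2]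
    by_contra h_ne
    have h_le : (k w : ℕ∞) ≤ i := (hk w hw).trans (iInf₂_le i h_ne)
    exact absurd (by exact_mod_cast h_le) (not_le.2 hi)

lemma zeroCount_le_ofReal {f : ℂ → ℂ} (hc : RapidDecay c) (hf : EqOn f (seriesSum c) closedDisc)
    {B : ℝ} (hB : ∀ Z, IsZeroMultiset c Z → (Multiset.card Z : ℝ) ≤ B) :
    zeroCount f ≤ ENNReal.ofReal B := by
  have h_sum_le : ∀ (F : Finset closedDisc) (k : closedDisc → ℕ),
      (∀ z ∈ F, (k z : ℕ∞) ≤ zeroMult f z) → ((∑ z ∈ F, k z : ℕ) : ℝ) ≤ B := fun F k hk => by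
    simpa using hB _ (isZeroMultiset_sum_replicate hc hf F hk)
  have h_ne_top : ∀ z : closedDisc, zeroMult f z ≠ ⊤ := fun z hz => by
    obtain ⟨M, hM⟩ := exists_nat_gt B
    exact hM.not_ge (by simpa using h_sum_le {z} (fun _ => M) (by simp [hz]))
  rw [zeroCount, ENNReal.tsum_eq_iSup_sum]
  refine iSup_le fun F => ?_
  have h_toNat : ∀ z : closedDisc, ((zeroMult f z).toNat : ℕ∞) = zeroMult f z := fun z =>
    ENat.natCast_toNat (h_ne_top z)
  have h_cast : ∑ z ∈ F, ((zeroMult f z : ℕ∞) : ENNReal) =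
      ENNReal.ofReal ((∑ z ∈ F, (zeroMult f z).toNat : ℕ) : ℝ) := by
    rw [ENNReal.ofReal_natCast, Nat.cast_sum]
    refine Finset.sum_congr rfl fun z _ => ?_
    rw [← ENat.toENNReal_coe, h_toNat]
  rw [h_cast]
  exact ENNReal.ofReal_le_ofReal (h_sum_le F _ fun z _ => (h_toNat z).le)

end

/-! ### Smallness near clusters of zeros -/

/-- A bound for all power series whose coefficients satisfy `Decay K β` for some `β ≥ 0`. -/
noncomputable def supBound (K : ℝ) : ℝ :=
  K * ∑' k : ℕ, Real.exp (-(K⁻¹ / 2 * (k : ℝ) ^ (1 / 2 : ℝ)))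

/-- The coefficient bound defining `ClassA β`, with the two constants `K⁻¹` and `K`. -/
def Decay (K β : ℝ) (c : ℕ → ℂ) : Prop :=
  ∀ k : ℕ, ‖c k‖ ≤ K * Real.exp (-(K⁻¹ * (k : ℝ) ^ ((1 + β) / (2 + β))))

lemma pow_le_rpow_mul_exp {a s x : ℝ} (ha : 0 < a) (hs : 0 < s) (hx : 0 ≤ x) (n : ℕ) :
    x ^ n ≤ (n / (a * s)) ^ ((n : ℝ) / s) * Real.exp (a * x ^ s) := by
  rcases n.eq_zero_or_pos with rfl | hn
  · simpa using mul_nonneg ha.le (Real.rpow_nonneg hx s)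
  have : (0 : ℝ) < n := by exact_mod_cast hn
  have h_rpow : x ^ s ≤ n / (a * s) * Real.exp (a * s * x ^ s / n) :=
    calc x ^ s = n / (a * s) * (a * s * x ^ s / n) := by field_simp
      _ ≤ _ := by
        gcongr
        linarith [Real.add_one_le_exp (a * s * x ^ s / n)]
  calc x ^ n = (x ^ s) ^ ((n : ℝ) / s) := by
        rw [← Real.rpow_mul hx, mul_div_cancel₀ _ hs.ne', Real.rpow_natCast]
    _ ≤ (n / (a * s) * Real.exp (a * s * x ^ s / n)) ^ ((n : ℝ) / s) := by gcongr
    _ = _ := by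
        rw [Real.mul_rpow (by positivity) (by positivity), ← Real.exp_mul]
        congr 2
        field_simp

lemma choose_mul_exp_neg_le {a s : ℝ} (ha : 0 < a) (hs : 0 < s) (n k : ℕ) :
    (k.choose n : ℝ) * Real.exp (-(a * (k : ℝ) ^ s)) ≤
      (n / (a * s)) ^ ((n : ℝ) / s) / n.factorial :=
  calc (k.choose n : ℝ) * Real.exp (-(a * (k : ℝ) ^ s))
      ≤ (k : ℝ) ^ n / n.factorial * Real.exp (-(a * (k : ℝ) ^ s)) := by
        gcongr
        exact Nat.choose_le_pow_div n k
    _ ≤ (n / (a * s)) ^ ((n : ℝ) / s) * Real.exp (a * (k : ℝ) ^ s) / n.factorial *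
          Real.exp (-(a * (k : ℝ) ^ s)) := by
        gcongr
        exact pow_le_rpow_mul_exp ha hs k.cast_nonneg n
    _ = _ := by
        rw [Real.exp_neg]
        field_simp

section

variable {K β : ℝ} {c : ℕ → ℂ}

lemma summable_exp_neg_mul_sqrt (hK : 1 ≤ K) :
    Summable fun k : ℕ => Real.exp (-(K⁻¹ / 2 * (k : ℝ) ^ (1 / 2 : ℝ))) := by
  have : 0 < K := by positivity
  simpa using summable_pow_mul_exp_neg_mul_rpow (a := K⁻¹ / 2) (s := 1 / 2) (by positivity)
    (by norm_num) 0

lemma one_le_supBound (hK : 1 ≤ K) : 1 ≤ supBound K := by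
  have h_zero := (summable_exp_neg_mul_sqrt hK).le_tsum 0 fun n _ => (Real.exp_pos _).le
  rw [Nat.cast_zero, Real.zero_rpow (by norm_num), mul_zero, neg_zero, Real.exp_zero] at h_zero
  rw [supBound]
  nlinarith

lemma Decay.rapidDecay (hK : 1 ≤ K) (hβ : 0 ≤ β) (hc : Decay K β c) : RapidDecay c :=
  rapidDecay_of_norm_le_exp (inv_pos.2 (by linarith)) (exponent_pos hβ) hc

lemma natCast_rpow_inv_exponent (hβ : 0 ≤ β) (n : ℕ) :
    (n : ℝ) ^ (1 / ((1 + β) / (2 + β))) = n * (n : ℝ) ^ (1 / (1 + β)) := by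
  rw [← Real.rpow_one_add' n.cast_nonneg (by positivity)]
  congr 1
  field_simp
  ring

-- Stirling's `n ^ n ≤ n! * exp n` cancels one of the powers of `n`.
lemma choose_mul_exp_neg_exponent_le (hK : 1 ≤ K) (hβ : 0 ≤ β) (n k : ℕ) :
    (k.choose n : ℝ) * Real.exp (-(K⁻¹ / 2 * (k : ℝ) ^ ((1 + β) / (2 + β)))) ≤
      (16 * Real.exp 1 * K ^ 2 * (n : ℝ) ^ (1 / (1 + β))) ^ n := by
  have : 0 < K := by positivity
  set s := (1 + β) / (2 + β) with hs_def
  have hs : 0 < s := exponent_pos hβ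
  have hs2 : 1 / 2 ≤ s := half_le_exponent hβ
  have h_const : (4 * K) ^ (1 / s) ≤ 16 * K ^ 2 :=
    calc (4 * K) ^ (1 / s) ≤ (4 * K) ^ (2 : ℝ) := by
          gcongr
          · linarith
          · rw [div_le_iff₀ hs]
            linarith
      _ = 16 * K ^ 2 := by
          rw [Real.rpow_two]
          ring
  have h_base : n / (K⁻¹ / 2 * s) ≤ 4 * K * n := by
    rw [div_le_iff₀ (by positivity)]
    field_simp
    nlinarith [n.cast_nonneg (α := ℝ)]
  have h_stirling : (n : ℝ) ^ n / n.factorial ≤ Real.exp 1 ^ n := by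
    rw [← Real.exp_nat_mul, mul_one]
    exact Real.pow_div_factorial_le_exp _ n.cast_nonneg n
  calc (k.choose n : ℝ) * Real.exp (-(K⁻¹ / 2 * (k : ℝ) ^ s))
      ≤ (n / (K⁻¹ / 2 * s)) ^ ((n : ℝ) / s) / n.factorial :=
        choose_mul_exp_neg_le (by positivity) hs n k
    _ ≤ (4 * K * n) ^ (1 / s * n) / n.factorial := by
        rw [one_div_mul_eq_div]
        gcongr
    _ = ((4 * K) ^ (1 / s) * (n * (n : ℝ) ^ (1 / (1 + β)))) ^ n / n.factorial := by
        rw [Real.rpow_mul_natCast (by positivity), Real.mul_rpow (by positivity) n.cast_nonneg,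
          hs_def, natCast_rpow_inv_exponent hβ]
    _ ≤ (16 * K ^ 2 * (n * (n : ℝ) ^ (1 / (1 + β)))) ^ n / n.factorial := by gcongr
    _ = (16 * K ^ 2 * (n : ℝ) ^ (1 / (1 + β))) ^ n * ((n : ℝ) ^ n / n.factorial) := by
        rw [mul_left_comm (16 * K ^ 2), mul_pow (n : ℝ)]
        ring
    _ ≤ (16 * K ^ 2 * (n : ℝ) ^ (1 / (1 + β))) ^ n * Real.exp 1 ^ n := by gcongr
    _ = _ := by
        rw [← mul_pow]
        ring

lemma Decay.norm_le_exp_mul_exp (hK : 1 ≤ K) (hβ : 0 ≤ β) (hc : Decay K β c) (k : ℕ) :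
    ‖c k‖ ≤ K * Real.exp (-(K⁻¹ / 2 * (k : ℝ) ^ (1 / 2 : ℝ))) *
      Real.exp (-(K⁻¹ / 2 * (k : ℝ) ^ ((1 + β) / (2 + β)))) := by
  have : 0 < K := by positivity
  refine (hc k).trans ?_
  rw [mul_assoc, ← Real.exp_add]
  gcongr
  linarith [mul_le_mul_of_nonneg_left (half_rpow_le (half_le_exponent hβ) k)
    (show 0 ≤ K⁻¹ / 2 by positivity)]

lemma toReal_binomMoment (n : ℕ) (c : ℕ → ℂ) :
    (binomMoment n c).toReal = ∑' k, (k.choose n : ℝ) * ‖c k‖ := by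
  rw [binomMoment, ENNReal.tsum_toReal_eq fun k => ENNReal.mul_ne_top (by simp) (by simp)]
  exact tsum_congr fun k => by simp [ENNReal.toReal_mul]

lemma Decay.toReal_binomMoment_le (hK : 1 ≤ K) (hβ : 0 ≤ β) (hc : Decay K β c) (n : ℕ) :
    (binomMoment n c).toReal ≤
      supBound K * (16 * Real.exp 1 * K ^ 2 * (n : ℝ) ^ (1 / (1 + β))) ^ n := by
  have : 0 < K := by positivity
  rw [toReal_binomMoment, supBound, ← tsum_mul_left, ← tsum_mul_right]
  refine ((hc.rapidDecay hK hβ).summable_choose_mul_norm n).tsum_le_tsum (fun k => ?_)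
    (((summable_exp_neg_mul_sqrt hK).mul_left K).mul_right _)
  calc (k.choose n : ℝ) * ‖c k‖
      ≤ (k.choose n : ℝ) * (K * Real.exp (-(K⁻¹ / 2 * (k : ℝ) ^ (1 / 2 : ℝ))) *
          Real.exp (-(K⁻¹ / 2 * (k : ℝ) ^ ((1 + β) / (2 + β))))) := by
        gcongr
        exact hc.norm_le_exp_mul_exp hK hβ k
    _ = K * Real.exp (-(K⁻¹ / 2 * (k : ℝ) ^ (1 / 2 : ℝ))) * ((k.choose n : ℝ) *
          Real.exp (-(K⁻¹ / 2 * (k : ℝ) ^ ((1 + β) / (2 + β))))) := by ring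
    _ ≤ _ := by
        gcongr
        exact choose_mul_exp_neg_exponent_le hK hβ n k

lemma Decay.norm_seriesSum_le (hK : 1 ≤ K) (hβ : 0 ≤ β) (hc : Decay K β c) {w : ℂ}
    (hw : ‖w‖ ≤ 1) : ‖seriesSum c w‖ ≤ supBound K := by
  simpa using ((hc.rapidDecay hK hβ).norm_seriesSum_le hw).trans
    (hc.toReal_binomMoment_le hK hβ 0)

lemma Decay.norm_seriesSum_le_exp_neg_card (hK : 1 ≤ K) (hβ : 0 ≤ β) (hc : Decay K β c)
    {Z : Multiset ℂ} (hZ : IsZeroMultiset c Z) {r : ℝ} (hr : 0 < r) {w : ℂ} (hw : ‖w‖ ≤ 1)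
    (hwZ : ∀ z ∈ Z, ‖w - z‖ ≤ 2 * r)
    (hn : (Multiset.card Z : ℝ) ≤ (256 * K ^ 2 * r) ^ (-(1 + β))) :
    ‖seriesSum c w‖ ≤ supBound K * Real.exp (-(Multiset.card Z : ℝ)) := by
  have : 0 < K := by positivity
  have : 0 < supBound K := by linarith [one_le_supBound hK]
  set n := Multiset.card Z
  have h_root : (n : ℝ) ^ (1 / (1 + β)) ≤ (256 * K ^ 2 * r)⁻¹ :=
    calc (n : ℝ) ^ (1 / (1 + β)) ≤ ((256 * K ^ 2 * r) ^ (-(1 + β))) ^ (1 / (1 + β)) := by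
          gcongr
      _ = (256 * K ^ 2 * r)⁻¹ := by
          rw [← Real.rpow_mul (by positivity), ← Real.rpow_neg_one]
          congr 1
          field_simp
  have h_factor : 2 * r * (16 * Real.exp 1 * K ^ 2 * (n : ℝ) ^ (1 / (1 + β))) ≤ Real.exp (-1) :=
    calc _ ≤ 2 * r * (16 * Real.exp 1 * K ^ 2 * (256 * K ^ 2 * r)⁻¹) := by gcongr
      _ = Real.exp 1 / 8 := by
          field_simp
          norm_num
      _ ≤ Real.exp (-1) := by
          rw [Real.exp_neg, div_le_iff₀ (by norm_num), inv_mul_eq_div, le_div_iff₀ (Real.exp_pos 1)]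
          nlinarith [Real.exp_one_lt_d9, Real.exp_pos 1]
  calc ‖seriesSum c w‖ ≤ (2 * r) ^ n * (binomMoment n c).toReal :=
        hZ.norm_seriesSum_le (hc.rapidDecay hK hβ) hw hwZ
    _ ≤ (2 * r) ^ n * (supBound K * (16 * Real.exp 1 * K ^ 2 * (n : ℝ) ^ (1 / (1 + β))) ^ n) := by
        gcongr
        exact hc.toReal_binomMoment_le hK hβ n
    _ = supBound K * (2 * r * (16 * Real.exp 1 * K ^ 2 * (n : ℝ) ^ (1 / (1 + β)))) ^ n := by
        rw [mul_pow (2 * r)]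
        ring
    _ ≤ supBound K * Real.exp (-1) ^ n := by gcongr
    _ = _ := by
        rw [← Real.exp_nat_mul]
        ring_nf

end

/-! ### The Poisson–Jensen inequality for polynomials -/

section

open Polynomial

variable {p q : ℂ[X]} {w : ℂ}

/-- The Poisson integral over the unit circle of `log ‖p‖`, evaluated at `w`. -/
noncomputable def poissonLog (p : ℂ[X]) (w : ℂ) : ℝ :=
  Real.circleAverage (fun z => poissonKernel 0 w z * Real.log ‖p.eval z‖) 0 1

lemma continuousOn_poissonKernel (hw : ‖w‖ < 1) :
    ContinuousOn (poissonKernel 0 w) (sphere 0 |1|) := by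
  rw [poissonKernel_eq_re_herglotzRieszKernel]
  exact Complex.continuous_re.comp_continuousOn
    (continuousOn_herglotzRieszKernel_sphere (by simpa using hw))

lemma continuous_poissonKernel_circleMap (hw : ‖w‖ < 1) :
    Continuous fun θ => poissonKernel 0 w (circleMap 0 1 θ) :=
  (continuousOn_poissonKernel hw).comp_continuous (continuous_circleMap 0 1)
    (circleMap_mem_sphere' 0 1)

lemma circleIntegrable_log_norm_eval (p : ℂ[X]) :
    CircleIntegrable (fun z => Real.log ‖p.eval z‖) 0 1 :=
  MeromorphicOn.circleIntegrable_log_norm fun z _ =>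
    (p.differentiable.analyticAt z).meromorphicAt

lemma circleIntegrable_poissonKernel_mul {g : ℂ → ℝ} (hw : ‖w‖ < 1)
    (hg : CircleIntegrable g 0 1) :
    CircleIntegrable (fun z => poissonKernel 0 w z * g z) 0 1 :=
  IntervalIntegrable.continuousOn_mul (f := fun θ => g (circleMap 0 1 θ)) hg
    (continuous_poissonKernel_circleMap hw).continuousOn

lemma poissonLog_eq_of_eval_ne_zero (hp : ∀ z : ℂ, ‖z‖ ≤ 1 → p.eval z ≠ 0) (hw : ‖w‖ < 1) :
    poissonLog p w = Real.log ‖p.eval w‖ := by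
  have h_harmonic : InnerProductSpace.HarmonicOnNhd (fun z => Real.log ‖p.eval z‖)
      (closedBall 0 1) := fun z hz =>
    (p.differentiable.analyticAt z).harmonicAt_log_norm (hp z (by simpa using hz))
  exact h_harmonic.circleAverage_poissonKernel_smul (by simpa using hw)

lemma poissonLog_X_sub_C_of_norm_eq_one {b : ℂ} (hb : ‖b‖ = 1) (hw : ‖w‖ < 1) :
    poissonLog (X - C b) w = Real.log ‖(X - C b).eval w‖ := by
  have h_average := circleAverage_re_herglotzRieszKernel_mul_log (c := 0) (R := 1) (ρ := b)
    (w := w) (by simpa using hb) (by simpa using hw)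
  rw [← poissonKernel_eq_re_herglotzRieszKernel] at h_average
  simp only [poissonLog, eval_sub, eval_X, eval_C]
  exact h_average

lemma norm_sub_le_norm_one_sub_conj_mul {b : ℂ} (hb : ‖b‖ ≤ 1) (hw : ‖w‖ ≤ 1) :
    ‖w - b‖ ≤ ‖1 - (starRingEnd ℂ) b * w‖ := by
  have h_diff : Complex.normSq (1 - (starRingEnd ℂ) b * w) - Complex.normSq (w - b) =
      (1 - Complex.normSq b) * (1 - Complex.normSq w) := by
    simp only [Complex.normSq_apply, Complex.sub_re, Complex.sub_im, Complex.mul_re,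
      Complex.mul_im, Complex.conj_re, Complex.conj_im, Complex.one_re, Complex.one_im]
    ring
  simp only [Complex.normSq_eq_norm_sq] at h_diff
  have : ‖b‖ ^ 2 ≤ 1 := pow_le_one₀ (norm_nonneg b) hb
  have : ‖w‖ ^ 2 ≤ 1 := pow_le_one₀ (norm_nonneg w) hw
  rw [← sq_le_sq₀ (norm_nonneg _) (norm_nonneg _)]
  nlinarith

-- Reflecting `b` in the unit circle changes `‖w - b‖` into `‖1 - conj b * w‖`, which agrees with it
-- on the circle and is free of zeros in the disc.
lemma norm_eval_X_sub_C_le_exp_poissonLog_of_norm_lt_one {b : ℂ} (hb : ‖b‖ < 1) (hw : ‖w‖ < 1) :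
    ‖(X - C b).eval w‖ ≤ Real.exp (poissonLog (X - C b) w) := by
  set q : ℂ[X] := 1 - C ((starRingEnd ℂ) b) * X
  have h_eval : ∀ z, q.eval z = 1 - (starRingEnd ℂ) b * z := fun z => by simp [q]
  have h_ne_zero : ∀ z : ℂ, ‖z‖ ≤ 1 → q.eval z ≠ 0 := by
    intro z hz h
    have h_norm : ‖b‖ * ‖z‖ = 1 := by
      rw [← Complex.norm_conj b, ← norm_mul, ← sub_eq_zero.1 ((h_eval z).symm.trans h), norm_one]
    nlinarith [norm_nonneg b, norm_nonneg z]
  have h_reflect : poissonLog (X - C b) w = poissonLog q w := by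
    refine Real.circleAverage_congr_sphere fun z hz => ?_
    rw [abs_one, mem_sphere_zero_iff_norm] at hz
    simp only [h_eval, eval_sub, eval_X, eval_C]
    rw [norm_sub_eq_norm_one_sub_conj_mul hz]
  rw [h_reflect, poissonLog_eq_of_eval_ne_zero h_ne_zero hw,
    Real.exp_log (norm_pos_iff.2 (h_ne_zero w hw.le)), h_eval]
  simpa using norm_sub_le_norm_one_sub_conj_mul hb.le hw.le

lemma norm_eval_X_sub_C_le_exp_poissonLog (b : ℂ) (hw : ‖w‖ < 1) :
    ‖(X - C b).eval w‖ ≤ Real.exp (poissonLog (X - C b) w) := by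
  rcases lt_trichotomy ‖b‖ 1 with hb | hb | hb
  · exact norm_eval_X_sub_C_le_exp_poissonLog_of_norm_lt_one hb hw
  · rw [poissonLog_X_sub_C_of_norm_eq_one hb hw]
    exact Real.le_exp_log _
  · have h_ne_zero : ∀ z : ℂ, ‖z‖ ≤ 1 → (X - C b).eval z ≠ 0 := by
      intro z hz h
      rw [eval_sub, eval_X, eval_C, sub_eq_zero] at h
      exact hb.not_ge (h ▸ hz)
    rw [poissonLog_eq_of_eval_ne_zero h_ne_zero hw]
    exact Real.le_exp_log _

lemma ae_eval_circleMap_ne_zero (hp : p ≠ 0) : ∀ᵐ θ : ℝ, p.eval (circleMap 0 1 θ) ≠ 0 := by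
  have h_countable : {z | p.IsRoot z}.Countable := (finite_setOfPred_isRoot hp).countable
  exact (h_countable.preimage_circleMap 0 one_ne_zero).ae_notMem volume

lemma poissonLog_mul (hp : p ≠ 0) (hq : q ≠ 0) (hw : ‖w‖ < 1) :
    poissonLog (p * q) w = poissonLog p w + poissonLog q w := by
  rw [poissonLog, poissonLog, poissonLog, ← Real.circleAverage_fun_add
    (circleIntegrable_poissonKernel_mul hw (circleIntegrable_log_norm_eval p))
    (circleIntegrable_poissonKernel_mul hw (circleIntegrable_log_norm_eval q)),
    Real.circleAverage_def, Real.circleAverage_def]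
  congr 1
  apply intervalIntegral.integral_congr_ae
  filter_upwards [ae_eval_circleMap_ne_zero hp, ae_eval_circleMap_ne_zero hq] with θ hpθ hqθ _
  rw [eval_mul, norm_mul, Real.log_mul (norm_ne_zero_iff.2 hpθ) (norm_ne_zero_iff.2 hqθ)]
  ring

lemma norm_eval_mul_le_exp_poissonLog (hp : p ≠ 0) (hq : q ≠ 0) (hw : ‖w‖ < 1)
    (hpw : ‖p.eval w‖ ≤ Real.exp (poissonLog p w))
    (hqw : ‖q.eval w‖ ≤ Real.exp (poissonLog q w)) :
    ‖(p * q).eval w‖ ≤ Real.exp (poissonLog (p * q) w) := by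
  rw [poissonLog_mul hp hq hw, eval_mul, norm_mul, Real.exp_add]
  gcongr

lemma norm_eval_le_exp_poissonLog (hp : p ≠ 0) (hw : ‖w‖ < 1) :
    ‖p.eval w‖ ≤ Real.exp (poissonLog p w) := by
  have h_lead : p.leadingCoeff ≠ 0 := leadingCoeff_ne_zero.2 hp
  have h_const : ‖(C p.leadingCoeff).eval w‖ ≤ Real.exp (poissonLog (C p.leadingCoeff) w) := by
    rw [poissonLog_eq_of_eval_ne_zero (fun z _ => by simpa using h_lead) hw]
    exact Real.le_exp_log _
  have h_prod : ∀ Z : Multiset ℂ, ‖(Z.map (X - C ·)).prod.eval w‖ ≤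
      Real.exp (poissonLog (Z.map (X - C ·)).prod w) := by
    intro Z
    induction Z using Multiset.induction with
    | empty => simp [poissonLog, Real.circleAverage_const]
    | cons b Z ih =>
      rw [Multiset.map_cons, Multiset.prod_cons]
      exact norm_eval_mul_le_exp_poissonLog (X_sub_C_ne_zero b)
        (monic_multisetProd_X_sub_C Z).ne_zero hw (norm_eval_X_sub_C_le_exp_poissonLog b hw) ih
  rw [(IsAlgClosed.splits p).eq_prod_roots]
  exact norm_eval_mul_le_exp_poissonLog (C_ne_zero.2 h_lead)
    (monic_multisetProd_X_sub_C p.roots).ne_zero hw h_const (h_prod p.roots)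

end

/-! ### Logarithmic mass on arcs -/

section

open Polynomial

variable {P : ℂ[X]} {w : ℂ} {θ₀ ρ : ℝ}

/-- The function `log (1 / ‖P‖)` on the unit circle, in the angular variable. -/
noncomputable def logInv (P : ℂ[X]) (θ : ℝ) : ℝ := -Real.log ‖P.eval (circleMap 0 1 θ)‖

/-- The integral of `log (1 / ‖P‖)` over the arc of half-length `ρ` centred at the angle `θ₀`. -/
noncomputable def mass (P : ℂ[X]) (θ₀ ρ : ℝ) : ℝ := ∫ θ in (θ₀ - ρ)..(θ₀ + ρ), logInv P θ

lemma intervalIntegrable_logInv (P : ℂ[X]) (a b : ℝ) :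
    IntervalIntegrable (logInv P) volume a b := by
  have h_mero : MeromorphicOn (fun θ : ℝ => P.eval (circleMap 0 1 θ)) (uIcc a b) := fun θ _ =>
    ((P.differentiable.analyticAt _).restrictScalars.comp
      (analyticOnNhd_circleMap 0 1 θ (mem_univ θ))).meromorphicAt
  exact h_mero.intervalIntegrable_log_norm.neg

lemma integral_le_integral_logInv {g : ℝ → ℝ} {a b : ℝ} (hP : P ≠ 0) (hab : a ≤ b)
    (hg : IntervalIntegrable g volume a b)
    (h : ∀ θ ∈ Icc a b, P.eval (circleMap 0 1 θ) ≠ 0 → g θ ≤ logInv P θ) :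
    ∫ θ in a..b, g θ ≤ ∫ θ in a..b, logInv P θ := by
  refine intervalIntegral.integral_mono_ae_restrict hab hg (intervalIntegrable_logInv P a b) ?_
  filter_upwards [ae_restrict_of_ae (ae_eval_circleMap_ne_zero hP),
    ae_restrict_mem measurableSet_Icc] with θ hne hθ using h θ hθ hne

lemma ne_zero_of_exp_le_norm_eval {t : ℝ} {z : ℂ} (ht : Real.exp t ≤ ‖P.eval z‖) : P ≠ 0 := by
  rintro rfl
  rw [eval_zero, norm_zero] at ht
  exact (Real.exp_pos _).not_ge ht

lemma norm_circleMap_zero_one (θ : ℝ) : ‖circleMap 0 1 θ‖ = 1 := by simp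

lemma logInv_nonneg (hP : ∀ z : ℂ, ‖z‖ ≤ 1 → ‖P.eval z‖ ≤ 1) (θ : ℝ) : 0 ≤ logInv P θ :=
  neg_nonneg.2 <| Real.log_nonpos (norm_nonneg _) (hP _ (norm_circleMap_zero_one θ).le)

lemma mass_mono {ρ' : ℝ} (hP : ∀ z : ℂ, ‖z‖ ≤ 1 → ‖P.eval z‖ ≤ 1) (θ₀ : ℝ) (hρ : 0 ≤ ρ)
    (h : ρ ≤ ρ') : mass P θ₀ ρ ≤ mass P θ₀ ρ' :=
  intervalIntegral.integral_mono_interval (by linarith) (by linarith) (by linarith)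
    (.of_forall fun θ => logInv_nonneg hP θ) (intervalIntegrable_logInv P _ _)

lemma mass_nonneg (hP : ∀ z : ℂ, ‖z‖ ≤ 1 → ‖P.eval z‖ ≤ 1) (θ₀ : ℝ) (hρ : 0 ≤ ρ) :
    0 ≤ mass P θ₀ ρ :=
  intervalIntegral.integral_nonneg (by linarith) fun θ _ => logInv_nonneg hP θ

lemma poissonKernel_zero_circleMap (w : ℂ) (θ : ℝ) :
    poissonKernel 0 w (circleMap 0 1 θ) = (1 - ‖w‖ ^ 2) / ‖circleMap 0 1 θ - w‖ ^ 2 := by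
  rw [poissonKernel, sub_zero, sub_zero, norm_circleMap_zero_one, one_pow]

lemma poissonKernel_nonneg (hw : ‖w‖ ≤ 1) (θ : ℝ) :
    0 ≤ poissonKernel 0 w (circleMap 0 1 θ) := by
  rw [poissonKernel_zero_circleMap]
  have := pow_le_one₀ (n := 2) (norm_nonneg w) hw
  exact div_nonneg (by linarith) (by positivity)

lemma poissonLog_eq_neg_integral (P : ℂ[X]) (w : ℂ) (θ₀ : ℝ) :
    poissonLog P w = -((2 * Real.pi)⁻¹ * ∫ θ in (θ₀ - Real.pi)..(θ₀ + Real.pi),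
      poissonKernel 0 w (circleMap 0 1 θ) * logInv P θ) := by
  have h_periodic : Function.Periodic
      (fun θ => poissonKernel 0 w (circleMap 0 1 θ) * logInv P θ) (2 * Real.pi) := by
    intro θ
    simp only [logInv, periodic_circleMap 0 1 θ]
  have h_shift := h_periodic.intervalIntegral_add_eq 0 (θ₀ - Real.pi)
  rw [zero_add, show θ₀ - Real.pi + 2 * Real.pi = θ₀ + Real.pi by ring] at h_shift
  rw [poissonLog, Real.circleAverage_def, smul_eq_mul, ← h_shift, ← mul_neg,
    ← intervalIntegral.integral_neg]
  simp only [logInv, mul_neg, neg_neg]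

lemma norm_eval_le_exp_neg_mass {l : ℝ} (hP0 : P ≠ 0)
    (hP : ∀ z : ℂ, ‖z‖ ≤ 1 → ‖P.eval z‖ ≤ 1) (hw : ‖w‖ < 1) (hρ0 : 0 ≤ ρ) (hρ : ρ ≤ Real.pi)
    (hl : ∀ θ ∈ Icc (θ₀ - ρ) (θ₀ + ρ), l ≤ poissonKernel 0 w (circleMap 0 1 θ)) :
    ‖P.eval w‖ ≤ Real.exp (-(l / (2 * Real.pi) * mass P θ₀ ρ)) := by
  have := Real.pi_pos
  set g : ℝ → ℝ := fun θ => poissonKernel 0 w (circleMap 0 1 θ) * logInv P θ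
  have h_int : ∀ a b, IntervalIntegrable g volume a b := fun a b =>
    (intervalIntegrable_logInv P a b).continuousOn_mul
      (continuous_poissonKernel_circleMap hw).continuousOn
  have h_arc : l * mass P θ₀ ρ ≤ ∫ θ in (θ₀ - ρ)..(θ₀ + ρ), g θ := by
    rw [mass, ← intervalIntegral.integral_const_mul]
    exact intervalIntegral.integral_mono_on (by linarith)
      ((intervalIntegrable_logInv P _ _).const_mul l) (h_int _ _) fun θ hθ =>
        mul_le_mul_of_nonneg_right (hl θ hθ) (logInv_nonneg hP θ)
  have h_circle : ∫ θ in (θ₀ - ρ)..(θ₀ + ρ), g θ ≤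
      ∫ θ in (θ₀ - Real.pi)..(θ₀ + Real.pi), g θ :=
    intervalIntegral.integral_mono_interval (by linarith) (by linarith) (by linarith)
      (.of_forall fun θ => mul_nonneg (poissonKernel_nonneg hw.le θ) (logInv_nonneg hP θ))
      (h_int _ _)
  refine (norm_eval_le_exp_poissonLog hP0 hw).trans (Real.exp_le_exp.2 ?_)
  rw [poissonLog_eq_neg_integral P w θ₀, div_eq_inv_mul, mul_assoc]
  gcongr
  exact h_arc.trans h_circle

lemma mass_le {A : ℝ} (hP : ∀ z : ℂ, ‖z‖ ≤ 1 → ‖P.eval z‖ ≤ 1)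
    (hA : Real.exp (-A) ≤ ‖P.eval 0‖) (θ₀ : ℝ) (hρ0 : 0 ≤ ρ) (hρ : ρ ≤ Real.pi) :
    mass P θ₀ ρ ≤ 2 * Real.pi * A := by
  have h_eval := norm_eval_le_exp_neg_mass (ne_zero_of_exp_le_norm_eval hA) hP (w := 0) (θ₀ := θ₀)
    (l := 1) (by simp) hρ0 hρ fun θ _ => by simp [poissonKernel]
  have h_log := neg_le_neg_iff.1 (Real.exp_le_exp.1 (hA.trans h_eval))
  rwa [one_div, inv_mul_le_iff₀ Real.two_pi_pos] at h_log

lemma norm_circleMap_sub_circleMap_le (θ t : ℝ) :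
    ‖circleMap 0 1 θ - circleMap 0 1 t‖ ≤ |θ - t| := by
  simpa [dist_eq_norm, Real.dist_eq] using (lipschitzWith_circleMap 0 1).dist_le_mul θ t

lemma norm_eval_le_exp_of_near_arc {z : ℂ} {h θ : ℝ} (hP0 : P ≠ 0)
    (hP : ∀ z : ℂ, ‖z‖ ≤ 1 → ‖P.eval z‖ ≤ 1) (hh : 0 < h) (hhρ : h ≤ ρ) (hρ : ρ ≤ 1)
    (hθ : |θ - θ₀| ≤ 2 * ρ) (hzθ : ‖z - circleMap 0 1 θ‖ ≤ h) (hz : ‖z‖ ^ 2 ≤ 1 - h / 2) :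
    ‖P.eval z‖ ≤ Real.exp (-(h * mass P θ₀ ρ / (256 * ρ ^ 2))) := by
  have hρ0 : 0 < ρ := hh.trans_le hhρ
  have hz_lt : ‖z‖ < 1 := by nlinarith [norm_nonneg z]
  have h_dist : ∀ t ∈ Icc (θ₀ - ρ) (θ₀ + ρ), ‖circleMap 0 1 t - z‖ ≤ 4 * ρ := by
    intro t ht
    have h_angle : |θ - t| ≤ 3 * ρ := by
      rw [abs_le] at hθ ⊢
      constructor <;> linarith [ht.1, ht.2]
    linarith [norm_sub_rev z (circleMap 0 1 t), norm_circleMap_sub_circleMap_le θ t,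
      norm_sub_le_norm_sub_add_norm_sub z (circleMap 0 1 θ) (circleMap 0 1 t)]
  have h_kernel : ∀ t ∈ Icc (θ₀ - ρ) (θ₀ + ρ),
      h / (32 * ρ ^ 2) ≤ poissonKernel 0 z (circleMap 0 1 t) := by
    intro t ht
    have : 0 < ‖circleMap 0 1 t - z‖ := by
      rw [norm_pos_iff, sub_ne_zero]
      rintro rfl
      exact hz_lt.ne (norm_circleMap_zero_one t)
    rw [poissonKernel_zero_circleMap, le_div_iff₀ (by positivity)]
    calc h / (32 * ρ ^ 2) * ‖circleMap 0 1 t - z‖ ^ 2 ≤ h / (32 * ρ ^ 2) * (4 * ρ) ^ 2 := by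
          gcongr
          exact h_dist t ht
      _ = h / 2 := by
          field_simp
          norm_num
      _ ≤ _ := by linarith
  refine (norm_eval_le_exp_neg_mass hP0 hP hz_lt hρ0.le (by linarith [Real.pi_gt_three])
    h_kernel).trans (Real.exp_le_exp.2 (neg_le_neg ?_))
  have := mass_nonneg hP θ₀ hρ0.le
  calc h * mass P θ₀ ρ / (256 * ρ ^ 2) = h / (32 * ρ ^ 2) / 8 * mass P θ₀ ρ := by
        field_simp
        ring
    _ ≤ h / (32 * ρ ^ 2) / (2 * Real.pi) * mass P θ₀ ρ := by
        gcongr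
        linarith [Real.pi_lt_four]

end

/-! ### Partial sums -/

section

variable {K β h T : ℝ} {c : ℕ → ℂ} {n N : ℕ} {z z₀ : ℂ}

/-- The polynomial of degree less than `n` with coefficients `c`, as a function. -/
noncomputable def partialSum (c : ℕ → ℂ) (n : ℕ) (z : ℂ) : ℂ := ∑ k ∈ Finset.range n, c k * z ^ k

lemma differentiable_partialSum (c : ℕ → ℂ) (n : ℕ) : Differentiable ℂ (partialSum c n) := by
  unfold partialSum
  fun_prop

lemma sum_mul_exp_neg_le_supBound (hK : 1 ≤ K) (s : Finset ℕ) :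
    ∑ k ∈ s, K * Real.exp (-(K⁻¹ / 2 * (k : ℝ) ^ (1 / 2 : ℝ))) ≤ supBound K := by
  rw [← Finset.mul_sum, supBound]
  gcongr
  exact (summable_exp_neg_mul_sqrt hK).sum_le_tsum _ fun k _ => (Real.exp_pos _).le

lemma rpow_mul_rpow_exponent (hβ : 0 ≤ β) (k : ℕ) :
    (k : ℝ) ^ (1 / (2 + β)) * (k : ℝ) ^ ((1 + β) / (2 + β)) = k := by
  rw [← Real.rpow_add_of_nonneg k.cast_nonneg (by positivity) (by positivity), ← add_div,
    show 1 + (1 + β) = 2 + β by ring, div_self (by positivity), Real.rpow_one]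

lemma norm_pow_le_exp_of_norm_le_one_add (hβ : 0 ≤ β) {k : ℕ}
    (hk : h * (k : ℝ) ^ (1 / (2 + β)) ≤ K⁻¹ / 2) (hz : ‖z‖ ≤ 1 + h) :
    ‖z‖ ^ k ≤ Real.exp (K⁻¹ / 2 * (k : ℝ) ^ ((1 + β) / (2 + β))) :=
  calc ‖z‖ ^ k ≤ Real.exp h ^ k := by
        gcongr
        linarith [Real.add_one_le_exp h]
    _ = Real.exp (h * (k : ℝ) ^ (1 / (2 + β)) * (k : ℝ) ^ ((1 + β) / (2 + β))) := by
        rw [← Real.exp_nat_mul, mul_assoc, rpow_mul_rpow_exponent hβ, mul_comm]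
    _ ≤ _ := by gcongr

lemma Decay.norm_partialSum_le (hK : 1 ≤ K) (hβ : 0 ≤ β) (hc : Decay K β c)
    (hn : ∀ k < n, h * (k : ℝ) ^ (1 / (2 + β)) ≤ K⁻¹ / 2) (hz : ‖z‖ ≤ 1 + h) :
    ‖partialSum c n z‖ ≤ supBound K := by
  refine (norm_sum_le _ _).trans (le_trans (Finset.sum_le_sum fun k hk => ?_)
    (sum_mul_exp_neg_le_supBound hK (Finset.range n)))
  rw [norm_mul, norm_pow]
  calc ‖c k‖ * ‖z‖ ^ k
      ≤ K * Real.exp (-(K⁻¹ / 2 * (k : ℝ) ^ (1 / 2 : ℝ))) *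
          Real.exp (-(K⁻¹ / 2 * (k : ℝ) ^ ((1 + β) / (2 + β)))) *
          Real.exp (K⁻¹ / 2 * (k : ℝ) ^ ((1 + β) / (2 + β))) := by
        gcongr
        · exact hc.norm_le_exp_mul_exp hK hβ k
        · exact norm_pow_le_exp_of_norm_le_one_add hβ (hn k (Finset.mem_range.1 hk)) hz
    _ = _ := by
        rw [mul_assoc _ (Real.exp (-_)), ← Real.exp_add, neg_add_cancel, Real.exp_zero, mul_one]

lemma Decay.norm_partialSum_sub_le (hK : 1 ≤ K) (hβ : 0 ≤ β) (hc : Decay K β c) (hnN : n ≤ N)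
    (hz : ‖z‖ ≤ 1) :
    ‖partialSum c N z - partialSum c n z‖ ≤
      supBound K * Real.exp (-(K⁻¹ / 2 * (n : ℝ) ^ ((1 + β) / (2 + β)))) := by
  have : 0 < K := by positivity
  rw [partialSum, partialSum, ← Finset.sum_Ico_eq_sub _ hnN]
  calc ‖∑ k ∈ Finset.Ico n N, c k * z ^ k‖
      ≤ ∑ k ∈ Finset.Ico n N, K * Real.exp (-(K⁻¹ / 2 * (k : ℝ) ^ (1 / 2 : ℝ))) *
          Real.exp (-(K⁻¹ / 2 * (n : ℝ) ^ ((1 + β) / (2 + β)))) := by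
        refine norm_sum_le_of_le _ fun k hk => ?_
        refine (norm_mul_pow_le c hz k).trans ((hc.norm_le_exp_mul_exp hK hβ k).trans ?_)
        have := (Finset.mem_Ico.1 hk).1
        gcongr
    _ ≤ _ := by
        rw [← Finset.sum_mul]
        gcongr
        exact sum_mul_exp_neg_le_supBound hK _

/-! ### Propagation of smallness to the circle -/

lemma re_sq_add_im_sq (z : ℂ) : z.re ^ 2 + z.im ^ 2 = ‖z‖ ^ 2 := by
  rw [Complex.sq_norm, Complex.normSq_apply, sq, sq]

lemma exists_rotation_re_le {v : ℂ} (hv : ‖v‖ = 1) :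
    ∃ j < 4, (Complex.I ^ j * v).re ≤ -(7 / 10) := by
  have h_circle : v.re ^ 2 + v.im ^ 2 = 1 := by
    rw [re_sq_add_im_sq, hv, one_pow]
  by_contra! h_re
  have h0 := h_re 0 (by norm_num)
  have h1 := h_re 1 (by norm_num)
  have h2 := h_re 2 (by norm_num)
  have h3 := h_re 3 (by norm_num)
  simp only [pow_zero, one_mul, pow_one, Complex.mul_re, Complex.I_re, Complex.I_im, zero_mul,
    Complex.I_sq, Complex.I_pow_three, Complex.neg_re, Complex.neg_im, Complex.one_re,
    Complex.one_im] at h0 h1 h2 h3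
  nlinarith

-- Apply the maximum principle to the product of the four rotations of `F` by right angles.
lemma norm_pow_four_le_of_norm_le_on_arc {F : ℂ → ℂ} (hF : Differentiable ℂ F) {M m : ℝ}
    (hM : ∀ u : ℂ, ‖u‖ = 1 → ‖F u‖ ≤ M)
    (hm : ∀ u : ℂ, ‖u‖ = 1 → u.re ≤ -(7 / 10) → ‖F u‖ ≤ m) :
    ‖F 0‖ ^ 4 ≤ M ^ 3 * m := by
  set g : ℂ → ℂ := fun v => ∏ j ∈ Finset.range 4, F (Complex.I ^ j * v) with hg
  have h_norm : ∀ v : ℂ, ‖v‖ = 1 → ∀ j, ‖Complex.I ^ j * v‖ = 1 := fun v hv j => by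
    rw [norm_mul, norm_pow, Complex.norm_I, one_pow, hv, one_mul]
  have h_bound : ∀ v : ℂ, ‖v‖ = 1 → ‖g v‖ ≤ M ^ 3 * m := by
    intro v hv
    obtain ⟨j, hj, hre⟩ := exists_rotation_re_le hv
    have hM0 : 0 ≤ M := (norm_nonneg _).trans (hM v hv)
    rw [hg, norm_prod, ← Finset.prod_erase_mul _ _ (Finset.mem_range.2 hj)]
    refine mul_le_mul ?_ (hm _ (h_norm v hv j) hre) (norm_nonneg _) (by positivity)
    calc ∏ i ∈ (Finset.range 4).erase j, ‖F (Complex.I ^ i * v)‖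
        ≤ ∏ _i ∈ (Finset.range 4).erase j, M :=
          Finset.prod_le_prod (fun _ _ => norm_nonneg _) fun i _ => hM _ (h_norm v hv i)
      _ = M ^ 3 := by
          rw [Finset.prod_const, Finset.card_erase_of_mem (Finset.mem_range.2 hj),
            Finset.card_range]
  have h_zero : ‖g 0‖ ≤ M ^ 3 * m := by
    refine Complex.norm_le_of_forall_mem_frontier_norm_le (U := ball (0 : ℂ) 1) isBounded_ball
      (by fun_prop : Differentiable ℂ g).diffContOnCl (fun v hv => h_bound v ?_)
      (subset_closure (by simp))
    rwa [frontier_ball _ one_ne_zero, mem_sphere_zero_iff_norm] at hv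
  simpa [hg] using h_zero

lemma Decay.exists_partialSum_truncation (hK : 1 ≤ K) (hβ : 0 ≤ β) (hc : Decay K β c) (N : ℕ)
    (hh : 0 < h) (hT : T ≤ K⁻¹ / 2 * (K⁻¹ / (2 * h)) ^ (1 + β)) :
    ∃ n, (∀ z : ℂ, ‖z‖ ≤ 1 →
        ‖partialSum c N z - partialSum c n z‖ ≤ supBound K * Real.exp (-T)) ∧
      ∀ z : ℂ, ‖z‖ ≤ 1 + h → ‖partialSum c n z‖ ≤ supBound K := by
  have : 0 < K := by positivity
  have : 0 < supBound K := by linarith [one_le_supBound hK]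
  set x := (K⁻¹ / (2 * h)) ^ (2 + β) with hx
  refine ⟨min ⌈x⌉₊ N, fun z hz => ?_, fun z => hc.norm_partialSum_le hK hβ fun k hk => ?_⟩
  · rcases le_total ⌈x⌉₊ N with hN | hN
    · rw [min_eq_left hN]
      refine (hc.norm_partialSum_sub_le hK hβ hN hz).trans ?_
      gcongr
      calc T ≤ K⁻¹ / 2 * (K⁻¹ / (2 * h)) ^ (1 + β) := hT
        _ = K⁻¹ / 2 * x ^ ((1 + β) / (2 + β)) := by
            rw [hx, ← Real.rpow_mul (by positivity), mul_div_cancel₀ _ (by positivity)]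
        _ ≤ _ := by
            gcongr
            exact Nat.le_ceil x
    · rw [min_eq_right hN, sub_self, norm_zero]
      positivity
  · have hkx : (k : ℝ) < x := Nat.lt_ceil.1 (hk.trans_le (min_le_left _ _))
    calc h * (k : ℝ) ^ (1 / (2 + β)) ≤ h * x ^ (1 / (2 + β)) := by gcongr
      _ = h * (K⁻¹ / (2 * h)) := by
          rw [hx, ← Real.rpow_mul (by positivity), mul_one_div_cancel (by positivity),
            Real.rpow_one]
      _ = K⁻¹ / 2 := by field_simp

lemma norm_mul_one_add_sq_le (hh : 0 ≤ h) (hh2 : h ≤ 1 / 2) (hz₀ : ‖z₀‖ = 1) {u : ℂ}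
    (hu : ‖u‖ = 1) (hre : u.re ≤ -(7 / 10)) : ‖z₀ * (1 + h * u)‖ ^ 2 ≤ 1 - h / 2 := by
  have h_circle : u.re ^ 2 + u.im ^ 2 = 1 := by
    rw [re_sq_add_im_sq, hu, one_pow]
  have h_expand : ‖z₀ * (1 + h * u)‖ ^ 2 = 1 + 2 * (h * u.re) + h * h := by
    rw [norm_mul, hz₀, one_mul, ← re_sq_add_im_sq]
    simp only [Complex.add_re, Complex.one_re, Complex.re_ofReal_mul, Complex.add_im,
      Complex.one_im, Complex.im_ofReal_mul]
    linear_combination h ^ 2 * h_circle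
  rw [h_expand]
  nlinarith [mul_le_mul_of_nonneg_left hre hh]

lemma norm_mul_one_add_sub (hh : 0 ≤ h) (hz₀ : ‖z₀‖ = 1) {u : ℂ} (hu : ‖u‖ = 1) :
    ‖z₀ * (1 + h * u) - z₀‖ = h := by
  rw [mul_one_add, add_sub_cancel_left, norm_mul, norm_mul, hz₀, hu, Complex.norm_real,
    Real.norm_of_nonneg hh, one_mul, mul_one]

-- A truncation of the partial sum is bounded on the whole disc of radius `h` about `z₀`, and small
-- on the arc of its boundary that lies well inside the unit disc.
lemma Decay.norm_partialSum_boundary_le (hK : 1 ≤ K) (hβ : 0 ≤ β) (hc : Decay K β c) (N : ℕ)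
    (hh : 0 < h) (hh2 : h ≤ 1 / 2) (hT0 : 0 ≤ T)
    (hT : T ≤ K⁻¹ / 2 * (K⁻¹ / (2 * h)) ^ (1 + β)) (hz₀ : ‖z₀‖ = 1)
    (hdeep : ∀ z : ℂ, ‖z - z₀‖ ≤ h → ‖z‖ ^ 2 ≤ 1 - h / 2 →
      ‖partialSum c N z‖ ≤ supBound K * Real.exp (-T)) :
    ‖partialSum c N z₀‖ ≤ 3 * supBound K * Real.exp (-(T / 4)) := by
  obtain ⟨n, h_trunc, h_big⟩ := hc.exists_partialSum_truncation hK hβ N hh hT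
  set S := supBound K
  have : 0 < S := by linarith [one_le_supBound hK]
  set F : ℂ → ℂ := fun u => partialSum c n (z₀ * (1 + h * u))
  have hF : Differentiable ℂ F := (differentiable_partialSum c n).comp (by fun_prop)
  have h_all : ∀ u : ℂ, ‖u‖ = 1 → ‖F u‖ ≤ S := fun u hu =>
    h_big _ <| calc ‖z₀ * (1 + h * u)‖ ≤ ‖z₀ * (1 + h * u) - z₀‖ + ‖z₀‖ :=
          norm_le_norm_sub_add _ _
      _ = 1 + h := by rw [norm_mul_one_add_sub hh.le hz₀ hu, hz₀, add_comm]
  have h_small : ∀ u : ℂ, ‖u‖ = 1 → u.re ≤ -(7 / 10) → ‖F u‖ ≤ 2 * S * Real.exp (-T) := by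
    intro u hu hre
    have h_sq := norm_mul_one_add_sq_le hh.le hh2 hz₀ hu hre
    have h_le : ‖z₀ * (1 + h * u)‖ ≤ 1 := by nlinarith [norm_nonneg (z₀ * (1 + h * u))]
    linarith [norm_le_norm_add_norm_sub (partialSum c N (z₀ * (1 + h * u))) (F u),
      hdeep _ (norm_mul_one_add_sub hh.le hz₀ hu).le h_sq, h_trunc _ h_le]
  have h_center : ‖partialSum c n z₀‖ ≤ 2 * S * Real.exp (-(T / 4)) := by
    have h_four := norm_pow_four_le_of_norm_le_on_arc hF h_all h_small
    simp only [F, mul_zero, add_zero, mul_one] at h_four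
    rw [← pow_le_pow_iff_left₀ (norm_nonneg _) (by positivity) four_ne_zero]
    calc ‖partialSum c n z₀‖ ^ 4 ≤ 2 * (S ^ 4 * Real.exp (-T)) := h_four.trans_eq (by ring)
      _ ≤ 16 * (S ^ 4 * Real.exp (-T)) := by gcongr; norm_num
      _ = (2 * S * Real.exp (-(T / 4))) ^ 4 := by
          rw [mul_pow, ← Real.exp_nat_mul, Nat.cast_ofNat, mul_neg,
            mul_div_cancel₀ _ four_ne_zero]
          ring
  have h_tail : ‖partialSum c N z₀ - partialSum c n z₀‖ ≤ S * Real.exp (-(T / 4)) :=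
    (h_trunc z₀ hz₀.le).trans (by gcongr; linarith)
  linarith [norm_le_norm_add_norm_sub' (partialSum c N z₀) (partialSum c n z₀)]

end

/-! ### Growth of the logarithmic mass -/

section

open Polynomial

variable {K β : ℝ} {c : ℕ → ℂ} {N : ℕ}

/-- The partial sum of order `N` as a polynomial, divided by `supBound K` so that it is bounded by
`1` in the unit disc when the coefficients satisfy `Decay K β`. -/
noncomputable def normalizedSum (K : ℝ) (c : ℕ → ℂ) (N : ℕ) : ℂ[X] :=
  ∑ k ∈ Finset.range N, C (c k / supBound K) * X ^ k

/-- The constant `ε` in the condition `ε ^ (2 + β) * ρ ^ (-β) ≤ mass P θ₀ ρ`, under which the mass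
keeps growing when `ρ` is doubled. -/
noncomputable def threshold (K : ℝ) : ℝ := (2048 * K ^ 2)⁻¹

/-- The largest half-length of the arcs on which the mass is studied. -/
noncomputable def maxScale (K : ℝ) : ℝ := threshold K ^ 2 / 4096

lemma norm_eval_normalizedSum (hK : 1 ≤ K) (c : ℕ → ℂ) (N : ℕ) (z : ℂ) :
    ‖(normalizedSum K c N).eval z‖ = ‖partialSum c N z‖ / supBound K := by
  have h_eval : (normalizedSum K c N).eval z = partialSum c N z / supBound K := by
    simp only [normalizedSum, partialSum, eval_finsetSum, eval_mul, eval_C, eval_pow, eval_X,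
      Finset.sum_div, div_mul_eq_mul_div]
  rw [h_eval, norm_div, Complex.norm_real,
    Real.norm_of_nonneg (zero_le_one.trans (one_le_supBound hK))]

lemma norm_eval_normalizedSum_le_iff (hK : 1 ≤ K) {B : ℝ} {z : ℂ} :
    ‖(normalizedSum K c N).eval z‖ ≤ B ↔ ‖partialSum c N z‖ ≤ B * supBound K := by
  rw [norm_eval_normalizedSum hK, div_le_iff₀ (by linarith [one_le_supBound hK])]

lemma Decay.norm_eval_normalizedSum_le_one (hK : 1 ≤ K) (hβ : 0 ≤ β) (hc : Decay K β c) (N : ℕ)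
    (z : ℂ) (hz : ‖z‖ ≤ 1) : ‖(normalizedSum K c N).eval z‖ ≤ 1 := by
  have : 0 < K := by positivity
  rw [norm_eval_normalizedSum_le_iff hK, one_mul]
  exact hc.norm_partialSum_le hK hβ (h := 0) (fun k _ => by rw [zero_mul]; positivity)
    (by simpa using hz)

lemma threshold_pos (hK : 1 ≤ K) : 0 < threshold K := by
  unfold threshold
  positivity

lemma threshold_le_inv (hK : 1 ≤ K) : threshold K ≤ K⁻¹ / 2048 := by
  have : 0 < K := by positivity
  unfold threshold
  rw [mul_inv, mul_comm, div_eq_mul_inv]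
  gcongr
  nlinarith

lemma threshold_le (hK : 1 ≤ K) : threshold K ≤ 1 / 2048 := by
  linarith [threshold_le_inv hK, inv_le_one_of_one_le₀ hK]

lemma maxScale_pos (hK : 1 ≤ K) : 0 < maxScale K := by
  have := threshold_pos hK
  unfold maxScale
  positivity

lemma maxScale_le (hK : 1 ≤ K) : maxScale K ≤ 1 / 4096 := by
  unfold maxScale
  nlinarith [threshold_pos hK, threshold_le hK]

lemma le_logInv_of_norm_eval_le {P : ℂ[X]} {θ B t : ℝ} (hB : 0 < B)
    (hP : ‖P.eval (circleMap 0 1 θ)‖ ≤ B * Real.exp (-t)) (hne : P.eval (circleMap 0 1 θ) ≠ 0) :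
    t - Real.log B ≤ logInv P θ := by
  have h_log := Real.log_le_log (norm_pos_iff.2 hne) hP
  rw [Real.log_mul hB.ne' (Real.exp_pos _).ne', Real.log_exp] at h_log
  rw [logInv]
  linarith

lemma Decay.le_logInv (hK : 1 ≤ K) (hβ : 0 ≤ β) (hc : Decay K β c)
    (hP0 : normalizedSum K c N ≠ 0) {h T ρ θ θ₀ : ℝ} (hh : 0 < h) (hhρ : h ≤ ρ) (hρ : ρ ≤ 1 / 2)
    (hT0 : 0 ≤ T) (hT1 : T ≤ h * mass (normalizedSum K c N) θ₀ ρ / (256 * ρ ^ 2))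
    (hT2 : T ≤ K⁻¹ / 2 * (K⁻¹ / (2 * h)) ^ (1 + β)) (hθ : |θ - θ₀| ≤ 2 * ρ)
    (hne : (normalizedSum K c N).eval (circleMap 0 1 θ) ≠ 0) :
    T / 4 - Real.log 3 ≤ logInv (normalizedSum K c N) θ := by
  refine le_logInv_of_norm_eval_le (by norm_num) ?_ hne
  have := one_le_supBound hK
  rw [norm_eval_normalizedSum_le_iff hK, mul_right_comm]
  refine hc.norm_partialSum_boundary_le hK hβ N hh (hhρ.trans hρ) hT0 hT2
    (norm_circleMap_zero_one θ) fun z hzθ hz => ?_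
  rw [mul_comm, ← norm_eval_normalizedSum_le_iff hK]
  refine (norm_eval_le_exp_of_near_arc hP0 (hc.norm_eval_normalizedSum_le_one hK hβ N) hh hhρ
    (by linarith) hθ hzθ hz).trans ?_
  gcongr

lemma mul_rpow_neg_inv_exponent {M : ℝ} (hβ : 0 ≤ β) (hM : 0 < M) :
    M * M ^ (-(1 / (2 + β))) = M ^ ((1 + β) / (2 + β)) := by
  nth_rw 1 [← Real.rpow_one M]
  rw [← Real.rpow_add hM]
  congr 1
  field_simp
  ring

lemma mul_rpow_neg_inv_le {ε r q M : ℝ} (hε : 0 < ε) (hr : 0 < r) (hq : 0 < q)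
    (hM : (ε / r) ^ q ≤ M) : ε * M ^ (-(1 / q)) ≤ r := by
  have : 0 < 1 / q := by positivity
  calc ε * M ^ (-(1 / q)) ≤ ε * ((ε / r) ^ q) ^ (-(1 / q)) := by
        gcongr ε * ?_
        exact Real.rpow_le_rpow_of_nonpos (by positivity) hM (by linarith)
    _ = ε * (ε / r)⁻¹ := by
        rw [← Real.rpow_mul (by positivity), mul_neg, mul_one_div_cancel hq.ne', Real.rpow_neg_one]
    _ = r := by field_simp

lemma mul_rpow_exponent_le_div_width {M κ ε : ℝ} (hβ : 0 ≤ β) (hM : 0 < M) (hε : 0 < ε)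
    (hεκ : 2 * ε ≤ κ) :
    M ^ ((1 + β) / (2 + β)) ≤ (κ / (2 * (ε * M ^ (-(1 / (2 + β)))))) ^ (1 + β) := by
  have h_base : κ / (2 * (ε * M ^ (-(1 / (2 + β))))) = κ / (2 * ε) * M ^ (1 / (2 + β)) := by
    rw [Real.rpow_neg hM.le]
    field_simp
  have hκ : 1 ≤ κ / (2 * ε) := by rwa [one_le_div (by positivity)]
  rw [h_base, Real.mul_rpow (by positivity) (by positivity), ← Real.rpow_mul hM.le,
    one_div_mul_eq_div]
  exact le_mul_of_one_le_left (by positivity) (Real.one_le_rpow hκ (by linarith))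

lemma div_threshold_le_rpow_exponent {M ρ : ℝ} (hK : 1 ≤ K) (hβ : 0 ≤ β) (hρ0 : 0 < ρ)
    (hρ : ρ ≤ maxScale K) (hM : (threshold K / ρ) ^ (2 + β) ≤ M) :
    4096 / threshold K ≤ M ^ ((1 + β) / (2 + β)) := by
  have hε := threshold_pos hK
  have h_ratio : 4096 / threshold K ≤ threshold K / ρ := by
    rw [maxScale] at hρ
    rw [div_le_div_iff₀ hε hρ0]
    linarith
  have h_one : 1 ≤ threshold K / ρ := by
    refine le_trans ?_ h_ratio
    rw [one_le_div hε]
    linarith [threshold_le hK]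
  calc 4096 / threshold K ≤ threshold K / ρ := h_ratio
    _ ≤ (threshold K / ρ) ^ (1 + β) := Real.self_le_rpow_of_one_le h_one (by linarith)
    _ = ((threshold K / ρ) ^ (2 + β)) ^ ((1 + β) / (2 + β)) := by
        rw [← Real.rpow_mul (by positivity), mul_div_cancel₀ _ (by positivity)]
    _ ≤ _ := by gcongr

-- The width `h = ε * M ^ (-1 / (2 + β))` balances the two upper bounds for `T` in
-- `Decay.le_logInv`.
lemma Decay.mul_rpow_le_logInv (hK : 1 ≤ K) (hβ : 0 ≤ β) (hc : Decay K β c)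
    (hP0 : normalizedSum K c N ≠ 0) {ρ θ θ₀ : ℝ} (hρ0 : 0 < ρ) (hρ : ρ ≤ maxScale K)
    (hm : (threshold K / ρ) ^ (2 + β) ≤ mass (normalizedSum K c N) θ₀ ρ / ρ ^ 2)
    (hθ : |θ - θ₀| ≤ 2 * ρ) (hne : (normalizedSum K c N).eval (circleMap 0 1 θ) ≠ 0) :
    threshold K / 2048 * (mass (normalizedSum K c N) θ₀ ρ / ρ ^ 2) ^ ((1 + β) / (2 + β)) ≤
      logInv (normalizedSum K c N) θ := by
  have h_large := div_threshold_le_rpow_exponent hK hβ hρ0 hρ hm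
  have hεK := threshold_le_inv hK
  have hε : 0 < threshold K := threshold_pos hK
  have : 0 < K := by positivity
  set ε := threshold K
  set M := mass (normalizedSum K c N) θ₀ ρ / ρ ^ 2 with hM_def
  have hM : 0 < M := lt_of_lt_of_le (by positivity) hm
  set h := ε * M ^ (-(1 / (2 + β))) with hh_def
  set T := ε / 256 * M ^ ((1 + β) / (2 + β)) with hT_def
  have hT1 : T ≤ h * mass (normalizedSum K c N) θ₀ ρ / (256 * ρ ^ 2) := by
    rw [hT_def, hh_def, ← mul_rpow_neg_inv_exponent hβ hM, hM_def]
    apply le_of_eq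
    ring
  have hT2 : T ≤ K⁻¹ / 2 * (K⁻¹ / (2 * h)) ^ (1 + β) := by
    rw [hT_def]
    gcongr ?_ * ?_
    · linarith
    · exact mul_rpow_exponent_le_div_width hβ hM hε (by linarith)
  have h_width := mul_rpow_neg_inv_le hε hρ0 (by positivity) hm
  have h_log := hc.le_logInv hK hβ hP0 (by positivity) h_width (by linarith [maxScale_le hK])
    (by positivity) hT1 hT2 hθ hne
  rw [div_le_iff₀ hε] at h_large
  have := Real.log_le_sub_one_of_pos (show (0 : ℝ) < 3 by norm_num)
  linarith

lemma Decay.mul_le_integral_logInv (hK : 1 ≤ K) (hβ : 0 ≤ β) (hc : Decay K β c)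
    (hP0 : normalizedSum K c N ≠ 0) {ρ θ₀ a b : ℝ} (hρ0 : 0 < ρ) (hρ : ρ ≤ maxScale K)
    (hm : (threshold K / ρ) ^ (2 + β) ≤ mass (normalizedSum K c N) θ₀ ρ / ρ ^ 2) (hab : a ≤ b)
    (ha : |a - θ₀| ≤ 2 * ρ) (hb : |b - θ₀| ≤ 2 * ρ) :
    (b - a) * (threshold K / 2048 *
      (mass (normalizedSum K c N) θ₀ ρ / ρ ^ 2) ^ ((1 + β) / (2 + β))) ≤
        ∫ θ in a..b, logInv (normalizedSum K c N) θ := by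
  rw [← smul_eq_mul, ← intervalIntegral.integral_const]
  refine integral_le_integral_logInv hP0 hab (by simp) fun θ hθ hne => ?_
  refine hc.mul_rpow_le_logInv hK hβ hP0 hρ0 hρ hm ?_ hne
  rw [abs_le] at ha hb ⊢
  exact ⟨by linarith [hθ.1, ha.1], by linarith [hθ.2, hb.2]⟩

lemma Decay.mass_add_le_mass_two_mul (hK : 1 ≤ K) (hβ : 0 ≤ β) (hc : Decay K β c)
    (hP0 : normalizedSum K c N ≠ 0) {ρ θ₀ : ℝ} (hρ0 : 0 < ρ) (hρ : ρ ≤ maxScale K)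
    (hm : (threshold K / ρ) ^ (2 + β) ≤ mass (normalizedSum K c N) θ₀ ρ / ρ ^ 2) :
    mass (normalizedSum K c N) θ₀ ρ + 2 * ρ * (threshold K / 2048 *
      (mass (normalizedSum K c N) θ₀ ρ / ρ ^ 2) ^ ((1 + β) / (2 + β))) ≤
        mass (normalizedSum K c N) θ₀ (2 * ρ) := by
  set P := normalizedSum K c N
  have h_int := intervalIntegrable_logInv P
  have h_left := hc.mul_le_integral_logInv hK hβ hP0 hρ0 hρ hm
    (a := θ₀ - 2 * ρ) (b := θ₀ - ρ) (by linarith) (by rw [abs_le]; constructor <;> linarith)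
    (by rw [abs_le]; constructor <;> linarith)
  have h_right := hc.mul_le_integral_logInv hK hβ hP0 hρ0 hρ hm
    (a := θ₀ + ρ) (b := θ₀ + 2 * ρ) (by linarith) (by rw [abs_le]; constructor <;> linarith)
    (by rw [abs_le]; constructor <;> linarith)
  have h_split : mass P θ₀ (2 * ρ) = (∫ θ in (θ₀ - 2 * ρ)..(θ₀ - ρ), logInv P θ) +
      mass P θ₀ ρ + ∫ θ in (θ₀ + ρ)..(θ₀ + 2 * ρ), logInv P θ := by
    rw [mass, mass, intervalIntegral.integral_add_adjacent_intervals (h_int _ _) (h_int _ _),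
      intervalIntegral.integral_add_adjacent_intervals (h_int _ _) (h_int _ _)]
  rw [h_split]
  linarith

lemma one_add_div_le_rpow {x q : ℝ} (hx0 : 0 ≤ x) (hx1 : x ≤ 1) (hq : 1 ≤ q) :
    1 + x / (2 * q) ≤ (1 + x) ^ (1 / q) := by
  have h_exp : Real.exp (x / 2) ≤ 1 + x := by
    refine (Real.exp_bound_div_one_sub_of_interval (by linarith) (by linarith)).trans ?_
    rw [div_le_iff₀ (by linarith)]
    nlinarith
  calc 1 + x / (2 * q) ≤ Real.exp (x / (2 * q)) := by linarith [Real.add_one_le_exp (x / (2 * q))]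
    _ = Real.exp (x / 2) ^ (1 / q) := by
        rw [← Real.exp_mul, mul_one_div, div_div]
    _ ≤ _ := by gcongr

lemma rpow_div_le_div_sq {ε ρ m : ℝ} (hε : 0 < ε) (hρ : 0 < ρ) (hm : ε ^ (2 + β) * ρ ^ (-β) ≤ m) :
    (ε / ρ) ^ (2 + β) ≤ m / ρ ^ 2 := by
  have h_rpow : (ε / ρ) ^ (2 + β) * ρ ^ 2 = ε ^ (2 + β) * ρ ^ (-β) := by
    rw [Real.div_rpow hε.le hρ.le, Real.rpow_add hρ, Real.rpow_two, Real.rpow_neg hρ.le]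
    field_simp
  rwa [le_div_iff₀ (by positivity), h_rpow]

lemma mul_div_sq_rpow_exponent {ρ m : ℝ} (hβ : 0 ≤ β) (hρ : 0 < ρ) (hm : 0 < m) :
    ρ * (m / ρ ^ 2) ^ ((1 + β) / (2 + β)) =
      m * (ρ ^ (-(β / (2 + β))) * m ^ (-(1 / (2 + β)))) := by
  have h_rho : ρ * ρ ^ (-(2 * ((1 + β) / (2 + β)))) = ρ ^ (-(β / (2 + β))) := by
    nth_rw 1 [← Real.rpow_one ρ]
    rw [← Real.rpow_add hρ]
    congr 1
    field_simp
    ring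
  rw [Real.div_rpow hm.le (by positivity), ← Real.rpow_two, ← Real.rpow_mul hρ.le,
    div_eq_mul_inv, ← Real.rpow_neg hρ.le, ← h_rho, ← mul_rpow_neg_inv_exponent hβ hm]
  ring

-- The increment of `mass_add_le_mass_two_mul` is the relative increment
-- `x = ε / 1024 * ρ ^ (-β / (2 + β)) * m ^ (-1 / (2 + β))` of the mass `m`.
lemma Decay.mass_rpow_add_le_mass_two_mul_rpow (hK : 1 ≤ K) (hβ : 0 ≤ β) (hc : Decay K β c)
    (hP0 : normalizedSum K c N ≠ 0) {ρ θ₀ : ℝ} (hρ0 : 0 < ρ) (hρ : ρ ≤ maxScale K)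
    (hm : threshold K ^ (2 + β) * ρ ^ (-β) ≤ mass (normalizedSum K c N) θ₀ ρ) :
    mass (normalizedSum K c N) θ₀ ρ ^ (1 / (2 + β)) +
        threshold K / (2048 * (2 + β)) * ρ ^ (-(β / (2 + β))) ≤
      mass (normalizedSum K c N) θ₀ (2 * ρ) ^ (1 / (2 + β)) := by
  have hε := threshold_pos hK
  have h_grow := hc.mass_add_le_mass_two_mul hK hβ hP0 hρ0 hρ (rpow_div_le_div_sq hε hρ0 hm)
  set ε := threshold K
  set m := mass (normalizedSum K c N) θ₀ ρ
  have hm0 : 0 < m := lt_of_lt_of_le (by positivity) hm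
  set x := ε / 1024 * (ρ ^ (-(β / (2 + β))) * m ^ (-(1 / (2 + β)))) with hx_def
  have hx0 : 0 ≤ x := by positivity
  have hx1 : x ≤ 1 := by
    have h_width : ε * m ^ (-(1 / (2 + β))) ≤ ρ ^ (β / (2 + β)) := by
      refine mul_rpow_neg_inv_le hε (by positivity) (by positivity) (le_of_eq_of_le ?_ hm)
      rw [Real.div_rpow hε.le (by positivity), ← Real.rpow_mul hρ0.le,
        div_mul_cancel₀ _ (by positivity), Real.rpow_neg hρ0.le, div_eq_mul_inv]
    calc x = ε * m ^ (-(1 / (2 + β))) * ρ ^ (-(β / (2 + β))) / 1024 := by ring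
      _ ≤ ρ ^ (β / (2 + β)) * ρ ^ (-(β / (2 + β))) / 1024 := by gcongr
      _ ≤ 1 := by
          rw [← Real.rpow_add hρ0, add_neg_cancel, Real.rpow_zero]
          norm_num
  have h_cancel : m ^ (1 / (2 + β)) * m ^ (-(1 / (2 + β))) = 1 := by
    rw [← Real.rpow_add hm0, add_neg_cancel, Real.rpow_zero]
  calc m ^ (1 / (2 + β)) + ε / (2048 * (2 + β)) * ρ ^ (-(β / (2 + β)))
      = m ^ (1 / (2 + β)) + ε / (2048 * (2 + β)) * ρ ^ (-(β / (2 + β))) *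
          (m ^ (1 / (2 + β)) * m ^ (-(1 / (2 + β)))) := by
        rw [h_cancel, mul_one]
    _ = m ^ (1 / (2 + β)) * (1 + x / (2 * (2 + β))) := by
        rw [hx_def]
        field_simp
        ring
    _ ≤ m ^ (1 / (2 + β)) * (1 + x) ^ (1 / (2 + β)) := by
        gcongr
        exact one_add_div_le_rpow hx0 hx1 (by linarith)
    _ = (m + 2 * ρ * (ε / 2048 * (m / ρ ^ 2) ^ ((1 + β) / (2 + β)))) ^ (1 / (2 + β)) := by
        rw [← Real.mul_rpow hm0.le (by positivity), hx_def]
        congr 1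
        linear_combination -(ε / 1024) * mul_div_sq_rpow_exponent hβ hρ0 hm0
    _ ≤ _ := by gcongr

lemma Decay.sum_rpow_le_mass_rpow (hK : 1 ≤ K) (hβ : 0 ≤ β) (hc : Decay K β c)
    (hP0 : normalizedSum K c N ≠ 0) {r θ₀ : ℝ} (hr : 0 < r)
    (hm : threshold K ^ (2 + β) * r ^ (-β) ≤ mass (normalizedSum K c N) θ₀ r) {j : ℕ}
    (hj : 2 ^ j * r ≤ maxScale K) :
    threshold K / (2048 * (2 + β)) * ∑ i ∈ Finset.range j, (2 ^ i * r) ^ (-(β / (2 + β))) ≤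
      mass (normalizedSum K c N) θ₀ (2 ^ j * r) ^ (1 / (2 + β)) := by
  have hε := threshold_pos hK
  have hP1 := hc.norm_eval_normalizedSum_le_one hK hβ N
  induction j with
  | zero =>
    rw [Finset.range_zero, Finset.sum_empty, mul_zero]
    exact Real.rpow_nonneg (mass_nonneg hP1 θ₀ (by positivity)) _
  | succ j ih =>
    rw [pow_succ', mul_assoc] at hj ⊢
    have h_scale : 2 ^ j * r ≤ maxScale K := by linarith [show 0 < 2 ^ j * r by positivity]
    have h_le : r ≤ 2 ^ j * r := le_mul_of_one_le_left hr.le (one_le_pow₀ one_le_two)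
    have h_mass : threshold K ^ (2 + β) * (2 ^ j * r) ^ (-β) ≤
        mass (normalizedSum K c N) θ₀ (2 ^ j * r) :=
      calc threshold K ^ (2 + β) * (2 ^ j * r) ^ (-β) ≤ threshold K ^ (2 + β) * r ^ (-β) := by
            gcongr _ * ?_
            exact Real.rpow_le_rpow_of_nonpos hr h_le (by linarith)
        _ ≤ mass (normalizedSum K c N) θ₀ r := hm
        _ ≤ _ := mass_mono hP1 θ₀ hr.le h_le
    rw [Finset.sum_range_succ, mul_add]
    linarith [ih h_scale,
      hc.mass_rpow_add_le_mass_two_mul_rpow hK hβ hP0 (by positivity) h_scale h_mass]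

lemma sum_two_rpow_le_sum_scale_rpow {γ ρ : ℝ} (hγ : 0 ≤ γ) (hρ0 : 0 < ρ) (hρ : ρ ≤ 1) (J : ℕ) :
    ∑ i ∈ Finset.range J, (2 : ℝ) ^ (γ * (i + 1)) ≤
      ∑ i ∈ Finset.range J, (2 ^ i * (ρ / 2 ^ J)) ^ (-γ) := by
  rw [← Finset.sum_range_reflect]
  refine Finset.sum_le_sum fun i hi => ?_
  have hiJ := Finset.mem_range.1 hi
  have h_index : ((J - 1 - i : ℕ) : ℝ) + 1 = J - i := by
    rw [← Nat.cast_add_one, show J - 1 - i + 1 = J - i by omega, Nat.cast_sub hiJ.le]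
  calc (2 : ℝ) ^ (γ * ((J - 1 - i : ℕ) + 1)) = (2 ^ i / 2 ^ J) ^ (-γ) := by
        rw [h_index, ← Real.rpow_natCast, ← Real.rpow_natCast, ← Real.rpow_sub two_pos,
          ← Real.rpow_mul two_pos.le]
        ring_nf
    _ ≤ _ := by
        refine Real.rpow_le_rpow_of_nonpos (by positivity) ?_ (by linarith)
        rw [← mul_div_assoc]
        gcongr
        exact mul_le_of_le_one_right (by positivity) hρ

/-- The growth of `mass ^ (1 / (2 + β))` over `n` dyadic scales, up to a constant factor. -/
noncomputable def scaleSum (β : ℝ) (n : ℕ) : ℝ :=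
  ∑ i ∈ Finset.range n, (2 : ℝ) ^ (β / (2 + β) * (i + 1))

lemma Decay.scaleSum_le_of_le_mass (hK : 1 ≤ K) (hβ : 0 ≤ β) (hc : Decay K β c) {A : ℝ}
    (hA : Real.exp (-A) ≤ ‖(normalizedSum K c N).eval 0‖) {θ₀ : ℝ} {J : ℕ}
    (hm : threshold K ^ (2 + β) * (maxScale K / 2 ^ J) ^ (-β) ≤
      mass (normalizedSum K c N) θ₀ (maxScale K / 2 ^ J)) :
    threshold K / (2048 * (2 + β)) * scaleSum β J ≤ (2 * Real.pi * A) ^ (1 / (2 + β)) := by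
  have hε := threshold_pos hK
  have hρ0 := maxScale_pos hK
  have hρ1 := maxScale_le hK
  have hP1 := hc.norm_eval_normalizedSum_le_one hK hβ N
  have hP0 := ne_zero_of_exp_le_norm_eval hA
  have h_top : 2 ^ J * (maxScale K / 2 ^ J) = maxScale K := mul_div_cancel₀ _ (by positivity)
  have := mass_nonneg hP1 θ₀ hρ0.le
  calc _ ≤ threshold K / (2048 * (2 + β)) *
          ∑ i ∈ Finset.range J, (2 ^ i * (maxScale K / 2 ^ J)) ^ (-(β / (2 + β))) := by
        gcongr _ * ?_
        exact sum_two_rpow_le_sum_scale_rpow (by positivity) hρ0 (by linarith) J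
    _ ≤ mass (normalizedSum K c N) θ₀ (maxScale K) ^ (1 / (2 + β)) := by
        simpa only [h_top] using
          hc.sum_rpow_le_mass_rpow hK hβ hP0 (by positivity) hm h_top.le
    _ ≤ _ := by
        gcongr
        exact mass_le hP1 hA θ₀ hρ0.le (by linarith [Real.pi_gt_three])

end

/-! ### Counting the zeros -/

section

open Polynomial

variable {K β A : ℝ} {c : ℕ → ℂ} {Z : Multiset ℂ}

lemma RapidDecay.exists_norm_partialSum_sub_le (hc : RapidDecay c) {δ : ℝ} (hδ : 0 < δ) :
    ∃ N, 1 ≤ N ∧ ∀ z : ℂ, ‖z‖ ≤ 1 → ‖partialSum c N z - seriesSum c z‖ ≤ δ := by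
  obtain ⟨N, hNδ, hN1⟩ := (((tendsto_sum_nat_add fun k => ‖c k‖).eventually_lt_const hδ).and
    (eventually_ge_atTop 1)).exists
  refine ⟨N, hN1, fun z hz => ?_⟩
  rw [partialSum, seriesSum, ← (hc.summable hz).sum_add_tsum_nat_add N, sub_add_cancel_left,
    norm_neg]
  exact (tsum_of_norm_bounded ((summable_nat_add_iff N).2 hc.summable_norm).hasSum
    fun k => norm_mul_pow_le c hz (k + N)).trans hNδ.le

lemma norm_eval_zero_normalizedSum (hK : 1 ≤ K) {N : ℕ} (hN : 1 ≤ N) :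
    ‖(normalizedSum K c N).eval 0‖ = ‖c 0‖ / supBound K := by
  have h_zero : partialSum c N 0 = c 0 := by
    rw [partialSum, Finset.sum_eq_single_of_mem 0 (Finset.mem_range.2 hN) fun k _ hk => by
      rw [zero_pow hk, mul_zero], pow_zero, mul_one]
  rw [norm_eval_normalizedSum hK, h_zero]

lemma le_logInv_of_norm_seriesSum_le (hK : 1 ≤ K) {N : ℕ} {θ t : ℝ}
    (h_sum : ‖seriesSum c (circleMap 0 1 θ)‖ ≤ supBound K * Real.exp (-t))
    (h_approx : ‖partialSum c N (circleMap 0 1 θ) - seriesSum c (circleMap 0 1 θ)‖ ≤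
      supBound K * Real.exp (-t))
    (hne : (normalizedSum K c N).eval (circleMap 0 1 θ) ≠ 0) :
    t - 3 / 4 ≤ logInv (normalizedSum K c N) θ := by
  refine le_trans ?_ (le_logInv_of_norm_eval_le (B := 2) (t := t) two_pos ?_ hne)
  · linarith [Real.log_two_lt_d9]
  · rw [norm_eval_normalizedSum_le_iff hK]
    linarith [norm_le_norm_sub_add (partialSum c N (circleMap 0 1 θ))
      (seriesSum c (circleMap 0 1 θ))]

-- The zeros close to a boundary point make the function, hence a long partial sum, small there.
lemma Decay.exists_card_sub_le_logInv (hK : 1 ≤ K) (hβ : 0 ≤ β) (hc : Decay K β c)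
    (hA : Real.exp (-A) ≤ ‖c 0‖) (hZ : IsZeroMultiset c Z) {r : ℝ} (hr : 0 < r) :
    ∃ N, Real.exp (-(A + Real.log (supBound K))) ≤ ‖(normalizedSum K c N).eval 0‖ ∧
      ∀ θ, (normalizedSum K c N).eval (circleMap 0 1 θ) ≠ 0 → ∀ Y ≤ Z,
        (∀ z ∈ Y, ‖circleMap 0 1 θ - z‖ ≤ 2 * r) →
        (Multiset.card Y : ℝ) ≤ (256 * K ^ 2 * r) ^ (-(1 + β)) →
        Multiset.card Y - 3 / 4 ≤ logInv (normalizedSum K c N) θ := by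
  have hS : 0 < supBound K := zero_lt_one.trans_le (one_le_supBound hK)
  obtain ⟨N, hN1, hN⟩ := (hc.rapidDecay hK hβ).exists_norm_partialSum_sub_le
    (δ := supBound K * Real.exp (-(Multiset.card Z : ℝ))) (by positivity)
  refine ⟨N, ?_, fun θ hne Y hYZ hY h_card => ?_⟩
  · rw [norm_eval_zero_normalizedSum hK hN1, neg_add, Real.exp_add, Real.exp_neg (Real.log _),
      Real.exp_log hS, ← div_eq_mul_inv]
    gcongr
  · have hθ := (norm_circleMap_zero_one θ).le
    have h_card_le : (Multiset.card Y : ℝ) ≤ Multiset.card Z := by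
      exact_mod_cast Multiset.card_le_card hYZ
    exact le_logInv_of_norm_seriesSum_le hK
      (hc.norm_seriesSum_le_exp_neg_card hK hβ (hZ.mono hYZ) hr hθ hY h_card)
      ((hN _ hθ).trans (by gcongr)) hne

lemma threshold_mul (hK : 1 ≤ K) : threshold K * (256 * K ^ 2) = 1 / 8 := by
  unfold threshold
  field_simp
  norm_num

lemma mul_le_one_of_le_maxScale {r : ℝ} (hK : 1 ≤ K) (hr : r ≤ maxScale K) :
    256 * K ^ 2 * r ≤ 1 := by
  calc 256 * K ^ 2 * r ≤ 256 * K ^ 2 * maxScale K := by gcongr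
    _ = threshold K * (256 * K ^ 2) * (threshold K / 4096) := by
        rw [maxScale]
        ring
    _ ≤ 1 := by
        rw [threshold_mul hK]
        linarith [threshold_le hK]

lemma threshold_rpow_mul_rpow_neg_le (hK : 1 ≤ K) (hβ : 0 ≤ β) {r : ℝ} (hr : 0 < r) :
    threshold K ^ (2 + β) * r ^ (-β) ≤ r / 4 * (256 * K ^ 2 * r) ^ (-(1 + β)) := by
  have hε := threshold_pos hK
  have h_threshold : threshold K ≤ (256 * K ^ 2)⁻¹ := by
    rw [← one_div, le_div_iff₀ (by positivity), threshold_mul hK]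
    norm_num
  calc threshold K ^ (2 + β) * r ^ (-β)
      = threshold K * threshold K ^ (1 + β) * (r * r ^ (-(1 + β))) := by
        nth_rw 2 [← Real.rpow_one (threshold K)]
        nth_rw 2 [← Real.rpow_one r]
        rw [← Real.rpow_add hε, ← Real.rpow_add hr]
        ring_nf
    _ ≤ 1 / 4 * (256 * K ^ 2)⁻¹ ^ (1 + β) * (r * r ^ (-(1 + β))) := by
        gcongr
        linarith [threshold_le hK]
    _ = _ := by
        rw [Real.mul_rpow (by positivity) hr.le, Real.inv_rpow (by positivity),
          ← Real.rpow_neg (by positivity)]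
        ring

lemma half_mul_le_mass_of_le_logInv {P : ℂ[X]} (hP : P ≠ 0) {θ₀ r t : ℝ} (hr : 0 ≤ r) (ht : 1 ≤ t)
    (h : ∀ θ, |θ - θ₀| ≤ r → P.eval (circleMap 0 1 θ) ≠ 0 → t - 3 / 4 ≤ logInv P θ) :
    r * t / 2 ≤ mass P θ₀ r := by
  calc r * t / 2 = ∫ _ in (θ₀ - r)..(θ₀ + r), t / 4 := by
        rw [intervalIntegral.integral_const, smul_eq_mul]
        ring
    _ ≤ _ := integral_le_integral_logInv hP (by linarith) (by simp) fun θ hθ hne => by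
        have := h θ (abs_le.2 ⟨by linarith [hθ.1], by linarith [hθ.2]⟩) hne
        linarith

lemma Decay.card_le_of_near (hK : 1 ≤ K) (hβ : 0 ≤ β) (hc : Decay K β c)
    (hA : Real.exp (-A) ≤ ‖c 0‖) {J : ℕ}
    (hJ : (2 * Real.pi * (A + Real.log (supBound K))) ^ (1 / (2 + β)) <
      threshold K / (2048 * (2 + β)) * scaleSum β J)
    (hZ : IsZeroMultiset c Z) {θ₀ : ℝ}
    (hθ₀ : ∀ z ∈ Z, ‖circleMap 0 1 θ₀ - z‖ ≤ maxScale K / 2 ^ J) :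
    (Multiset.card Z : ℝ) ≤ (256 * K ^ 2 * (maxScale K / 2 ^ J)) ^ (-(1 + β)) := by
  have hρ0 := maxScale_pos hK
  set r := maxScale K / 2 ^ J
  have hr0 : 0 < r := by positivity
  have hr_le : r ≤ maxScale K := div_le_self hρ0.le (one_le_pow₀ one_le_two)
  set X := (256 * K ^ 2 * r) ^ (-(1 + β))
  have hX1 : 1 ≤ X := Real.one_le_rpow_of_pos_of_le_one_of_nonpos (by positivity)
    (mul_le_one_of_le_maxScale hK hr_le) (by linarith)
  by_contra! h_many
  obtain ⟨Y, hY⟩ : ∃ Y, Y ∈ Multiset.powersetCard ⌊X⌋₊ Z := by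
    rw [← Multiset.card_pos_iff_exists_mem, Multiset.card_powersetCard]
    exact Nat.choose_pos (Nat.floor_le_of_le h_many.le)
  obtain ⟨hYZ, hY_card⟩ := Multiset.mem_powersetCard.1 hY
  have hn1 : (1 : ℝ) ≤ ⌊X⌋₊ := by exact_mod_cast Nat.le_floor (by simpa using hX1)
  obtain ⟨N, hN0, hN⟩ := hc.exists_card_sub_le_logInv hK hβ hA (hZ.mono hYZ) hr0
  have h_mass : r * ⌊X⌋₊ / 2 ≤ mass (normalizedSum K c N) θ₀ r := by
    refine half_mul_le_mass_of_le_logInv (ne_zero_of_exp_le_norm_eval hN0) hr0.le hn1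
      fun θ hθ hne => ?_
    rw [← hY_card]
    refine hN θ hne Y le_rfl (fun z hz => ?_) (hY_card ▸ Nat.floor_le (by linarith))
    linarith [hθ₀ z (Multiset.mem_of_le hYZ hz), norm_circleMap_sub_circleMap_le θ θ₀,
      norm_sub_le_norm_sub_add_norm_sub (circleMap 0 1 θ) (circleMap 0 1 θ₀) z]
  have h_grow : threshold K ^ (2 + β) * r ^ (-β) ≤ mass (normalizedSum K c N) θ₀ r :=
    calc _ ≤ r / 4 * X := threshold_rpow_mul_rpow_neg_le hK hβ hr0
      _ ≤ r / 4 * (2 * ⌊X⌋₊) := by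
          gcongr
          linarith [Nat.lt_floor_add_one X]
      _ ≤ _ := by linarith
  exact (hc.scaleSum_le_of_le_mass hK hβ hN0 h_grow).not_gt hJ

lemma measurable_countP_near (Z : Multiset ℂ) (r : ℝ) :
    Measurable fun θ : ℝ => (Z.countP (fun z => ‖circleMap 0 1 θ - z‖ ≤ r) : ℝ) := by
  induction Z using Multiset.induction with
  | empty => simp
  | cons a Z ih =>
    simp only [Multiset.countP_cons, Nat.cast_add, Nat.cast_ite, Nat.cast_one, Nat.cast_zero]
    have h_near : MeasurableSet {θ : ℝ | ‖circleMap 0 1 θ - a‖ ≤ r} :=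
      measurableSet_le (by fun_prop) measurable_const
    exact ih.add (measurable_const.ite h_near measurable_const)

lemma intervalIntegrable_countP_near (Z : Multiset ℂ) (r a b : ℝ) :
    IntervalIntegrable (fun θ : ℝ => (Z.countP (fun z => ‖circleMap 0 1 θ - z‖ ≤ r) : ℝ))
      volume a b := by
  refine (intervalIntegrable_const (c := (Multiset.card Z : ℝ))).mono_fun
    (measurable_countP_near Z r).aestronglyMeasurable (.of_forall fun θ => ?_)
  simp only [Real.norm_natCast]
  exact_mod_cast Multiset.countP_le_card _ _

lemma norm_circleMap_arg_sub (z : ℂ) : ‖circleMap 0 1 z.arg - z‖ = |1 - ‖z‖| := by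
  have h_polar : circleMap 0 1 z.arg - z = (1 - ‖z‖ : ℝ) * circleMap 0 1 z.arg := by
    have h_exp : circleMap 0 1 z.arg = Complex.exp (z.arg * Complex.I) := by simp [circleMap]
    nth_rw 2 [← Complex.norm_mul_exp_arg_mul_I z]
    rw [h_exp]
    push_cast
    ring
  rw [h_polar, norm_mul, norm_circleMap_zero_one, mul_one, Complex.norm_real, Real.norm_eq_abs]

lemma exists_Icc_subset_near {φ r : ℝ} (hφ : φ ∈ Icc (-Real.pi) Real.pi) (hr0 : 0 ≤ r)
    (hr : r ≤ Real.pi) :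
    ∃ x, -Real.pi ≤ x ∧ x + r ≤ Real.pi ∧ ∀ θ ∈ Icc x (x + r), |θ - φ| ≤ r := by
  obtain ⟨h_lower, h_upper⟩ := hφ
  rcases le_total 0 φ with h | h
  · exact ⟨φ - r, by linarith, by linarith, fun θ hθ =>
      abs_le.2 ⟨by linarith [hθ.1], by linarith [hθ.2]⟩⟩
  · exact ⟨φ, by linarith, by linarith, fun θ hθ =>
      abs_le.2 ⟨by linarith [hθ.1], by linarith [hθ.2]⟩⟩

lemma half_le_integral_countP_near {z : ℂ} {r : ℝ} (hr0 : 0 ≤ r) (hr1 : r ≤ 1) (hz : ‖z‖ ≤ 1)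
    (hzr : 1 - r / 2 ≤ ‖z‖) :
    r / 2 ≤ ∫ θ in (-Real.pi)..Real.pi,
      (Multiset.countP (fun z => ‖circleMap 0 1 θ - z‖ ≤ r) {z} : ℝ) := by
  have h_near : ∀ θ, |θ - z.arg| ≤ r / 2 →
      (Multiset.countP (fun z => ‖circleMap 0 1 θ - z‖ ≤ r) {z} : ℝ) = 1 := by
    intro θ hθ
    have h_arg := norm_circleMap_arg_sub z
    rw [abs_of_nonneg (by linarith)] at h_arg
    have h_dist : ‖circleMap 0 1 θ - z‖ ≤ r := by
      linarith [norm_circleMap_sub_circleMap_le θ z.arg,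
        norm_sub_le_norm_sub_add_norm_sub (circleMap 0 1 θ) (circleMap 0 1 z.arg) z]
    rw [Multiset.countP_eq_card_filter, Multiset.filter_singleton, if_pos h_dist,
      Multiset.card_singleton, Nat.cast_one]
  obtain ⟨x, hx_lower, hx_upper, hx⟩ := exists_Icc_subset_near
    ⟨(Complex.neg_pi_lt_arg z).le, Complex.arg_le_pi z⟩ (by linarith : 0 ≤ r / 2)
    (by linarith [Real.pi_gt_three])
  calc r / 2 = ∫ _ in x..(x + r / 2), (1 : ℝ) := by
        rw [intervalIntegral.integral_const, smul_eq_mul]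
        ring
    _ = ∫ θ in x..(x + r / 2),
          (Multiset.countP (fun z => ‖circleMap 0 1 θ - z‖ ≤ r) {z} : ℝ) := by
        refine intervalIntegral.integral_congr fun θ hθ => ?_
        rw [uIcc_of_le (by linarith)] at hθ
        exact (h_near θ (hx θ hθ)).symm
    _ ≤ _ := intervalIntegral.integral_mono_interval hx_lower (by linarith) hx_upper
        (.of_forall fun θ => Nat.cast_nonneg _) (intervalIntegrable_countP_near _ _ _ _)

lemma card_le_integral_countP_near {r : ℝ} (hr0 : 0 ≤ r) (hr1 : r ≤ 1)
    (hZ : ∀ z ∈ Z, ‖z‖ ≤ 1 ∧ 1 - r / 2 ≤ ‖z‖) :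
    r / 2 * Multiset.card Z ≤ ∫ θ in (-Real.pi)..Real.pi,
      (Z.countP (fun z => ‖circleMap 0 1 θ - z‖ ≤ r) : ℝ) := by
  induction Z using Multiset.induction with
  | empty => simp
  | cons a Z ih =>
    obtain ⟨ha, haZ⟩ := hZ a (Multiset.mem_cons_self a Z)
    simp_rw [← Multiset.singleton_add, Multiset.countP_add, Multiset.card_add,
      Multiset.card_singleton, Nat.cast_add, Nat.cast_one, mul_add, mul_one]
    rw [intervalIntegral.integral_add (intervalIntegrable_countP_near _ _ _ _)
      (intervalIntegrable_countP_near _ _ _ _)]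
    exact add_le_add (half_le_integral_countP_near hr0 hr1 ha haZ)
      (ih fun z hz => hZ z (Multiset.mem_cons_of_mem hz))

lemma Decay.card_le_of_one_sub_le_norm (hK : 1 ≤ K) (hβ : 0 ≤ β) (hc : Decay K β c)
    (hA : Real.exp (-A) ≤ ‖c 0‖) {J : ℕ}
    (hJ : (2 * Real.pi * (A + Real.log (supBound K))) ^ (1 / (2 + β)) <
      threshold K / (2048 * (2 + β)) * scaleSum β J)
    (hZ : IsZeroMultiset c Z) (h_shallow : ∀ z ∈ Z, 1 - maxScale K / 2 ^ J / 2 ≤ ‖z‖) :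
    maxScale K / 2 ^ J / 2 * Multiset.card Z ≤
      2 * Real.pi * (A + Real.log (supBound K)) + 2 * Real.pi := by
  have hρ0 := maxScale_pos hK
  set r := maxScale K / 2 ^ J
  have hr0 : 0 < r := by positivity
  have hr1 : r ≤ 1 := (div_le_self hρ0.le (one_le_pow₀ one_le_two)).trans
    ((maxScale_le hK).trans (by norm_num))
  obtain ⟨N, hN0, hN⟩ := hc.exists_card_sub_le_logInv hK hβ hA hZ hr0
  have h_logInv : ∀ θ, (normalizedSum K c N).eval (circleMap 0 1 θ) ≠ 0 →
      (Z.countP (fun z => ‖circleMap 0 1 θ - z‖ ≤ r) : ℝ) - 1 ≤ logInv (normalizedSum K c N) θ := by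
    intro θ hne
    have h_near : ∀ z ∈ Z.filter fun z => ‖circleMap 0 1 θ - z‖ ≤ r, ‖circleMap 0 1 θ - z‖ ≤ r :=
      fun z hz => (Multiset.mem_filter.1 hz).2
    have := hN θ hne _ (Multiset.filter_le _ Z) (fun z hz => by linarith [h_near z hz])
      (hc.card_le_of_near hK hβ hA hJ (hZ.mono (Multiset.filter_le _ _)) h_near)
    rw [Multiset.countP_eq_card_filter]
    linarith
  have h_mass := mass_le (hc.norm_eval_normalizedSum_le_one hK hβ N) hN0 0 Real.pi_pos.le le_rfl
  have h_count := integral_le_integral_logInv (ne_zero_of_exp_le_norm_eval hN0)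
    (neg_le_self Real.pi_pos.le) ((intervalIntegrable_countP_near Z r _ _).sub (by simp))
    fun θ _ => h_logInv θ
  rw [intervalIntegral.integral_sub (intervalIntegrable_countP_near _ _ _ _) (by simp),
    intervalIntegral.integral_const, smul_eq_mul] at h_count
  rw [mass, zero_sub, zero_add] at h_mass
  linarith [card_le_integral_countP_near hr0.le hr1 fun z hz =>
    ⟨hZ.norm_le_one z hz, h_shallow z hz⟩]

lemma Decay.card_le_of_norm_le_one_sub (hK : 1 ≤ K) (hβ : 0 ≤ β) (hc : Decay K β c) {r : ℝ}
    (hA : Real.exp (-A) ≤ ‖c 0‖) (hZ : IsZeroMultiset c Z) (h_deep : ∀ z ∈ Z, ‖z‖ ≤ 1 - r) :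
    r * Multiset.card Z ≤ A + Real.log (supBound K) := by
  have h_prod : (Z.map norm).prod ≤ Real.exp (-(r * Multiset.card Z)) := by
    calc (Z.map norm).prod ≤ (Z.map fun _ => Real.exp (-r)).prod :=
          Multiset.prod_map_le_prod_map₀ _ _ (fun z _ => norm_nonneg z) fun z hz => by
            linarith [h_deep z hz, Real.add_one_le_exp (-r)]
      _ = _ := by
          rw [Multiset.map_const', Multiset.prod_replicate, ← Real.exp_nat_mul]
          ring_nf
  have h_exp : Real.exp (-A) ≤ Real.exp (Real.log (supBound K) - r * Multiset.card Z) :=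
    calc Real.exp (-A) ≤ ‖c 0‖ := hA
      _ ≤ supBound K * (Z.map norm).prod := by
          simpa only [seriesSum_zero] using hZ.norm_seriesSum_zero_le (hc.rapidDecay hK hβ)
            fun w hw => hc.norm_seriesSum_le hK hβ hw.le
      _ ≤ supBound K * Real.exp (-(r * Multiset.card Z)) := by
          have := one_le_supBound hK
          gcongr
      _ = _ := by
          rw [sub_eq_add_neg, Real.exp_add, Real.exp_log (by linarith [one_le_supBound hK])]
  linarith [Real.exp_le_exp.1 h_exp]

lemma Decay.card_le (hK : 1 ≤ K) (hβ : 0 ≤ β) (hc : Decay K β c) (hA1 : 1 ≤ A)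
    (hA : Real.exp (-A) ≤ ‖c 0‖) {J : ℕ}
    (hJ : (2 * Real.pi * (A + Real.log (supBound K))) ^ (1 / (2 + β)) <
      threshold K / (2048 * (2 + β)) * scaleSum β J)
    (hZ : IsZeroMultiset c Z) :
    (Multiset.card Z : ℝ) ≤ 40 * (1 + Real.log (supBound K)) / maxScale K * A * 2 ^ J := by
  classical
  have hρ0 := maxScale_pos hK
  have hl : 0 ≤ Real.log (supBound K) := Real.log_nonneg (one_le_supBound hK)
  set l := Real.log (supBound K)
  set r := maxScale K / 2 ^ J with hr
  have : 0 < r := by positivity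
  have h_shallow := hc.card_le_of_one_sub_le_norm hK hβ hA hJ
    (hZ.mono (Multiset.filter_le (fun z => 1 - r / 2 ≤ ‖z‖) Z))
    fun z hz => (Multiset.mem_filter.1 hz).2
  have h_deep := hc.card_le_of_norm_le_one_sub hK hβ (r := r / 2) hA
    (hZ.mono (Multiset.filter_le (fun z => ¬1 - r / 2 ≤ ‖z‖) Z))
    fun z hz => (not_le.1 (Multiset.mem_filter.1 hz).2).le
  have h_total : r / 2 * (Multiset.card Z : ℝ) ≤ 20 * (1 + l) * A := by
    rw [← Multiset.filter_add_not (fun z => 1 - r / 2 ≤ ‖z‖) Z, Multiset.card_add, Nat.cast_add,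
      mul_add]
    have h_pi : 2 * Real.pi * (A + l) + 2 * Real.pi ≤ 8 * (A + l) + 8 := by
      nlinarith [Real.pi_lt_four]
    nlinarith
  calc (Multiset.card Z : ℝ) ≤ 20 * (1 + l) * A / (r / 2) := by rwa [le_div_iff₀' (by positivity)]
    _ = _ := by
        rw [hr]
        field_simp
        norm_num

end

/-! ### The number of scales -/

section

variable {K C A β β₀ : ℝ} {n : ℕ}

lemma natCast_le_scaleSum (hβ : 0 ≤ β) (n : ℕ) : (n : ℝ) ≤ scaleSum β n :=
  calc (n : ℝ) = ∑ _i ∈ Finset.range n, (1 : ℝ) := by simp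
    _ ≤ _ := Finset.sum_le_sum fun i _ => Real.one_le_rpow one_le_two (by positivity)

lemma exists_scaleSum_le_lt_succ (hβ : 0 ≤ β) {T : ℝ} (hT : 0 ≤ T) :
    ∃ n, scaleSum β n ≤ T ∧ T < scaleSum β (n + 1) := by
  by_contra! h
  have h_le : ∀ n, scaleSum β n ≤ T := fun n => by
    induction n with
    | zero => simpa [scaleSum] using hT
    | succ n ih => exact h n ih
  obtain ⟨n, hn⟩ := exists_nat_gt T
  linarith [natCast_le_scaleSum hβ n, h_le n]

lemma rpow_two_pi_mul_add_le {l : ℝ} (hβ : 0 ≤ β) (hA : 1 ≤ A) (hl : 0 ≤ l) :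
    (2 * Real.pi * (A + l)) ^ (1 / (2 + β)) ≤ 2 * Real.pi * (1 + l) * A ^ (1 / (2 + β)) := by
  have h_one : 1 ≤ 2 * Real.pi * (1 + l) := by nlinarith [Real.pi_gt_three]
  calc (2 * Real.pi * (A + l)) ^ (1 / (2 + β))
      ≤ (2 * Real.pi * (1 + l) * A) ^ (1 / (2 + β)) := by
        rw [mul_assoc _ (1 + l)]
        gcongr
        nlinarith
    _ = (2 * Real.pi * (1 + l)) ^ (1 / (2 + β)) * A ^ (1 / (2 + β)) :=
        Real.mul_rpow (by linarith) (by linarith)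
    _ ≤ _ := by
        gcongr
        refine Real.rpow_le_self_of_one_le h_one ?_
        rw [div_le_one (by linarith)]
        linarith

lemma exists_zeroCount_le_mul_two_pow (hK : 1 ≤ K) (hβ₀ : 0 ≤ β₀) :
    ∃ C : ℝ, 1 ≤ C ∧ ∀ β : ℝ, 0 ≤ β → β ≤ β₀ → ∀ (f : ℂ → ℂ) (c : ℕ → ℂ) (A : ℝ), Decay K β c →
      EqOn f (seriesSum c) closedDisc → 1 ≤ A → Real.exp (-A) ≤ ‖c 0‖ →
      ∃ n, scaleSum β n ≤ C * A ^ (1 / (2 + β)) ∧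
        zeroCount f ≤ ENNReal.ofReal (C * A * 2 ^ n) := by
  have := threshold_pos hK
  have := maxScale_pos hK
  have hl : 0 ≤ Real.log (supBound K) := Real.log_nonneg (one_le_supBound hK)
  set l := Real.log (supBound K)
  set C₁ := 2 * Real.pi * (1 + l) * (2048 * (2 + β₀)) / threshold K with hC₁
  set C₂ := 80 * (1 + l) / maxScale K with hC₂
  have hC₁0 : 0 ≤ C₁ := by positivity
  have hC₂0 : 0 ≤ C₂ := by positivity
  refine ⟨1 + C₁ + C₂, by linarith, fun β hβ hββ₀ f c A hc hf hA1 hA => ?_⟩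
  set M := (2 * Real.pi * (A + l)) ^ (1 / (2 + β))
  obtain ⟨n, h_le, h_lt⟩ := exists_scaleSum_le_lt_succ hβ
    (T := M / (threshold K / (2048 * (2 + β)))) (by positivity)
  rw [div_lt_iff₀' (by positivity)] at h_lt
  refine ⟨n, ?_, zeroCount_le_ofReal (hc.rapidDecay hK hβ) hf fun Z hZ => ?_⟩
  · calc scaleSum β n ≤ M / (threshold K / (2048 * (2 + β))) := h_le
      _ ≤ 2 * Real.pi * (1 + l) * A ^ (1 / (2 + β)) / (threshold K / (2048 * (2 + β₀))) := by
        gcongr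
        exact rpow_two_pi_mul_add_le hβ hA1 hl
      _ = C₁ * A ^ (1 / (2 + β)) := by
        rw [hC₁]
        field_simp
      _ ≤ _ := by
        gcongr
        linarith
  · calc (Multiset.card Z : ℝ) ≤ 40 * (1 + l) / maxScale K * A * 2 ^ (n + 1) :=
          hc.card_le hK hβ hA1 hA h_lt hZ
      _ = C₂ * A * 2 ^ n := by
        rw [hC₂, pow_succ]
        ring
      _ ≤ _ := by
        gcongr
        linarith

lemma mul_two_pow_le_exp_sqrt (hC : 1 ≤ C) (hA : 1 ≤ A) (hn : n ≤ C * √A) :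
    C * A * 2 ^ n ≤ Real.exp ((2 * C + 2) * √A) := by
  have h_sqrt : 1 ≤ √A := Real.one_le_sqrt.2 hA
  have hC_le : C ≤ Real.exp (C * √A) := by
    nlinarith [Real.add_one_le_exp (C * √A)]
  have hA_le : A ≤ Real.exp (2 * √A) := by
    calc A = √A ^ 2 := (Real.sq_sqrt (by linarith)).symm
      _ ≤ Real.exp √A ^ 2 := by
        gcongr
        linarith [Real.add_one_le_exp √A]
      _ = _ := by
        rw [← Real.exp_nat_mul]
        norm_num
  have h_pow : (2 : ℝ) ^ n ≤ Real.exp (C * √A) := by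
    calc (2 : ℝ) ^ n ≤ Real.exp 1 ^ n := by
          gcongr
          linarith [Real.add_one_le_exp 1]
      _ = Real.exp n := by rw [← Real.exp_nat_mul, mul_one]
      _ ≤ _ := Real.exp_le_exp.2 hn
  calc C * A * 2 ^ n ≤ Real.exp (C * √A) * Real.exp (2 * √A) * Real.exp (C * √A) := by gcongr
    _ = _ := by
        rw [← Real.exp_add, ← Real.exp_add]
        ring_nf

lemma one_sub_le_two_rpow_neg {s : ℝ} (hs : 0 ≤ s) : 1 - s ≤ (2 : ℝ) ^ (-s) := by
  rw [Real.rpow_def_of_pos two_pos]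
  nlinarith [Real.add_one_le_exp (Real.log 2 * -s), Real.log_two_lt_d9]

lemma two_rpow_sub_one_le {s : ℝ} (hs : 0 ≤ s) (n : ℕ) :
    (2 : ℝ) ^ (s * n) - 1 ≤ s * ∑ i ∈ Finset.range n, (2 : ℝ) ^ (s * (i + 1)) := by
  induction n with
  | zero => simp
  | succ n ih =>
    rw [Finset.sum_range_succ, mul_add]
    push_cast
    have h_step : (1 - s) * (2 : ℝ) ^ (s * (n + 1)) ≤ 2 ^ (s * n) :=
      calc (1 - s) * (2 : ℝ) ^ (s * (n + 1)) ≤ 2 ^ (-s) * 2 ^ (s * (n + 1)) := by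
            gcongr
            exact one_sub_le_two_rpow_neg hs
        _ = 2 ^ (s * n) := by
            rw [← Real.rpow_add two_pos]
            ring_nf
    linarith

lemma sub_one_le_mul_log {x : ℝ} (hx : 0 ≤ x) : x - 1 ≤ x * Real.log x := by
  linarith [InformationTheory.klFun_nonneg hx, InformationTheory.klFun_apply x]

lemma log_mul_rpow_inv (hβ : 0 < β) (hA : 0 < A) :
    Real.log (β * A ^ (1 / (2 + β))) = Real.log β + Real.log A / (2 + β) := by
  rw [Real.log_mul hβ.ne' (by positivity), Real.log_rpow hA]
  ring

lemma log_add_two_mul_log_nonneg (hβ : 0 < β) (hA : β ^ (-2 : ℤ) ≤ A) :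
    0 ≤ Real.log A + 2 * Real.log β := by
  have h_log := Real.log_le_log (by positivity) hA
  rw [Real.log_zpow] at h_log
  push_cast at h_log
  linarith

lemma one_le_exp_one_mul (hβ : 0 < β) (hA : β ^ (-2 : ℤ) ≤ A) :
    1 ≤ Real.exp 1 * (β * A ^ (1 / (2 + β))) := by
  have hA0 : 0 < A := lt_of_lt_of_le (by positivity) hA
  rw [← Real.log_nonneg_iff (by positivity), Real.log_mul (by positivity) (by positivity),
    Real.log_exp, log_mul_rpow_inv hβ hA0]
  have h_eq : 1 + (Real.log β + Real.log A / (2 + β)) =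
      (2 + β + (2 + β) * Real.log β + Real.log A) / (2 + β) := by
    field_simp
    ring
  rw [h_eq]
  exact div_nonneg (by nlinarith [sub_one_le_mul_log hβ.le, log_add_two_mul_log_nonneg hβ hA])
    (by linarith)

lemma mul_log_two_le (hC : 0 ≤ C) (hβ : 0 < β) (hA : β ^ (-2 : ℤ) ≤ A)
    (hn : scaleSum β n ≤ C * A ^ (1 / (2 + β))) :
    β * (n * Real.log 2) ≤
      (2 + β) * Real.log (Real.exp 1 + C) + (2 + β) * Real.log β + Real.log A := by
  have hA0 : 0 < A := lt_of_lt_of_le (by positivity) hA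
  set T := β * A ^ (1 / (2 + β)) with hT
  have hT0 : 0 < T := by positivity
  have h_pow : (2 : ℝ) ^ (β / (2 + β) * n) ≤ (Real.exp 1 + C) * T := by
    have h_sum : β / (2 + β) * scaleSum β n ≤ C * T :=
      calc β / (2 + β) * scaleSum β n ≤ β * (C * A ^ (1 / (2 + β))) := by
            gcongr
            · exact Finset.sum_nonneg fun i _ => by positivity
            · exact div_le_self hβ.le (by linarith)
        _ = C * T := by ring
    have h_le : (2 : ℝ) ^ (β / (2 + β) * n) - 1 ≤ β / (2 + β) * scaleSum β n :=
      two_rpow_sub_one_le (by positivity) n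
    linarith [one_le_exp_one_mul hβ hA]
  have h_log := Real.log_le_log (by positivity) h_pow
  rw [Real.log_rpow two_pos, Real.log_mul (by positivity) hT0.ne', hT,
    log_mul_rpow_inv hβ hA0] at h_log
  calc β * (n * Real.log 2) = (2 + β) * (β / (2 + β) * n * Real.log 2) := by field_simp
    _ ≤ (2 + β) * (Real.log (Real.exp 1 + C) + (Real.log β + Real.log A / (2 + β))) := by gcongr
    _ = _ := by
      field_simp
      ring

lemma mul_two_pow_eq_exp (hC : 0 < C) (hA : 0 < A) (n : ℕ) :
    C * A * 2 ^ n = Real.exp (Real.log C + Real.log A + n * Real.log 2) := by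
  rw [Real.exp_add, Real.exp_add, Real.exp_log hC, Real.exp_log hA, Real.exp_nat_mul,
    Real.exp_log two_pos]

/-- A constant `c` for which the power bounds on the number of zeros hold when `β ≤ β₀`, given the
constant `C` of `exists_zeroCount_le_mul_two_pow`. -/
noncomputable def powConst (β₀ C : ℝ) : ℝ :=
  β₀ * Real.log C + (2 + β₀) * Real.log (Real.exp 1 + C) + 1 + 2 * β₀ + β₀ ^ 2

lemma powConst_pos (hβ₀ : 0 ≤ β₀) (hC : 1 ≤ C) : 0 < powConst β₀ C := by
  have := Real.log_nonneg hC
  have := Real.log_nonneg (by linarith [Real.exp_pos 1] : 1 ≤ Real.exp 1 + C)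
  unfold powConst
  positivity

lemma mul_log_add_mul_log_add_le_powConst (hC : 1 ≤ C) (hβ : 0 ≤ β) (hβ₀ : β ≤ β₀) :
    β * Real.log C + (2 + β) * Real.log (Real.exp 1 + C) + 1 + 2 * β + β ^ 2 ≤ powConst β₀ C := by
  have := Real.log_nonneg hC
  have := Real.log_nonneg (by linarith [Real.exp_pos 1] : 1 ≤ Real.exp 1 + C)
  unfold powConst
  gcongr

lemma mul_two_pow_le_rpow_mul_rpow (hC : 1 ≤ C) (hβ : 0 < β) (hβ₀ : β ≤ β₀)
    (hA : β ^ (-2 : ℤ) ≤ A) (hn : scaleSum β n ≤ C * A ^ (1 / (2 + β))) :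
    C * A * 2 ^ n ≤ A ^ (2 / β + 1) * β ^ (4 / β + 2) * Real.exp (powConst β₀ C / β) := by
  have hA0 : 0 < A := lt_of_lt_of_le (by positivity) hA
  rw [mul_two_pow_eq_exp (by linarith) hA0, Real.rpow_def_of_pos hA0, Real.rpow_def_of_pos hβ,
    ← Real.exp_add, ← Real.exp_add, Real.exp_le_exp]
  have h_eq : Real.log A * (2 / β + 1) + Real.log β * (4 / β + 2) + powConst β₀ C / β =
      (Real.log A * (2 + β) + Real.log β * (4 + 2 * β) + powConst β₀ C) / β := by
    field_simp
  rw [h_eq, le_div_iff₀ hβ]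
  nlinarith [mul_log_two_le (by linarith) hβ hA hn,
    mul_log_add_mul_log_add_le_powConst hC hβ.le hβ₀, log_add_two_mul_log_nonneg hβ hA,
    sub_one_le_mul_log hβ.le]

lemma mul_two_pow_le_rpow (hC : 1 ≤ C) (hβ : 0 < β) (hβ₀ : β ≤ β₀) (hA : β ^ (-2 : ℤ) ≤ A)
    (hn : scaleSum β n ≤ C * A ^ (1 / (2 + β))) :
    C * A * 2 ^ n ≤ A ^ (1 / β + 1) * Real.exp (powConst β₀ C / β) := by
  have hA0 : 0 < A := lt_of_lt_of_le (by positivity) hA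
  rw [mul_two_pow_eq_exp (by linarith) hA0, Real.rpow_def_of_pos hA0, ← Real.exp_add,
    Real.exp_le_exp]
  have h_eq : Real.log A * (1 / β + 1) + powConst β₀ C / β =
      (Real.log A * (1 + β) + powConst β₀ C) / β := by
    field_simp
  rw [h_eq, le_div_iff₀ hβ]
  nlinarith [mul_log_two_le (by linarith) hβ hA hn,
    mul_log_add_mul_log_add_le_powConst hC hβ.le hβ₀, Real.log_le_sub_one_of_pos hβ]

lemma zpow_neg_two_le_of_zpow_neg_four_le (hA : 1 ≤ A) (h : β ^ (-4 : ℤ) ≤ A) :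
    β ^ (-2 : ℤ) ≤ A := by
  refine le_of_sq_le_sq ?_ (by linarith)
  calc (β ^ (-2 : ℤ)) ^ 2 = β ^ (-4 : ℤ) := by
        rw [← zpow_natCast, ← zpow_mul]
        norm_num
    _ ≤ A ^ 2 := h.trans (le_self_pow₀ hA two_ne_zero)

end

section

variable {K K' β : ℝ} {f : ℂ → ℂ}

lemma Decay.zero_left {c : ℕ → ℂ} (hK : 0 ≤ K) (hβ : 0 ≤ β) (hc : Decay K β c) :
    Decay K 0 c := by
  intro k
  refine (hc k).trans ?_
  rcases Nat.eq_zero_or_pos k with rfl | hk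
  · rw [Nat.cast_zero, Real.zero_rpow (exponent_pos hβ).ne', Real.zero_rpow (by norm_num)]
  · have h_exponent : (1 + 0) / (2 + 0) ≤ (1 + β) / (2 + β) := by
      rw [div_le_div_iff₀ (by norm_num) (by linarith)]
      linarith
    gcongr
    exact_mod_cast hk

lemma ClassAComparable.mono (hK : 0 < K) (h : K ≤ K') (hf : ClassAComparable K β f) :
    ClassAComparable K' β f := by
  have h_sub : Icc K⁻¹ K ⊆ Icc K'⁻¹ K' := Icc_subset_Icc (by gcongr) h
  obtain ⟨a, ha, a', ha', hf⟩ := hf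
  exact ⟨a, h_sub ha, a', h_sub ha', hf⟩

lemma ClassCComparable.mono (hK : 0 < K) (h : K ≤ K') (hf : ClassCComparable K β f) :
    ClassCComparable K' β f := by
  have h_sub : Icc K⁻¹ K ⊆ Icc K'⁻¹ K' := Icc_subset_Icc (by gcongr) h
  obtain ⟨d, hd, d', hd', hf⟩ := hf
  exact ⟨d, h_sub hd, d', h_sub hd', hf⟩

lemma ClassAComparable.decay (hK : 0 ≤ K) (hf : ClassAComparable K β f) :
    Decay K β (taylorCoeff f) := by
  obtain ⟨a, ⟨ha, -⟩, a', ⟨-, ha'⟩, hf⟩ := hf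
  exact fun k => (hf.coeff_le k).trans (by gcongr)

lemma ClassAComparable.eqOn_seriesSum (hK : 0 < K) (hβ : 0 ≤ β) (hf : ClassAComparable K β f) :
    EqOn f (seriesSum (taylorCoeff f)) closedDisc := by
  obtain ⟨a, ⟨ha, -⟩, _, -, hf⟩ := hf
  exact hf.eqOn_seriesSum hβ ((inv_pos.2 hK).trans_le ha)

lemma exists_classes_comparable (hK : 1 ≤ K) :
    ∃ K' : ℝ, 1 ≤ K' ∧ ∀ β : ℝ, 0 ≤ β → ∀ f : ℂ → ℂ,
      (ClassAComparable K β f → ClassCComparable K' β f) ∧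
      (ClassCComparable K β f → ClassAComparable K' β f) := by
  obtain ⟨K', hK', h⟩ := exists_classCComparable_of_classAComparable hK
  exact ⟨K' + 4 * K, by linarith, fun β hβ f =>
    ⟨fun hf => (h β hβ f hf).mono (by linarith) (by linarith),
      fun hf => (hf.classAComparable hβ hK).mono (by linarith) (by linarith)⟩⟩

lemma exists_forall_zeroCount_le {β₀ : ℝ} (hK : 1 ≤ K) (hβ₀ : 0 ≤ β₀) :
    ∃ c : ℝ, 0 < c ∧ ∀ β : ℝ, 0 ≤ β → ∀ (f : ℂ → ℂ) (A : ℝ), ClassAComparable K β f →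
      1 ≤ A → Real.exp (-A) ≤ ‖f 0‖ →
      zeroCount f ≤ ENNReal.ofReal (Real.exp (c * √A)) ∧
      (0 < β → β ≤ β₀ → β ^ (-2 : ℤ) ≤ A →
        zeroCount f ≤ ENNReal.ofReal (A ^ (2 / β + 1) * β ^ (4 / β + 2) * Real.exp (c / β)) ∧
        zeroCount f ≤ ENNReal.ofReal (A ^ (1 / β + 1) * Real.exp (c / β))) := by
  obtain ⟨C, hC, h_count⟩ := exists_zeroCount_le_mul_two_pow hK hβ₀
  have h_const := powConst_pos hβ₀ hC
  refine ⟨2 * C + 2 + powConst β₀ C, by linarith, fun β hβ f A hf hA1 hA => ?_⟩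
  have hA' : Real.exp (-A) ≤ ‖taylorCoeff f 0‖ := by simpa [taylorCoeff] using hA
  have hf_decay := hf.decay (by linarith)
  have hf_eq := hf.eqOn_seriesSum (by linarith) hβ
  refine ⟨?_, fun hβ0 hββ₀ hAβ => ?_⟩
  · obtain ⟨n, hn, hN⟩ := h_count 0 le_rfl hβ₀ f _ A (hf_decay.zero_left (by linarith) hβ) hf_eq
      hA1 hA'
    rw [add_zero, ← Real.sqrt_eq_rpow] at hn
    refine hN.trans (ENNReal.ofReal_le_ofReal ((mul_two_pow_le_exp_sqrt hC hA1
      ((natCast_le_scaleSum le_rfl n).trans hn)).trans ?_))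
    gcongr Real.exp (?_ * _)
    linarith
  · obtain ⟨n, hn, hN⟩ := h_count β hβ hββ₀ f _ A hf_decay hf_eq hA1 hA'
    have h_le : powConst β₀ C ≤ 2 * C + 2 + powConst β₀ C := by linarith
    exact ⟨hN.trans (ENNReal.ofReal_le_ofReal
        ((mul_two_pow_le_rpow_mul_rpow hC hβ0 hββ₀ hAβ hn).trans (by gcongr))),
      hN.trans (ENNReal.ofReal_le_ofReal
        ((mul_two_pow_le_rpow hC hβ0 hββ₀ hAβ hn).trans (by gcongr)))⟩

end

end Gevrey

theorem theorem1_general (K : ℝ) (hK : 1 ≤ K) :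
    (∃ K' : ℝ, 1 ≤ K' ∧ ∀ β : ℝ, 0 ≤ β → ∀ f : ℂ → ℂ,
      (Gevrey.ClassAComparable K β f → Gevrey.ClassCComparable K' β f) ∧
      (Gevrey.ClassCComparable K β f → Gevrey.ClassAComparable K' β f)) ∧
    ∀ β₀ : ℝ, 0 < β₀ → ∃ c : ℝ, 0 < c ∧ ∀ β : ℝ, 0 ≤ β → ∀ (f : ℂ → ℂ) (A : ℝ),
      (Gevrey.ClassAComparable K β f ∨ Gevrey.ClassCComparable K β f) →
      1 ≤ A → Real.exp (-A) ≤ ‖f 0‖ →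
      Gevrey.zeroCount f ≤ ENNReal.ofReal (Real.exp (c * √A)) ∧
      (0 < β → β ≤ β₀ → β ^ (-2 : ℤ) ≤ A →
        Gevrey.zeroCount f ≤
          ENNReal.ofReal (A ^ (2 / β + 1) * β ^ (4 / β + 2) * Real.exp (c / β)) ∧
        Gevrey.zeroCount f ≤ ENNReal.ofReal (A ^ (1 / β + 1) * Real.exp (c / β))) := by
  refine ⟨Gevrey.exists_classes_comparable hK, fun β₀ hβ₀ => ?_⟩
  obtain ⟨c, hc, h_count⟩ :=
    Gevrey.exists_forall_zeroCount_le (K := 4 * K) (by linarith) hβ₀.le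
  exact ⟨c, hc, fun β hβ f A hf => h_count β hβ f A <|
    hf.elim (·.mono (by linarith) (by linarith)) (·.classAComparable hβ hK)⟩

theorem theorem1 (K : ℝ) (hK : 1 ≤ K) :
    -- the two descriptions of the class with parameters comparable to `1` are equivalent
    (∀ β₀ : ℝ, 0 < β₀ → ∃ K' : ℝ, 1 ≤ K' ∧ ∀ β : ℝ, 0 ≤ β → β ≤ β₀ → ∀ f : ℂ → ℂ,
      (Gevrey.ClassAComparable K β f → Gevrey.ClassCComparable K' β f) ∧
      (Gevrey.ClassCComparable K β f → Gevrey.ClassAComparable K' β f)) ∧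
    -- the case `β = 0`
    (∃ c : ℝ, 0 < c ∧ ∀ (f : ℂ → ℂ) (A : ℝ),
      (Gevrey.ClassAComparable K 0 f ∨ Gevrey.ClassCComparable K 0 f) →
      1 ≤ A → Real.exp (-A) ≤ ‖f 0‖ →
      Gevrey.zeroCount f ≤ ENNReal.ofReal (Real.exp (c * √A))) ∧
    -- the case `0 < β ≤ β₀`
    (∀ β₀ : ℝ, 0 < β₀ → ∃ c : ℝ, 0 < c ∧ ∀ β : ℝ, 0 < β → β ≤ β₀ → ∀ (f : ℂ → ℂ) (A : ℝ),
      (Gevrey.ClassAComparable K β f ∨ Gevrey.ClassCComparable K β f) →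
      1 ≤ A → Real.exp (-A) ≤ ‖f 0‖ →
      (A ≤ β ^ (-2 : ℤ) →
        Gevrey.zeroCount f ≤ ENNReal.ofReal (Real.exp (c * √A))) ∧
      (β ^ (-2 : ℤ) ≤ A → A ≤ β ^ (-4 : ℤ) →
        Gevrey.zeroCount f ≤
          ENNReal.ofReal (A ^ (2 / β + 1) * β ^ (4 / β + 2) * Real.exp (c / β))) ∧
      (β ^ (-4 : ℤ) ≤ A →
        Gevrey.zeroCount f ≤ ENNReal.ofReal (A ^ (1 / β + 1) * Real.exp (c / β)))) := by
  obtain ⟨⟨K', hK', h_classes⟩, h_count⟩ := theorem1_general K hK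
  exact ⟨fun _ _ => ⟨K', hK', fun β hβ _ => h_classes β hβ⟩,
    (h_count 1 one_pos).imp fun _ h => ⟨h.1, fun f A hf hA1 hA => (h.2 0 le_rfl f A hf hA1 hA).1⟩,
    fun β₀ hβ₀ => (h_count β₀ hβ₀).imp fun _ h => ⟨h.1, fun β hβ hββ₀ f A hf hA1 hA =>
      have ⟨h_exp, h_pow⟩ := h.2 β hβ.le f A hf hA1 hA
      ⟨fun _ => h_exp, fun h2 _ => (h_pow hβ hββ₀ h2).1, fun h4 =>
        (h_pow hβ hββ₀ (Gevrey.zpow_neg_two_le_of_zpow_neg_four_le hA1 h4)).2⟩⟩⟩
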